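/- Let $M$ be a (Hausdorff, finite-dimensional, smooth) manifold. A quaternionic vector bundle over $M$ is a real vector bundle $E$ with structural group $\mathrm{Sp}(1)\cdot\mathrm{GL}(k,\mathbb H)$; equivalently, it is endowed with a bundle $\pi:Z\to M$ of admissible linear complex structures which, locally, is formed of the endomorphisms $aI+bJ+cK$, $a^2+b^2+c^2=1$, where $I,J,K$ are smooth sections of $\mathrm{End}(E)$ satisfying the quaternionic relations. An almost $f$-quaternionic structure on $M$ is a pair $(E,V)$, where $E$ is a quaternionic vector bundle over $M$ and $V,TM\subseteq E$ are vector subbundles such that $E=V\oplus TM$ and $JV\subseteq TM$ for any $J\in Z$. Denote by $\iota:TM\to E$ the inclusion and by $\rho:E\to TM$ the projection with kernel $V$. A connection $\nabla$ on $E$ is compatible with $(E,V)$ if it is compatible with the group of quaternionic linear isomorphisms preserving $V$ and $TM$; that is, $\nabla$ preserves the quaternionic structure of $E$ and the subbundles $V$ and $TM$. Such a $\nabla$ restricts to a connection $D$ on $M$; then $D$ is said to be compatible with $(E,V)$, and $\nabla=D^V\oplus D$ is the connection on $E$ induced by $D$. Given such a $\nabla$, consider on $Z$ the connection induced by $\nabla$,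 and, for $J\in Z$, let $E^J=\ker(J+\mathrm i)\subseteq E^{\mathbb C}_{\pi(J)}$. Let $(\ker d\pi)^{0,1}$ be taken with respect to the complex structure $A\mapsto J\circ A$ on $T_JZ_{\pi(J)}=\{A\in\mathrm{span}\,Z_{\pi(J)} : A\perp J\}$. Let $\mathcal C^{\rho}$ (respectively, $\mathcal C^{\iota}$) be the complex distribution on $Z$ which at each $J\in Z$ is the direct sum of $(\ker d\pi)^{0,1}_J$ and the horizontal lift of $\rho(E^J)$ (respectively, of $\iota^{-1}(E^J)$). The underlying almost co-CR quaternionic structure $(E,\rho,\nabla)$ (respectively, the underlying almost CR quaternionic structure $(E,\iota,\nabla)$) is integrable if the space of local smooth sections of $\mathcal C^{\rho}$ (respectively, $\mathcal C^{\iota}$) is closed under the Lie bracket. We say that $(E,V,\nabla)$ is integrable if both $(E,\rho,\nabla)$ and $(E,\iota,\nabla)$ are integrable. **Corollary 3.4.** Let $(E,V)$ be an almost $f$-quaternionic structure on $M$ and let $\nabla$ be the (smooth) connection on $E$ induced by some torsion-free connection $D$ on $M$ compatible with $(E,V)$. If either $\operatorname{rank}E>4\operatorname{rank}V\geq 8$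 or $\operatorname{rank}E=4\operatorname{rank}V\geq 12$, then $(E,V,\nabla)$ is integrable; that is, both the underlying almost co-CR quaternionic structure $(E,\rho,\nabla)$ and the underlying almost CR quaternionic structure $(E,\iota,\nabla)$ are integrable. -/

import Mathlib

open Bundle Manifold ContDiff Module

noncomputable section

namespace FQuat

/-- The unit sphere `S²` of `ℝ³`. -/
abbrev S2 : Type := Metric.sphere (0 : EuclideanSpace ℝ (Fin 3)) 1

/-! A vector `u + i v` of the complexification `W ⊗ ℂ` of a real vector space `W` is represented
by the pair of its real and imaginary parts `u, v : W`. -/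

/-- For a linear map `J` of `W`, extended complex linearly to `W ⊗ ℂ`: the vector `u + i v` lies
in `ker (J + i)`.  (Indeed `(J + i)(u + i v) = (J u - v) + i (J v + u)`.) -/
def MemKerAddI {W : Type*} [AddCommGroup W] (J : W → W) (u v : W) : Prop :=
  J u = v ∧ J v = -u

section Manifold

variable {B : Type*} [NormedAddCommGroup B] [NormedSpace ℝ B]
  {M : Type*} [TopologicalSpace M] [ChartedSpace B M]

/-! ### Complex distributions on `M × S²` -/

/-- The tangent space of `M × S²` at `z`. -/
abbrev TZ (z : M × S2) : Type _ := TangentSpace (𝓘(ℝ, B).prod (𝓡 2)) z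

/-- The component in `T M` of a tangent vector of `M × S²`. -/
def baseComp (z : M × S2) (ξ : TZ (B := B) z) : TangentSpace 𝓘(ℝ, B) z.1 :=
  mfderiv (𝓘(ℝ, B).prod (𝓡 2)) 𝓘(ℝ, B) (Prod.fst : M × S2 → M) z ξ

/-- The component in `T S² ⊆ ℝ³` of a tangent vector of `M × S²`, as a vector of `ℝ³`. -/
def sphereComp (z : M × S2) (ξ : TZ (B := B) z) : EuclideanSpace ℝ (Fin 3) :=
  mfderiv (𝓘(ℝ, B).prod (𝓡 2)) 𝓘(ℝ, EuclideanSpace ℝ (Fin 3))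
    (fun w : M × S2 => (w.2 : EuclideanSpace ℝ (Fin 3))) z ξ

variable [IsManifold 𝓘(ℝ, B) 1 M]

/-- The vector field `ζ` on `M × S²` is smooth on `Ω`. -/
def SmoothFieldOn (ζ : ∀ z : M × S2, TZ (B := B) z) (Ω : Set (M × S2)) : Prop :=
  ContMDiffOn (𝓘(ℝ, B).prod (𝓡 2)) (𝓘(ℝ, B).prod (𝓡 2)).tangent ∞
    (fun z => (⟨z, ζ z⟩ : TangentBundle (𝓘(ℝ, B).prod (𝓡 2)) (M × S2))) Ω

/-- A complex distribution `C` on the open subset `U × S²` of `M × S²` is given by the predicate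
`C z ξ₁ ξ₂`, meaning that the complex tangent vector `ξ₁ + i ξ₂` at `z` belongs to `C`.
It is *integrable* if, on every open subset of `U × S²`, the bracket of two smooth complex vector
fields which are sections of `C` is again a section of `C`, where
`[ξ₁ + i ξ₂, η₁ + i η₂] = ([ξ₁, η₁] - [ξ₂, η₂]) + i ([ξ₁, η₂] + [ξ₂, η₁])`. -/
def IntegrableDistribution (U : Set M)
    (C : ∀ z : M × S2, TZ (B := B) z → TZ (B := B) z → Prop) : Prop :=
  ∀ Ω : Set (M × S2), IsOpen Ω → (∀ z ∈ Ω, z.1 ∈ U) →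
  ∀ ξ₁ ξ₂ η₁ η₂ : ∀ z : M × S2, TZ (B := B) z,
    SmoothFieldOn ξ₁ Ω → SmoothFieldOn ξ₂ Ω → SmoothFieldOn η₁ Ω → SmoothFieldOn η₂ Ω →
    (∀ z ∈ Ω, C z (ξ₁ z) (ξ₂ z)) → (∀ z ∈ Ω, C z (η₁ z) (η₂ z)) →
    ∀ z ∈ Ω, C z
      (VectorField.mlieBracket (𝓘(ℝ, B).prod (𝓡 2)) ξ₁ η₁ z
        - VectorField.mlieBracket (𝓘(ℝ, B).prod (𝓡 2)) ξ₂ η₂ z)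
      (VectorField.mlieBracket (𝓘(ℝ, B).prod (𝓡 2)) ξ₁ η₂ z
        + VectorField.mlieBracket (𝓘(ℝ, B).prod (𝓡 2)) ξ₂ η₁ z)

variable {F : Type*} [NormedAddCommGroup F] [NormedSpace ℝ F]
  {E : M → Type*} [TopologicalSpace (TotalSpace F E)]
  [∀ x, AddCommGroup (E x)] [∀ x, Module ℝ (E x)] [∀ x, TopologicalSpace (E x)]
  [∀ x, IsTopologicalAddGroup (E x)] [∀ x, ContinuousSMul ℝ (E x)]
  [FiberBundle F E] [VectorBundle ℝ F E]

/-! ### Quaternionic vector bundles -/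

variable (B F) in
/-- Given, for each `x`, a set `Z x` of endomorphisms of `E x`: the endomorphism fields
`(𝕀 0, 𝕀 1, 𝕀 2)` form an *admissible frame* for `Z` on the open set `U`. They are smooth on `U`,
satisfy there the relations of the imaginary units of the quaternions, and
`Z x = {a₀ 𝕀 0 + a₁ 𝕀 1 + a₂ 𝕀 2 | a₀² + a₁² + a₂² = 1}` for `x` in `U`. -/
structure IsAdmissibleFrame (Z : ∀ x, Set (E x →L[ℝ] E x)) (U : Set M)
    (𝕀 : Fin 3 → ∀ x, E x →L[ℝ] E x) : Prop where
  isOpen : IsOpen U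
  smooth : ∀ j, ContMDiffOn 𝓘(ℝ, B) (𝓘(ℝ, B).prod 𝓘(ℝ, F →L[ℝ] F)) ∞
    (fun x => TotalSpace.mk' (F →L[ℝ] F) (E := fun x => E x →L[ℝ] E x) x (𝕀 j x)) U
  sq : ∀ x ∈ U, ∀ j, ∀ e, 𝕀 j x (𝕀 j x e) = -e
  mul₀₁ : ∀ x ∈ U, ∀ e, 𝕀 0 x (𝕀 1 x e) = 𝕀 2 x e
  mul₁₀ : ∀ x ∈ U, ∀ e, 𝕀 1 x (𝕀 0 x e) = -𝕀 2 x e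
  admissible : ∀ x ∈ U, Z x = {J | ∃ a : S2, J = ∑ j, a.1 j • 𝕀 j x}

variable (B F E) in
/-- A quaternionic vector bundle structure on the real vector bundle `E`, i.e. a reduction of its
structural group to `Sp(1) · GL(k, ℍ)`, given by the bundle `Z` of admissible linear complex
structures: near each point there is an admissible frame. -/
structure QuaternionicStructure where
  Z : ∀ x, Set (E x →L[ℝ] E x)
  exists_frame : ∀ x, ∃ U : Set M, x ∈ U ∧ ∃ 𝕀, IsAdmissibleFrame B F Z U 𝕀

/-! ### The twistor distributions -/

section Twistor

/-- The covariant derivative `∇_X A` at `x` of the endomorphism field `A`, characterized by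
`(∇_X A) σ = ∇_X (A σ) - A (∇_X σ)`, see `endDeriv_apply`. -/
def endDeriv (nabla : CovariantDerivative 𝓘(ℝ, B) F E) (A : ∀ x, E x →L[ℝ] E x) (x : M)
    (X : TangentSpace 𝓘(ℝ, B) x) (e : E x) : E x :=
  nabla (fun y => A y (FiberBundle.extend F e y)) x X - A x (nabla (FiberBundle.extend F e) x X)

set_option linter.unusedSectionVars false in
theorem endDeriv_apply [FiniteDimensional ℝ F] [ContMDiffVectorBundle 1 F E 𝓘(ℝ, B)]
    (nabla : CovariantDerivative 𝓘(ℝ, B) F E) (A : ∀ x, E x →L[ℝ] E x) (x : M)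
    (hA : MDifferentiableAt 𝓘(ℝ, B) (𝓘(ℝ, B).prod 𝓘(ℝ, F →L[ℝ] F))
      (fun x => TotalSpace.mk' (F →L[ℝ] F) (E := fun x => E x →L[ℝ] E x) x (A x)) x)
    (X : TangentSpace 𝓘(ℝ, B) x) (σ : ∀ x, E x)
    (hσ : MDifferentiableAt 𝓘(ℝ, B) (𝓘(ℝ, B).prod 𝓘(ℝ, F)) (fun x => TotalSpace.mk' F x (σ x)) x) :
    endDeriv nabla A x X (σ x) = nabla (fun y => A y (σ y)) x X - A x (nabla σ x X) := by
  have hAσ : ∀ τ : ∀ x, E x,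
      MDifferentiableAt 𝓘(ℝ, B) (𝓘(ℝ, B).prod 𝓘(ℝ, F)) (fun x => TotalSpace.mk' F x (τ x)) x →
      MDifferentiableAt 𝓘(ℝ, B) (𝓘(ℝ, B).prod 𝓘(ℝ, F))
        (fun x => TotalSpace.mk' F x (A x (τ x))) x :=
    fun τ hτ => MDifferentiableAt.clm_bundle_apply hA hτ
  have hT : TensorialAt 𝓘(ℝ, B) F
      (fun τ : ∀ x, E x => nabla (fun y => A y (τ y)) x X - A x (nabla τ x X)) x := by
    constructor
    · intro f τ hf hτ
      have h1 : (fun y => A y ((f • τ) y)) = f • (fun y => A y (τ y)) := by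
        funext y; simp
      rw [h1, nabla.isCovariantDerivativeOnUniv.leibniz (hAσ τ hτ) hf,
        nabla.isCovariantDerivativeOnUniv.leibniz hτ hf]
      simp
      module
    · intro τ τ' hτ hτ'
      have h1 : (fun y => A y ((τ + τ') y)) = (fun y => A y (τ y)) + (fun y => A y (τ' y)) := by
        funext y; simp
      rw [h1, nabla.isCovariantDerivativeOnUniv.add (hAσ τ hτ) (hAσ τ' hτ'),
        nabla.isCovariantDerivativeOnUniv.add hτ hτ']
      simp
      abel
  exact hT.pointwise (FiberBundle.mdifferentiableAt_extend ..) hσ (by simp)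

/-- An admissible frame on `U` identifies the restriction to `U` of the bundle of admissible linear
complex structures with `U × S²`: the point `(x, a)` corresponds to `a₀ 𝕀 0 + a₁ 𝕀 1 + a₂ 𝕀 2`. -/
def structureAt (𝕀 : Fin 3 → ∀ x, E x →L[ℝ] E x) (a : S2) (x : M) : E x →L[ℝ] E x :=
  ∑ j, a.1 j • 𝕀 j x

/-- The vertical part, with respect to the connection induced by `∇` on the bundle of admissible
linear complex structures (identified with `U × S²` by the frame `𝕀`), of the tangent vector `ξ` at
`z = (x, a)`. As the fibres are submanifolds of the vector spaces `End (E x)`, this is an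
endomorphism of `E x`, namely `∑ (dξ a_j) 𝕀 j + ∑ a_j ∇_X (𝕀 j)` where `X` is the projection
of `ξ` on `M`. The horizontal vectors are those with zero vertical part. -/
def verticalPart (nabla : CovariantDerivative 𝓘(ℝ, B) F E) (𝕀 : Fin 3 → ∀ x, E x →L[ℝ] E x)
    (z : M × S2) (ξ : TZ (B := B) z) (e : E z.1) : E z.1 :=
  ∑ j, sphereComp z ξ j • 𝕀 j z.1 e
    + endDeriv nabla (structureAt 𝕀 z.2) z.1 (baseComp z ξ) e

/-- The vertical part of the complex tangent vector `ξ₁ + i ξ₂` is in `(ker dπ)^{0,1}`. The fibre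
of the bundle of admissible complex structures is the unit sphere of an oriented three-dimensional
Euclidean space; its complex structure at `J` is `A ↦ J ∘ A`, hence the `(0,1)` vectors are the
complex endomorphisms `A` with `J ∘ A = -i A`. -/
def VerticalPartZeroOne (nabla : CovariantDerivative 𝓘(ℝ, B) F E)
    (𝕀 : Fin 3 → ∀ x, E x →L[ℝ] E x) (z : M × S2) (ξ₁ ξ₂ : TZ (B := B) z) : Prop :=
  ∀ e : E z.1, MemKerAddI (structureAt 𝕀 z.2 z.1)
    (verticalPart nabla 𝕀 z ξ₁ e) (verticalPart nabla 𝕀 z ξ₂ e)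

/-- The distribution `C = (ker dπ)^{0,1} ⊕ B` of the almost co-CR quaternionic structure `(E, ρ)`
and the connection `∇`, where `B_J` is the horizontal lift of `ρ (ker (J + i))`. -/
def CoCRDistribution (nabla : CovariantDerivative 𝓘(ℝ, B) F E)
    (ρ : ∀ x, E x →ₗ[ℝ] TangentSpace 𝓘(ℝ, B) x) (𝕀 : Fin 3 → ∀ x, E x →L[ℝ] E x)
    (z : M × S2) (ξ₁ ξ₂ : TZ (B := B) z) : Prop :=
  (∃ e₁ e₂ : E z.1, MemKerAddI (structureAt 𝕀 z.2 z.1) e₁ e₂ ∧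
    baseComp z ξ₁ = ρ z.1 e₁ ∧ baseComp z ξ₂ = ρ z.1 e₂) ∧
  VerticalPartZeroOne nabla 𝕀 z ξ₁ ξ₂

/-- The distribution `C = (ker dπ)^{0,1} ⊕ B` of the almost CR quaternionic structure `(E, ι)`
and the connection `∇`, where `B_J` is the horizontal lift of `ι⁻¹ (ker (J + i))`. -/
def CRDistribution (nabla : CovariantDerivative 𝓘(ℝ, B) F E)
    (ι : ∀ x, TangentSpace 𝓘(ℝ, B) x →L[ℝ] E x) (𝕀 : Fin 3 → ∀ x, E x →L[ℝ] E x)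
    (z : M × S2) (ξ₁ ξ₂ : TZ (B := B) z) : Prop :=
  MemKerAddI (structureAt 𝕀 z.2 z.1) (ι z.1 (baseComp z ξ₁)) (ι z.1 (baseComp z ξ₂)) ∧
  VerticalPartZeroOne nabla 𝕀 z ξ₁ ξ₂

/-- `(E, ρ, ∇)` is integrable (co-CR quaternionic): the distribution `C` on the bundle of admissible
linear complex structures is integrable. This is a local condition, expressed in the local
trivializations of that bundle given by the admissible frames. -/
def CoCRIntegrable (S : QuaternionicStructure B F E) (ρ : ∀ x, E x →ₗ[ℝ] TangentSpace 𝓘(ℝ, B) x)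
    (nabla : CovariantDerivative 𝓘(ℝ, B) F E) : Prop :=
  ∀ (U : Set M) (𝕀 : Fin 3 → ∀ x, E x →L[ℝ] E x), IsAdmissibleFrame B F S.Z U 𝕀 →
    IntegrableDistribution U (CoCRDistribution nabla ρ 𝕀)

/-- `(E, ι, ∇)` is integrable (CR quaternionic): the distribution `C` on the bundle of admissible
linear complex structures is integrable. -/
def CRIntegrable (S : QuaternionicStructure B F E) (ι : ∀ x, TangentSpace 𝓘(ℝ, B) x →L[ℝ] E x)
    (nabla : CovariantDerivative 𝓘(ℝ, B) F E) : Prop :=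
  ∀ (U : Set M) (𝕀 : Fin 3 → ∀ x, E x →L[ℝ] E x), IsAdmissibleFrame B F S.Z U 𝕀 →
    IntegrableDistribution U (CRDistribution nabla ι 𝕀)

end Twistor

/-! ### Almost `f`-quaternionic structures -/

variable (B F E) in
/-- An almost `f`-quaternionic structure `(E, V)` on `M`: a quaternionic vector bundle `E`, with
`V` and `T M` (embedded by `ι`) smooth vector subbundles such that `E = V ⊕ T M` and `J V ⊆ T M`
for every admissible linear complex structure `J`. -/
structure AlmostFQuaternionic
    extends QuaternionicStructure (M := M) B F E where
  V : ∀ x, Submodule ℝ (E x)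
  V_smooth : ∀ x, ∃ U : Set M, IsOpen U ∧ x ∈ U ∧ ∃ (n : ℕ) (s : Fin n → ∀ y, E y),
    (∀ j, ContMDiffOn 𝓘(ℝ, B) (𝓘(ℝ, B).prod 𝓘(ℝ, F)) ∞
      (fun y => TotalSpace.mk' F y (s j y)) U) ∧
    ∀ y ∈ U, LinearIndependent ℝ (fun j => s j y) ∧
      Submodule.span ℝ (Set.range fun j => s j y) = V y
  ι : ∀ x, TangentSpace 𝓘(ℝ, B) x →L[ℝ] E x
  ι_smooth : ContMDiff 𝓘(ℝ, B) (𝓘(ℝ, B).prod 𝓘(ℝ, B →L[ℝ] F)) ∞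
    (fun x => TotalSpace.mk' (B →L[ℝ] F)
      (E := fun x => TangentSpace 𝓘(ℝ, B) x →L[ℝ] E x) x (ι x))
  ι_injective : ∀ x, Function.Injective (ι x)
  isCompl : ∀ x, IsCompl (LinearMap.range (ι x).toLinearMap) (V x)
  J_mem : ∀ x, ∀ J ∈ Z x, ∀ v ∈ V x, J v ∈ LinearMap.range (ι x).toLinearMap

namespace AlmostFQuaternionic

variable (S : AlmostFQuaternionic (M := M) B F E)

/-- The projection `ρ : E → T M` with kernel `V`. -/
def ρ (x : M) : E x →ₗ[ℝ] TangentSpace 𝓘(ℝ, B) x :=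
  (LinearEquiv.ofInjective (S.ι x).toLinearMap (S.ι_injective x)).symm.toLinearMap ∘ₗ
    Submodule.projectionOnto _ _ (S.isCompl x)

theorem ρ_ι (x : M) (X : TangentSpace 𝓘(ℝ, B) x) : S.ρ x (S.ι x X) = X := by
  have h := Submodule.projectionOnto_apply_of_mem_left (S.isCompl x)
    (LinearMap.mem_range_self (S.ι x).toLinearMap X)
  simp only [ρ, LinearMap.comp_apply]
  erw [h]
  exact (LinearEquiv.symm_apply_eq _).2 rfl

theorem ρ_V (x : M) (v : E x) (hv : v ∈ S.V x) : S.ρ x v = 0 := by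
  simp [ρ, hv]

/-- The connection `∇` on `E` is compatible with the structural group of `(E, V)`, i.e. with the
group of quaternionic linear isomorphisms which preserve `V` and `T M`: the subbundle of `End E`
generated by the admissible linear complex structures, `V` and `T M` are preserved by `∇`. -/
structure IsCompatible (nabla : CovariantDerivative 𝓘(ℝ, B) F E) : Prop where
  quaternionic : ∀ (U : Set M) (𝕀 : Fin 3 → ∀ x, E x →L[ℝ] E x),
    IsAdmissibleFrame B F S.Z U 𝕀 → ∀ x ∈ U, ∀ (X : TangentSpace 𝓘(ℝ, B) x) (j : Fin 3),
      ∃ c : Fin 3 → ℝ, ∀ e, endDeriv nabla (𝕀 j) x X e = ∑ k, c k • 𝕀 k x e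
  preserves_V : ∀ (σ : ∀ x, E x) (x : M),
    MDifferentiableAt 𝓘(ℝ, B) (𝓘(ℝ, B).prod 𝓘(ℝ, F)) (fun x => TotalSpace.mk' F x (σ x)) x →
    (∀ᶠ y in nhds x, σ y ∈ S.V y) → ∀ X : TangentSpace 𝓘(ℝ, B) x, nabla σ x X ∈ S.V x
  preserves_T : ∀ (σ : ∀ x, E x) (x : M),
    MDifferentiableAt 𝓘(ℝ, B) (𝓘(ℝ, B).prod 𝓘(ℝ, F)) (fun x => TotalSpace.mk' F x (σ x)) x →
    (∀ᶠ y in nhds x, σ y ∈ LinearMap.range (S.ι y).toLinearMap) →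
    ∀ X : TangentSpace 𝓘(ℝ, B) x, nabla σ x X ∈ LinearMap.range (S.ι x).toLinearMap

/-- The connection `D` on `M` is compatible with `(E, V)` and `∇` is the connection on `E` induced
by it: `∇` is compatible with `(E, V)` and restricts to `D` on `T M`. Then `∇ = D^V ⊕ D`. -/
structure IsInducedBy (nabla : CovariantDerivative 𝓘(ℝ, B) F E)
    (D : CovariantDerivative 𝓘(ℝ, B) B (TangentSpace 𝓘(ℝ, B) : M → Type _)) : Prop where
  compatible : S.IsCompatible nabla
  restrict : ∀ (Y : ∀ x : M, TangentSpace 𝓘(ℝ, B) x) (x : M),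
    MDifferentiableAt 𝓘(ℝ, B) 𝓘(ℝ, B).tangent
      (fun x => (⟨x, Y x⟩ : TangentBundle 𝓘(ℝ, B) M)) x →
    ∀ X : TangentSpace 𝓘(ℝ, B) x, nabla (fun y => S.ι y (Y y)) x X = S.ι x (D Y x X)

/-- `(E, V, ∇)` is integrable: the underlying almost co-CR quaternionic structure `(E, ρ)` and the
underlying almost CR quaternionic structure `(E, ι)`, with the connection `∇`, are integrable. -/
def IsIntegrable (nabla : CovariantDerivative 𝓘(ℝ, B) F E) : Prop :=
  CoCRIntegrable S.toQuaternionicStructure S.ρ nabla ∧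
  CRIntegrable S.toQuaternionicStructure S.ι nabla

end AlmostFQuaternionic

end Manifold

end FQuat

end

/-! Let `J` denote a point of the twistor space, and also the tautological section of the pull back
of `End E` to it. An admissible frame identifies the twistor space over `U` with `U × S²`, and the
vertical part of a tangent vector `ξ` is then `∇_ξ J`. A complex field `ξ` lies in one of the two
distributions when `J ∘ ∇_ξ J = -√-1 ∇_ξ J` and its base component is `ρ e`, respectively has image
`e` under `ι`, for some `e` in `ker (J + √-1)`. Both cases have the common form `P e = ι (dπ ξ)`,
where `P` is a parallel endomorphism of `E`: the projection on `T M` in the co-CR case, the identity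
in the CR case.

Let `ξ`, `η` be two such fields, with lifts `e`, `f`. Since `D` is torsion-free and `P` is parallel,
`∇_ξ f - ∇_η e` is a lift of `[ξ, η]` (`apply_mlieBracket`), and by the Leibniz rule it stays in
`ker (J + √-1)`. The vertical part of the bracket is given by the Ricci identity
(`covHom_mlieBracket`). All its terms have type `(0,1)` except perhaps `[R(ξ, η), J]`. Integrability
is thus reduced (`twistor_bracket`) to an algebraic property of the curvature: `[R(x, y), J]` has
type `(0,1)` when `x`, `y` are in the image under `ρ` of `ker (J + √-1)`.

This property (`curvature_zeroOne`) follows from the first Bianchi identity. Complete `J = i` to a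
quaternionic frame `i, j, k`. Then `T M = iV ⊕ jV ⊕ kV ⊕ W`, where `W` is the largest quaternionic
subspace of `T M`. The curvature preserves `V`, `W` and `iV ⊕ jV ⊕ kV`, and rotates `i, j, k`
infinitesimally with coefficients `s₁, s₂, s₃`. The components of the Bianchi identity in this
splitting are linear relations among vectors of `V` whose coefficients are values of the `s_l`. If
`rank E > 4 rank V` then `W ≠ 0`, and two independent vectors of `V` suffice to make all `s_l`
vanish (`coeffs_eq_zero`). If `rank E = 4 rank V` then `W = 0`, and three independent vectors of `V`
leave only a part of the `s_l`, which is compatible with the type condition (`coeffs_of_generated`).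
These are the two alternatives on the ranks.

One regularity question remains. The co-CR condition provides the lift `e` only pointwise, but `J V
⊆ T M` determines its `V`-part from the base component of `ξ`, so that the lift is differentiable
(`isLiftable_of_coCRDistribution`). -/

noncomputable section
namespace FQuat

/-! ### Algebra of the curvature: the splitting `V ⊕ iV ⊕ jV ⊕ kV ⊕ W` and the Bianchi identity. -/

section LinearAlgebra

variable {F : Type*} [AddCommGroup F] [Module ℝ F]

/-- The endomorphisms `i, j, k` satisfy the relations of the quaternion units. -/
structure IsQuatFrame (i j k : End ℝ F) : Prop where
  ii : ∀ x, i (i x) = -x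
  jj : ∀ x, j (j x) = -x
  ij : ∀ x, i (j x) = k x
  ji : ∀ x, j (i x) = -k x

namespace IsQuatFrame

variable {i j k : End ℝ F} (h : IsQuatFrame i j k)
include h

theorem ik (x : F) : i (k x) = -j x := by rw [← h.ij, h.ii]

theorem jk (x : F) : j (k x) = i x := by
  have := h.ji (j x)
  rw [h.ij, ← h.ij (j x), h.jj] at this
  simpa using this

theorem kj (x : F) : k (j x) = -i x := by rw [← h.ij, h.jj, map_neg]

theorem ki (x : F) : k (i x) = j x := by
  have := h.ji (i x)
  rw [h.ii] at this
  simpa using this.symm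

theorem kk (x : F) : k (k x) = -x := by rw [← h.ij (k x), h.jk, h.ii]

theorem rotate : IsQuatFrame j k i where
  ii := h.jj
  jj := h.kk
  ij := h.jk
  ji := h.kj

end IsQuatFrame

/-- The algebraic properties of the curvature `R` of a torsion-free connection compatible with an
almost `f`-quaternionic structure: `P` is the projection of the quaternionic vector space `F` on
`T M` with kernel `V`, and `[R x y, -]` is the infinitesimal rotation of the imaginary quaternions
with components `s₁, s₂, s₃`. -/
structure IsFQuatCurvature (i j k P : End ℝ F) (R : F →ₗ[ℝ] F →ₗ[ℝ] End ℝ F)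
    (s₁ s₂ s₃ : End ℝ F →ₗ[ℝ] ℝ) : Prop where
  frame : IsQuatFrame i j k
  proj : ∀ x, P (P x) = P x
  proj_i : ∀ v, P v = 0 → P (i v) = i v
  proj_j : ∀ v, P v = 0 → P (j v) = j v
  proj_k : ∀ v, P v = 0 → P (k v) = k v
  swap : ∀ x y, R x y = -R y x
  left_proj : ∀ x y, R (P x) y = R x y
  comm_proj : ∀ x y z, R x y (P z) = P (R x y z)
  bianchi : ∀ x y z, R x y (P z) + R y z (P x) + R z x (P y) = 0
  apply_i : ∀ x y z, R x y (i z) = i (R x y z) + s₃ (R x y) • j z - s₂ (R x y) • k z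
  apply_j : ∀ x y z, R x y (j z) = j (R x y z) + s₁ (R x y) • k z - s₃ (R x y) • i z
  apply_k : ∀ x y z, R x y (k z) = k (R x y z) + s₂ (R x y) • i z - s₁ (R x y) • j z

/-- The vectors of the largest quaternionic subspace of the range of the projection `P`. -/
structure IsHoriz (i j k P : End ℝ F) (w : F) : Prop where
  one : P w = w
  i : P (i w) = i w
  j : P (j w) = j w
  k : P (k w) = k w

/-- The linear independence of two vectors. -/
def Indep2 (v w : F) : Prop := ∀ a b : ℝ, a • v + b • w = 0 → a = 0 ∧ b = 0

/-- The linear independence of three vectors. -/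
def Indep3 (u v w : F) : Prop :=
  ∀ a b c : ℝ, a • u + b • v + c • w = 0 → a = 0 ∧ b = 0 ∧ c = 0

namespace IsFQuatCurvature

variable {i j k P : End ℝ F} {R : F →ₗ[ℝ] F →ₗ[ℝ] End ℝ F} {s₁ s₂ s₃ : End ℝ F →ₗ[ℝ] ℝ}

/-- The hypotheses are invariant under cyclic permutation of the units, so each relation below need
be proved for only one unit or pair of units. -/
theorem rotate (h : IsFQuatCurvature i j k P R s₁ s₂ s₃) :
    IsFQuatCurvature j k i P R s₂ s₃ s₁ where
  frame := h.frame.rotate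
  proj := h.proj
  proj_i := h.proj_j
  proj_j := h.proj_k
  proj_k := h.proj_i
  swap := h.swap
  left_proj := h.left_proj
  comm_proj := h.comm_proj
  bianchi := h.bianchi
  apply_i := h.apply_j
  apply_j := h.apply_k
  apply_k := h.apply_i

theorem horiz_rotate {w : F} (hw : IsHoriz i j k P w) : IsHoriz j k i P w :=
  ⟨hw.one, hw.j, hw.k, hw.i⟩

variable (h : IsFQuatCurvature i j k P R s₁ s₂ s₃)
include h

theorem right_proj (x y : F) : R x (P y) = R x y := by
  rw [h.swap, h.left_proj, ← h.swap]

theorem apply_mem_ker {v : F} (hv : P v = 0) (x y : F) : P (R x y v) = 0 := by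
  rw [← h.comm_proj, hv, map_zero]

/-- `i (R x y w)` differs from `R x y (i w)` by a combination of `j w` and `k w`, and all three are
fixed by `P` because `R x y` commutes with `P`. -/
theorem horiz_apply {w : F} (hw : IsHoriz i j k P w) (x y : F) : IsHoriz i j k P (R x y w) where
  one := by rw [← h.comm_proj, hw.one]
  i := by
    have h1 : i (R x y w) = R x y (i w) - s₃ (R x y) • j w + s₂ (R x y) • k w := by
      rw [h.apply_i]; abel
    rw [h1, map_add, map_sub, ← h.comm_proj, map_smul, map_smul, hw.i, hw.j, hw.k]
  j := by
    have h1 : j (R x y w) = R x y (j w) - s₁ (R x y) • k w + s₃ (R x y) • i w := by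
      rw [h.apply_j]; abel
    rw [h1, map_add, map_sub, ← h.comm_proj, map_smul, map_smul, hw.i, hw.j, hw.k]
  k := by
    have h1 : k (R x y w) = R x y (k w) - s₂ (R x y) • i w + s₁ (R x y) • j w := by
      rw [h.apply_k]; abel
    rw [h1, map_add, map_sub, ← h.comm_proj, map_smul, map_smul, hw.i, hw.j, hw.k]

/-- The image of the vector under `i` is `-v₁ + k v₂ - j v₃`; `P` kills `v₁` and fixes the other two
terms, so the image can be tangent only if `v₁ = 0`. The units `j` and `k` deal with `v₂` and `v₃`
in the same way. This is the directness of the splitting, and turns each Bianchi identity below into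
separate relations in `V`. -/
theorem eq_zero_of_horiz {v₁ v₂ v₃ : F} (h₁ : P v₁ = 0) (h₂ : P v₂ = 0) (h₃ : P v₃ = 0)
    (hw : IsHoriz i j k P (i v₁ + j v₂ + k v₃)) : v₁ = 0 ∧ v₂ = 0 ∧ v₃ = 0 := by
  have hi := hw.i
  have hj := hw.j
  have hk := hw.k
  simp only [map_add, h.frame.ii, h.frame.ij, h.frame.ik, h.frame.ji, h.frame.jj, h.frame.jk,
    h.frame.ki, h.frame.kj, h.frame.kk, map_neg, h.proj_i _ h₂, h.proj_i _ h₃,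
    h.proj_j _ h₁, h.proj_j _ h₃, h.proj_k _ h₁, h.proj_k _ h₂, h₁, h₂, h₃] at hi hj hk
  refine ⟨?_, ?_, ?_⟩
  · simpa using hi
  · simpa using hj
  · simpa using hk

omit h in
theorem horiz_zero : IsHoriz i j k P (0 : F) := by constructor <;> simp

theorem eq_zero_of_add_eq_zero {v₁ v₂ v₃ : F} (h₁ : P v₁ = 0) (h₂ : P v₂ = 0) (h₃ : P v₃ = 0)
    (hw : i v₁ + j v₂ + k v₃ = 0) : v₁ = 0 ∧ v₂ = 0 ∧ v₃ = 0 :=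
  h.eq_zero_of_horiz h₁ h₂ h₃ (by rw [hw]; exact horiz_zero)

/-- `v₁`, `v₂`, `v₃` are minus the `V`-components of `i t`, `j t`, `k t`. Subtracting `i v₁` from
`t` cancels the `V`-component of `i t`, while `j v₂` and `k v₃` are sent by `i` into `k V` and `j
V`, which are tangent. -/
theorem exists_decomp {t : F} (ht : P t = t) : ∃ v₁ v₂ v₃ w : F,
    P v₁ = 0 ∧ P v₂ = 0 ∧ P v₃ = 0 ∧ IsHoriz i j k P w ∧ t = i v₁ + j v₂ + k v₃ + w := by
  have hQ : ∀ y, P (P y - y) = 0 := fun y => by rw [map_sub, h.proj, sub_self]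
  refine ⟨P (i t) - i t, P (j t) - j t, P (k t) - k t,
    t - i (P (i t) - i t) - j (P (j t) - j t) - k (P (k t) - k t), hQ _, hQ _, hQ _, ?_, by abel⟩
  obtain ⟨v₁, hv₁⟩ : ∃ v, v = P (i t) - i t := ⟨_, rfl⟩
  obtain ⟨v₂, hv₂⟩ : ∃ v, v = P (j t) - j t := ⟨_, rfl⟩
  obtain ⟨v₃, hv₃⟩ : ∃ v, v = P (k t) - k t := ⟨_, rfl⟩
  have h₁ : P v₁ = 0 := hv₁ ▸ hQ _
  have h₂ : P v₂ = 0 := hv₂ ▸ hQ _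
  have h₃ : P v₃ = 0 := hv₃ ▸ hQ _
  have e₁ : P (i t) = i t + v₁ := by rw [hv₁]; abel
  have e₂ : P (j t) = j t + v₂ := by rw [hv₂]; abel
  have e₃ : P (k t) = k t + v₃ := by rw [hv₃]; abel
  rw [← hv₁, ← hv₂, ← hv₃]
  constructor <;>
  · simp only [map_sub, h.frame.ii, h.frame.ij, h.frame.ik, h.frame.ji, h.frame.jj, h.frame.jk,
      h.frame.ki, h.frame.kj, h.frame.kk, map_neg, h.proj_i _ h₁, h.proj_i _ h₂, h.proj_i _ h₃,
      h.proj_j _ h₁, h.proj_j _ h₂, h.proj_j _ h₃, h.proj_k _ h₁, h.proj_k _ h₂,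
      h.proj_k _ h₃, h₁, h₂, h₃, e₁, e₂, e₃, ht]
    try abel

/-! ### The case when `F` is not generated by `V` -/

/-- If a vector of `i V + j V + k V` is also in the largest quaternionic subspace of `T M`,
then it is zero; applied to the Bianchi identity. -/
theorem apply_horiz_eq_zero {x y w : F} {v₁ v₂ v₃ : F} (h₁ : P v₁ = 0) (h₂ : P v₂ = 0)
    (h₃ : P v₃ = 0) (hw : IsHoriz i j k P w) (hx : R x y w = i v₁ + j v₂ + k v₃) : R x y w = 0 := by
  obtain ⟨rfl, rfl, rfl⟩ := h.eq_zero_of_horiz h₁ h₂ h₃ (hx ▸ h.horiz_apply hw x y)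
  simp [hx]

/-- In the Bianchi identity for `x, y, i v` the two terms applied to `x` and `y` are in `W`. Hence
so is `R x y (i v)`, which is also in `iV + jV + kV` with `j`- and `k`-components `s₃ v` and `-s₂
v`; these therefore vanish. -/
theorem horiz_horiz {x y v : F} (hx : IsHoriz i j k P x) (hy : IsHoriz i j k P y)
    (hv : P v = 0) (hv0 : v ≠ 0) : s₂ (R x y) = 0 ∧ s₃ (R x y) = 0 := by
  have hb := h.bianchi x y (i v)
  rw [hx.one, hy.one, h.proj_i v hv, h.apply_i] at hb
  have h1 := h.horiz_apply hx y (i v)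
  have h2 := h.horiz_apply hy (i v) x
  have e : i (R x y v) + j (s₃ (R x y) • v) + k (-s₂ (R x y) • v)
      = -R y (i v) x - R (i v) x y := by
    rw [map_smul, map_smul, neg_smul]
    linear_combination (norm := module) hb
  obtain ⟨-, h3, h4⟩ := h.eq_zero_of_horiz (v₁ := R x y v) (v₂ := s₃ (R x y) • v)
    (v₃ := -s₂ (R x y) • v) (h.apply_mem_ker hv x y) (by simp [hv]) (by simp [hv]) (by
      rw [e]
      constructor
      · rw [map_sub, map_neg, h1.one, h2.one]
      · rw [map_sub, map_neg, map_sub, map_neg, h1.i, h2.i]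
      · rw [map_sub, map_neg, map_sub, map_neg, h1.j, h2.j]
      · rw [map_sub, map_neg, map_sub, map_neg, h1.k, h2.k])
  simp only [smul_eq_zero, hv0, or_false, neg_eq_zero] at h3 h4
  exact ⟨h4, h3⟩

/-- By the Bianchi identity, `R x (i v) t - R x t (i v)` is the negative of a curvature applied to
`x`, so it is in `W`. For `t` in `iV + jV + kV` its components along `i`, `j`, `k` thus vanish, and
the independence of `v` and `w` separates the coefficients. -/
theorem horiz_i {x v w : F} (hx : IsHoriz i j k P x) (hv : P v = 0) (hw : P w = 0)
    (hvw : Indep2 v w) : s₁ (R x (i v)) = 0 ∧ s₂ (R x (i v)) = 0 ∧ s₃ (R x (i v)) = 0 := by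
  have key : ∀ t : F, P t = t → ∀ a₁ a₂ a₃ : F, P a₁ = 0 → P a₂ = 0 → P a₃ = 0 →
      R x (i v) t - R x t (i v) = i a₁ + j a₂ + k a₃ → a₁ = 0 ∧ a₂ = 0 ∧ a₃ = 0 := by
    intro t ht a₁ a₂ a₃ h₁ h₂ h₃ he
    have hb := h.bianchi x (i v) t
    rw [hx.one, h.proj_i v hv, ht, h.swap t x] at hb
    have h1 := h.horiz_apply hx (i v) t
    refine h.eq_zero_of_horiz h₁ h₂ h₃ ?_
    have e : i a₁ + j a₂ + k a₃ = - R (i v) t x := by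
      rw [← he]
      simp only [LinearMap.neg_apply] at hb
      linear_combination (norm := module) hb
    rw [e]
    constructor
    · rw [map_neg, h1.one]
    · rw [map_neg, map_neg, h1.i]
    · rw [map_neg, map_neg, h1.j]
    · rw [map_neg, map_neg, h1.k]
  have hR := @apply_mem_ker _ _ _ _ _ _ _ _ _ _ _ h
  obtain ⟨-, k1, k2⟩ := key (i w) (h.proj_i w hw) (R x (i v) w - R x (i w) v)
    (s₃ (R x (i v)) • w - s₃ (R x (i w)) • v) (-s₂ (R x (i v)) • w + s₂ (R x (i w)) • v)
    (by simp [hR hv, hR hw]) (by simp [hv, hw]) (by simp [hv, hw]) (by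
      rw [h.apply_i, h.apply_i]; simp only [map_sub, map_add, map_smul, neg_smul, map_neg]; abel)
  -- The commutator with `i` does not involve `s₁`; this coefficient is reached by testing on `j w`
  -- and reading the `k`-component.
  obtain ⟨-, -, k3⟩ := key (j w) (h.proj_j w hw) (-s₃ (R x (i v)) • w - R x (j w) v)
    (R x (i v) w - s₃ (R x (j w)) • v) (s₁ (R x (i v)) • w + s₂ (R x (j w)) • v)
    (by simp [hR hv, hw]) (by simp [hv, hR hw]) (by simp [hv, hw]) (by
      rw [h.apply_i, h.apply_j]; simp only [map_sub, map_add, map_smul, neg_smul, map_neg]; abel)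
  refine ⟨(hvw (s₂ (R x (j w))) _ (by rw [← k3]; abel)).2, ?_, ?_⟩
  · simpa using (hvw (s₂ (R x (i w))) (-s₂ (R x (i v))) (by rw [← k2]; abel)).2
  · exact (hvw (-s₃ (R x (i w))) (s₃ (R x (i v))) (by rw [← k1, neg_smul]; abel)).2

/-- By the Bianchi identity `R x y` maps `W` into `iV + jV + kV`, hence, preserving `W`, vanishes on
it. Comparing its values on `z` and on `i z`, both zero, leaves `s₃ j z = s₂ k z`. -/
theorem vert_vert {z x y : F}  (hz : IsHoriz i j k P z) (hz0 : z ≠ 0)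
    (hx : ∃ v₁ v₂ v₃, P v₁ = 0 ∧ P v₂ = 0 ∧ P v₃ = 0 ∧ x = i v₁ + j v₂ + k v₃)
    (hy : ∃ v₁ v₂ v₃, P v₁ = 0 ∧ P v₂ = 0 ∧ P v₃ = 0 ∧ y = i v₁ + j v₂ + k v₃) :
    s₂ (R x y) = 0 ∧ s₃ (R x y) = 0 := by
  have hR := @apply_mem_ker _ _ _ _ _ _ _ _ _ _ _ h
  have hP : ∀ x, (∃ v₁ v₂ v₃, P v₁ = 0 ∧ P v₂ = 0 ∧ P v₃ = 0 ∧ x = i v₁ + j v₂ + k v₃) →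
      P x = x := by
    rintro x ⟨v₁, v₂, v₃, h₁, h₂, h₃, rfl⟩
    rw [map_add, map_add, h.proj_i _ h₁, h.proj_j _ h₂, h.proj_k _ h₃]
  have hpres : ∀ a b x, (∃ v₁ v₂ v₃, P v₁ = 0 ∧ P v₂ = 0 ∧ P v₃ = 0 ∧ x = i v₁ + j v₂ + k v₃) →
      ∃ v₁ v₂ v₃, P v₁ = 0 ∧ P v₂ = 0 ∧ P v₃ = 0 ∧ R a b x = i v₁ + j v₂ + k v₃ := by
    rintro a b x ⟨v₁, v₂, v₃, h₁, h₂, h₃, rfl⟩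
    refine ⟨R a b v₁ - s₃ (R a b) • v₂ + s₂ (R a b) • v₃,
      R a b v₂ - s₁ (R a b) • v₃ + s₃ (R a b) • v₁,
      R a b v₃ - s₂ (R a b) • v₁ + s₁ (R a b) • v₂, by simp [hR h₁, h₂, h₃],
      by simp [hR h₂, h₁, h₃], by simp [hR h₃, h₂, h₁], ?_⟩
    simp only [map_add, map_sub, map_smul, h.apply_i, h.apply_j, h.apply_k]
    abel
  have hzero : ∀ z, IsHoriz i j k P z → R x y z = 0 := by
    intro z hz
    have hb := h.bianchi x y z
    rw [hz.one, hP x hx, hP y hy] at hb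
    obtain ⟨a₁, a₂, a₃, h₁, h₂, h₃, ha⟩ := hpres y z x hx
    obtain ⟨b₁, b₂, b₃, g₁, g₂, g₃, hb'⟩ := hpres z x y hy
    refine h.apply_horiz_eq_zero (v₁ := -a₁ - b₁) (v₂ := -a₂ - b₂) (v₃ := -a₃ - b₃)
      (by simp [h₁, g₁]) (by simp [h₂, g₂]) (by simp [h₃, g₃]) hz ?_
    rw [ha, hb'] at hb
    simp only [map_sub, map_neg]
    linear_combination (norm := module) hb
  have hiz : IsHoriz i j k P (i z) := by
    constructor
    · exact hz.i
    · simp [h.frame.ii, hz.one]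
    · simp [h.frame.ji, hz.k]
    · simp [h.frame.ki, hz.j]
  have e := h.apply_i x y z
  rw [hzero z hz, hzero _ hiz, map_zero, zero_add] at e
  have e1 := congrArg j e
  -- A real multiple of `z` equals a real multiple of `i z`; since `i² = -1`, iterating gives `(s₃²
  -- + s₂²) z = 0`.
  have e2 : (s₃ (R x y)) • z = - s₂ (R x y) • i z := by
    simp only [map_zero, map_sub, map_smul, h.frame.jj, h.frame.jk, smul_neg] at e1
    linear_combination (norm := module) e1
  have e3 := congrArg i e2
  have e4 : (s₃ (R x y) ^ 2 + s₂ (R x y) ^ 2) • z = 0 := by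
    simp only [map_smul, h.frame.ii, smul_neg] at e3
    have : s₃ (R x y) • s₃ (R x y) • z = - s₂ (R x y) • s₂ (R x y) • z := by
      rw [e2, smul_comm, e3]; simp
    rw [add_smul, pow_two, pow_two, mul_smul, mul_smul, this]
    module
  rw [smul_eq_zero] at e4
  have e5 := e4.resolve_right hz0
  constructor <;> nlinarith [sq_nonneg (s₃ (R x y)), sq_nonneg (s₂ (R x y))]

end IsFQuatCurvature
end LinearAlgebra
end FQuat
end

/-! ### The rotation coefficients of the curvature, for `W ≠ 0` and for `W = 0`. -/

noncomputable section
namespace FQuat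
section LinearAlgebra
variable {F : Type*} [AddCommGroup F] [Module ℝ F]
namespace IsFQuatCurvature

variable {i j k P : End ℝ F} {R : F →ₗ[ℝ] F →ₗ[ℝ] End ℝ F} {s₁ s₂ s₃ : End ℝ F →ₗ[ℝ] ℝ}
variable (h : IsFQuatCurvature i j k P R s₁ s₂ s₃)
include h

/-- If `F` is not generated by `V`, then the curvature is complex linear. -/
theorem coeffs_eq_zero {z v : F} (hz : IsHoriz i j k P z) (hz0 : z ≠ 0) (hv : P v = 0)
    (hv0 : v ≠ 0) (hV : ∀ v, P v = 0 → v ≠ 0 → ∃ w, P w = 0 ∧ Indep2 v w) (x y : F) :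
    s₁ (R x y) = 0 ∧ s₂ (R x y) = 0 ∧ s₃ (R x y) = 0 := by
  have h' := h.rotate
  have h'' := h'.rotate
  have hWW : ∀ x y, IsHoriz i j k P x → IsHoriz i j k P y →
      s₁ (R x y) = 0 ∧ s₂ (R x y) = 0 ∧ s₃ (R x y) = 0 := fun x y hx hy => by
    have h1 := h.horiz_horiz hx hy hv hv0
    have h2 := h'.horiz_horiz (horiz_rotate hx) (horiz_rotate hy) hv hv0
    exact ⟨h2.2, h1⟩
  have hWv : ∀ x u, IsHoriz i j k P x → P u = 0 →
      (s₁ (R x (i u)) = 0 ∧ s₂ (R x (i u)) = 0 ∧ s₃ (R x (i u)) = 0) ∧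
      (s₁ (R x (j u)) = 0 ∧ s₂ (R x (j u)) = 0 ∧ s₃ (R x (j u)) = 0) ∧
      (s₁ (R x (k u)) = 0 ∧ s₂ (R x (k u)) = 0 ∧ s₃ (R x (k u)) = 0) := fun x u hx hu => by
    by_cases hu0 : u = 0
    · simp [hu0]
    obtain ⟨w, hw, huw⟩ := hV u hu hu0
    have h1 := h.horiz_i hx hu hw huw
    have h2 := h'.horiz_i (horiz_rotate hx) hu hw huw
    have h3 := h''.horiz_i (horiz_rotate (horiz_rotate hx)) hu hw huw
    tauto
  have hVV : ∀ x y,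
      (∃ v₁ v₂ v₃, P v₁ = 0 ∧ P v₂ = 0 ∧ P v₃ = 0 ∧ x = i v₁ + j v₂ + k v₃) →
      (∃ v₁ v₂ v₃, P v₁ = 0 ∧ P v₂ = 0 ∧ P v₃ = 0 ∧ y = i v₁ + j v₂ + k v₃) →
      s₁ (R x y) = 0 ∧ s₂ (R x y) = 0 ∧ s₃ (R x y) = 0 := fun x y hx hy => by
    have h1 := h.vert_vert hz hz0 hx hy
    have hr : ∀ x, (∃ v₁ v₂ v₃, P v₁ = 0 ∧ P v₂ = 0 ∧ P v₃ = 0 ∧ x = i v₁ + j v₂ + k v₃) →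
        ∃ v₁ v₂ v₃, P v₁ = 0 ∧ P v₂ = 0 ∧ P v₃ = 0 ∧ x = j v₁ + k v₂ + i v₃ := by
      rintro x ⟨v₁, v₂, v₃, h₁, h₂, h₃, rfl⟩
      exact ⟨v₂, v₃, v₁, h₂, h₃, h₁, by abel⟩
    have h2 := h'.vert_vert (horiz_rotate hz) hz0 (hr x hx) (hr y hy)
    exact ⟨h2.2, h1⟩
  obtain ⟨a₁, a₂, a₃, a, ha₁, ha₂, ha₃, ha, hxa⟩ := h.exists_decomp (h.proj x)
  obtain ⟨b₁, b₂, b₃, b, hb₁, hb₂, hb₃, hb, hyb⟩ := h.exists_decomp (h.proj y)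
  have e : R x y = R (i a₁ + j a₂ + k a₃) (i b₁ + j b₂ + k b₃)
      + (R a (i b₁) + R a (j b₂) + R a (k b₃)) - (R b (i a₁) + R b (j a₂) + R b (k a₃))
      + R a b := by
    rw [← h.left_proj, ← h.right_proj, hxa, hyb, h.swap b, h.swap b, h.swap b]
    simp only [map_add, LinearMap.add_apply]
    abel
  have c1 := hVV (i a₁ + j a₂ + k a₃) (i b₁ + j b₂ + k b₃) ⟨_, _, _, ha₁, ha₂, ha₃, rfl⟩
    ⟨_, _, _, hb₁, hb₂, hb₃, rfl⟩
  have c2 := hWW a b ha hb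
  rw [e]
  generalize i a₁ + j a₂ + k a₃ = x', i b₁ + j b₂ + k b₃ = y' at c1
  simp [c1, c2, hWv a b₁ ha hb₁, hWv a b₂ ha hb₂, hWv a b₃ ha hb₃, hWv b a₁ hb ha₁,
    hWv b a₂ hb ha₂, hWv b a₃ hb ha₃]

/-! ### The case when `F` is generated by `V` -/

/-- The Bianchi identity for `i u, i v, i w` has `j`- and `k`-components which are linear relations
among `u, v, w`, with coefficients `s₃`, respectively `-s₂`; that of `u` comes from `R (i v) (i w)`.
For `s₁` the first vector is replaced by `j u`, since `[R, j]` has `k`-component `s₁`. -/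
theorem vert_ii {u v w : F} (hu : P u = 0) (hv : P v = 0) (hw : P w = 0) (huvw : Indep3 u v w) :
    s₁ (R (i v) (i w)) = 0 ∧ s₂ (R (i v) (i w)) = 0 ∧ s₃ (R (i v) (i w)) = 0 := by
  have hR := @apply_mem_ker _ _ _ _ _ _ _ _ _ _ _ h
  have e1 := h.bianchi (i u) (i v) (i w)
  have e2 := h.bianchi (j u) (i v) (i w)
  rw [h.proj_i _ hu, h.proj_i _ hv, h.proj_i _ hw, h.apply_i, h.apply_i, h.apply_i] at e1
  rw [h.proj_j _ hu, h.proj_i _ hv, h.proj_i _ hw, h.apply_i, h.apply_j, h.apply_i] at e2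
  obtain ⟨-, k1, k2⟩ := h.eq_zero_of_add_eq_zero
    (v₁ := R (i u) (i v) w + R (i v) (i w) u + R (i w) (i u) v)
    (v₂ := s₃ (R (i v) (i w)) • u + s₃ (R (i w) (i u)) • v + s₃ (R (i u) (i v)) • w)
    (v₃ := (-s₂ (R (i v) (i w))) • u + (-s₂ (R (i w) (i u))) • v + (-s₂ (R (i u) (i v))) • w)
    (by simp [hR hu, hR hv, hR hw]) (by simp [hu, hv, hw]) (by simp [hu, hv, hw]) (by
      rw [← e1]; simp only [map_add, map_smul]; module)
  obtain ⟨-, -, k3⟩ := h.eq_zero_of_add_eq_zero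
    (v₁ := R (j u) (i v) w + (-s₃ (R (i v) (i w))) • u + R (i w) (j u) v)
    (v₂ := R (i v) (i w) u + s₃ (R (i w) (j u)) • v + s₃ (R (j u) (i v)) • w)
    (v₃ := s₁ (R (i v) (i w)) • u + (-s₂ (R (i w) (j u))) • v + (-s₂ (R (j u) (i v))) • w)
    (by simp [hu, hR hv, hR hw]) (by simp [hR hu, hv, hw]) (by simp [hu, hv, hw]) (by
      rw [← e2]; simp only [map_add, map_smul]; module)
  refine ⟨(huvw _ _ _ k3).1, ?_, (huvw _ _ _ k1).1⟩
  simpa using (huvw _ _ _ k2).1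

/-- As in `vert_ii`, from the `k`-components of the identities for `i u, i v, j w` and `j u, i v, j
w`. The coefficient `s₃` is not reached, because the `j`-component involves `R (i u) (i v) w`, which
is not a combination of `u, v, w`. -/
theorem vert_ij {u v w : F} (hu : P u = 0) (hv : P v = 0) (hw : P w = 0) (huvw : Indep3 u v w) :
    s₁ (R (i v) (j w)) = 0 ∧ s₂ (R (i v) (j w)) = 0 := by
  have hR := @apply_mem_ker _ _ _ _ _ _ _ _ _ _ _ h
  have e1 := h.bianchi (i u) (i v) (j w)
  have e2 := h.bianchi (j u) (i v) (j w)
  rw [h.proj_i _ hu, h.proj_i _ hv, h.proj_j _ hw, h.apply_i, h.apply_i, h.apply_j] at e1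
  rw [h.proj_j _ hu, h.proj_i _ hv, h.proj_j _ hw, h.apply_i, h.apply_j, h.apply_j] at e2
  obtain ⟨-, -, k2⟩ := h.eq_zero_of_add_eq_zero
    (v₁ := (-s₃ (R (i u) (i v))) • w + R (i v) (j w) u + R (j w) (i u) v)
    (v₂ := s₃ (R (i v) (j w)) • u + s₃ (R (j w) (i u)) • v + R (i u) (i v) w)
    (v₃ := (-s₂ (R (i v) (j w))) • u + (-s₂ (R (j w) (i u))) • v + s₁ (R (i u) (i v)) • w)
    (by simp [hR hu, hR hv, hw]) (by simp [hu, hv, hR hw]) (by simp [hu, hv, hw]) (by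
      rw [← e1]; simp only [map_add, map_smul]; module)
  obtain ⟨-, -, k3⟩ := h.eq_zero_of_add_eq_zero
    (v₁ := (-s₃ (R (j u) (i v))) • w + (-s₃ (R (i v) (j w))) • u + R (j w) (j u) v)
    (v₂ := R (i v) (j w) u + s₃ (R (j w) (j u)) • v + R (j u) (i v) w)
    (v₃ := s₁ (R (i v) (j w)) • u + (-s₂ (R (j w) (j u))) • v + s₁ (R (j u) (i v)) • w)
    (by simp [hu, hR hv, hw]) (by simp [hR hu, hv, hR hw]) (by simp [hu, hv, hw]) (by
      rw [← e2]; simp only [map_add, map_smul]; module)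
  refine ⟨(huvw _ _ _ k3).1, ?_⟩
  simpa using (huvw _ _ _ k2).1

/-- The unknown vector `R (i u) (i v) w` appears both in the `j`-component of the identity for `i u,
i v, j w` and in the `k`-component of that for `i u, i v, k w`. Subtracting eliminates it. -/
theorem vert_ij_ik {u v w : F} (hu : P u = 0) (hv : P v = 0) (hw : P w = 0)
    (huvw : Indep3 u v w) : s₃ (R (i v) (j w)) + s₂ (R (i v) (k w)) = 0 := by
  have hR := @apply_mem_ker _ _ _ _ _ _ _ _ _ _ _ h
  have e1 := h.bianchi (i u) (i v) (j w)
  have e2 := h.bianchi (i u) (i v) (k w)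
  rw [h.proj_i _ hu, h.proj_i _ hv, h.proj_j _ hw, h.apply_i, h.apply_i, h.apply_j] at e1
  rw [h.proj_i _ hu, h.proj_i _ hv, h.proj_k _ hw, h.apply_i, h.apply_i, h.apply_k] at e2
  obtain ⟨-, k1, -⟩ := h.eq_zero_of_add_eq_zero
    (v₁ := (-s₃ (R (i u) (i v))) • w + R (i v) (j w) u + R (j w) (i u) v)
    (v₂ := s₃ (R (i v) (j w)) • u + s₃ (R (j w) (i u)) • v + R (i u) (i v) w)
    (v₃ := (-s₂ (R (i v) (j w))) • u + (-s₂ (R (j w) (i u))) • v + s₁ (R (i u) (i v)) • w)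
    (by simp [hR hu, hR hv, hw]) (by simp [hu, hv, hR hw]) (by simp [hu, hv, hw]) (by
      rw [← e1]; simp only [map_add, map_smul]; module)
  obtain ⟨-, -, k2⟩ := h.eq_zero_of_add_eq_zero
    (v₁ := s₂ (R (i u) (i v)) • w + R (i v) (k w) u + R (k w) (i u) v)
    (v₂ := s₃ (R (i v) (k w)) • u + s₃ (R (k w) (i u)) • v + (-s₁ (R (i u) (i v))) • w)
    (v₃ := (-s₂ (R (i v) (k w))) • u + (-s₂ (R (k w) (i u))) • v + R (i u) (i v) w)
    (by simp [hR hu, hR hv, hw]) (by simp [hu, hv, hw]) (by simp [hu, hv, hR hw]) (by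
      rw [← e2]; simp only [map_add, map_smul]; module)
  exact (huvw _ (s₃ (R (j w) (i u)) + s₂ (R (k w) (i u))) 0 (by
    linear_combination (norm := module) k1 - k2)).1

omit h in
/-- A bilinear form which vanishes on the pairs of linearly independent vectors of `ker P`. -/
theorem eq_zero_of_indep2 (g : F → F → ℝ) (hg : ∀ v w w', g v (w + w') = g v w + g v w')
    (hg0 : ∀ w, g 0 w = 0) (hg1 : ∀ v w, P v = 0 → P w = 0 → Indep2 v w → g v w = 0)
    (hV : ∀ v, P v = 0 → v ≠ 0 → ∃ w, P w = 0 ∧ Indep2 v w) {v w : F} (hv : P v = 0)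
    (hw : P w = 0) : g v w = 0 := by
  by_cases hv0 : v = 0
  · rw [hv0, hg0]
  by_cases hvw : Indep2 v w
  · exact hg1 v w hv hw hvw
  obtain ⟨u, hu, hvu⟩ := hV v hv hv0
  obtain ⟨a, rfl⟩ : ∃ a : ℝ, w = a • v := by
    simp only [Indep2, not_forall] at hvw
    obtain ⟨a, b, hab, hn⟩ := hvw
    have hb : b ≠ 0 := by
      rintro rfl
      simp [hv0] at hab
      exact hn ⟨hab, rfl⟩
    refine ⟨-a / b, ?_⟩
    have : b • w = (-a) • v := by linear_combination (norm := module) hab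
    rw [div_eq_inv_mul, mul_smul, ← this, smul_smul, inv_mul_cancel₀ hb, one_smul]
  -- The pair `(v, a v)` is dependent, but `(v, a v + u)` and `(v, u)` are not, and additivity in
  -- the second argument gives the value on `(v, a v)` as a difference.
  have h1 : Indep2 v (a • v + u) := fun c d hcd => by
    have := hvu (c + d * a) d (by linear_combination (norm := module) hcd)
    obtain ⟨h2, rfl⟩ := this
    simpa using h2
  have h2 := hg1 v _ hv (by simp [hv, hu]) h1
  rw [hg, hg1 v u hv hu hvu, add_zero] at h2
  exact h2

/-- If `F` is generated by `V`, the curvature at a pair of vectors of type `(0,1)` with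
respect to `i` is of type `(0,1)`. -/
theorem coeffs_of_generated (hgen : ∀ x, IsHoriz i j k P x → x = 0)
    (hV : ∀ v, P v = 0 → v ≠ 0 → ∃ w, P w = 0 ∧ Indep2 v w)
    (hV3 : ∀ v w, P v = 0 → P w = 0 → Indep2 v w → ∃ u, P u = 0 ∧ Indep3 u v w) (x y : F) :
    s₂ (R x y - R (i x) (i y)) = s₃ (R x (i y) + R (i x) y) ∧
    s₃ (R x y - R (i x) (i y)) = - s₂ (R x (i y) + R (i x) y) := by
  have h' := h.rotate
  have h'' := h'.rotate
  have ext : ∀ (A B : End ℝ F) (s : End ℝ F →ₗ[ℝ] ℝ),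
      (∀ v w, P v = 0 → P w = 0 → Indep2 v w → s (R (A v) (B w)) = 0) →
      ∀ v w, P v = 0 → P w = 0 → s (R (A v) (B w)) = 0 := fun A B s hs v w hv hw =>
    eq_zero_of_indep2 (fun v w => s (R (A v) (B w))) (by simp) (by simp) hs hV hv hw
  have hii : ∀ v w, P v = 0 → P w = 0 → s₂ (R (i v) (i w)) = 0 ∧ s₃ (R (i v) (i w)) = 0 :=
    fun v w hv hw => ⟨ext _ _ _ (fun v w hv hw hvw => by
        obtain ⟨u, hu, huvw⟩ := hV3 v w hv hw hvw
        exact (h.vert_ii hu hv hw huvw).2.1) v w hv hw,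
      ext _ _ _ (fun v w hv hw hvw => by
        obtain ⟨u, hu, huvw⟩ := hV3 v w hv hw hvw
        exact (h.vert_ii hu hv hw huvw).2.2) v w hv hw⟩
  have hjj : ∀ v w, P v = 0 → P w = 0 → s₂ (R (j v) (j w)) = 0 ∧ s₃ (R (j v) (j w)) = 0 :=
    fun v w hv hw => ⟨ext _ _ _ (fun v w hv hw hvw => by
        obtain ⟨u, hu, huvw⟩ := hV3 v w hv hw hvw
        exact (h'.vert_ii hu hv hw huvw).1) v w hv hw,
      ext _ _ _ (fun v w hv hw hvw => by
        obtain ⟨u, hu, huvw⟩ := hV3 v w hv hw hvw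
        exact (h'.vert_ii hu hv hw huvw).2.1) v w hv hw⟩
  have hkk : ∀ v w, P v = 0 → P w = 0 → s₂ (R (k v) (k w)) = 0 ∧ s₃ (R (k v) (k w)) = 0 :=
    fun v w hv hw => ⟨ext _ _ _ (fun v w hv hw hvw => by
        obtain ⟨u, hu, huvw⟩ := hV3 v w hv hw hvw
        exact (h''.vert_ii hu hv hw huvw).2.2) v w hv hw,
      ext _ _ _ (fun v w hv hw hvw => by
        obtain ⟨u, hu, huvw⟩ := hV3 v w hv hw hvw
        exact (h''.vert_ii hu hv hw huvw).1) v w hv hw⟩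
  have hjk : ∀ v w, P v = 0 → P w = 0 → s₂ (R (j v) (k w)) = 0 ∧ s₃ (R (j v) (k w)) = 0 :=
    fun v w hv hw => ⟨ext _ _ _ (fun v w hv hw hvw => by
        obtain ⟨u, hu, huvw⟩ := hV3 v w hv hw hvw
        exact (h'.vert_ij hu hv hw huvw).1) v w hv hw,
      ext _ _ _ (fun v w hv hw hvw => by
        obtain ⟨u, hu, huvw⟩ := hV3 v w hv hw hvw
        exact (h'.vert_ij hu hv hw huvw).2) v w hv hw⟩
  have hki : ∀ v w, P v = 0 → P w = 0 → s₃ (R (k v) (i w)) = 0 :=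
    fun v w hv hw => ext _ _ _ (fun v w hv hw hvw => by
        obtain ⟨u, hu, huvw⟩ := hV3 v w hv hw hvw
        exact (h''.vert_ij hu hv hw huvw).1) v w hv hw
  have hij : ∀ v w, P v = 0 → P w = 0 → s₂ (R (i v) (j w)) = 0 :=
    fun v w hv hw => ext _ _ _ (fun v w hv hw hvw => by
        obtain ⟨u, hu, huvw⟩ := hV3 v w hv hw hvw
        exact (h.vert_ij hu hv hw huvw).2) v w hv hw
  have hijk : ∀ v w, P v = 0 → P w = 0 → s₃ (R (i v) (j w)) = - s₂ (R (i v) (k w)) :=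
    fun v w hv hw => eq_neg_of_add_eq_zero_left (eq_zero_of_indep2
      (fun v w => s₃ (R (i v) (j w)) + s₂ (R (i v) (k w)))
      (by intros; simp only [map_add]; ring) (by simp) (fun v w hv hw hvw => by
        obtain ⟨u, hu, huvw⟩ := hV3 v w hv hw hvw
        exact h.vert_ij_ik hu hv hw huvw) hV hv hw)
  -- Since `W = 0`, every vector is `v₀ + i v₁ + j v₂ + k v₃`. Applying `i` sends `i v₁` to `-v₁`,
  -- which `P` kills, and brings `i v₀` into the tangent part.
  have hdec : ∀ x, ∃ v₀ v₁ v₂ v₃, P v₀ = 0 ∧ P v₁ = 0 ∧ P v₂ = 0 ∧ P v₃ = 0 ∧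
      P x = i v₁ + j v₂ + k v₃ ∧ P (i x) = i v₀ - j v₃ + k v₂ := by
    intro x
    obtain ⟨v₁, v₂, v₃, w, h₁, h₂, h₃, hw, e⟩ := h.exists_decomp (h.proj x)
    rw [hgen w hw, add_zero] at e
    have hQ : P (x - P x) = 0 := by rw [map_sub, h.proj, sub_self]
    refine ⟨x - P x, v₁, v₂, v₃, hQ, h₁, h₂, h₃, e, ?_⟩
    have : x = (x - P x) + (i v₁ + j v₂ + k v₃) := by rw [← e]; abel
    conv_lhs => rw [this]
    simp only [map_add, h.frame.ii, h.frame.ij, h.frame.ik, map_neg, h.proj_i _ hQ, h.proj_k _ h₂,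
      h.proj_j _ h₃, h₁]
    abel
  obtain ⟨a₀, a₁, a₂, a₃, ha₀, ha₁, ha₂, ha₃, ea, ea'⟩ := hdec x
  obtain ⟨b₀, b₁, b₂, b₃, hb₀, hb₁, hb₂, hb₃, eb, eb'⟩ := hdec y
  have eR : ∀ x y, R x y = R (P x) (P y) := fun x y => by rw [h.left_proj, h.right_proj]
  rw [eR x y, eR (i x) (i y), eR x (i y), eR (i x) y, ea, ea', eb, eb']
  -- With the pairs of units put in a fixed order, the only values that survive are `s₃ (R (i v) (j
  -- w))` and `s₂ (R (i v) (k w))`; they are opposite, and cancel in both identities.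
  have sw : ∀ (s : End ℝ F →ₗ[ℝ] ℝ) x y, s (R x y) = - s (R y x) := fun s x y => by
    rw [h.swap, map_neg]
  simp only [map_add, map_sub, LinearMap.add_apply, LinearMap.sub_apply,
    sw _ (j _) (i _), sw _ (k _) (j _), sw _ (i _) (k _), hii, hjj, hkk, hjk, hki, hij, hijk,
    ha₀, ha₁, ha₂, ha₃, hb₀, hb₁, hb₂, hb₃]
  constructor
  · ring
  · ring

end IsFQuatCurvature
end LinearAlgebra
end FQuat
end

/-! ### From the curvature of a bundle to the algebraic hypotheses: coefficients, frames,
dimensions. -/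

noncomputable section
namespace FQuat
section LinearAlgebra
variable {F : Type*} [AddCommGroup F] [Module ℝ F]

/-! ### Traces -/

/-- The coefficient along `k` of the infinitesimal rotation `[A, -]` of the span of a quaternionic
frame `i, j, k`. -/
def rotCoeff (k : End ℝ F) : End ℝ F →ₗ[ℝ] ℝ :=
  (-(2 / (finrank ℝ F : ℝ))) • (LinearMap.trace ℝ F) ∘ₗ LinearMap.mulRight ℝ k

theorem rotCoeff_apply (k A : End ℝ F) :
    rotCoeff k A = -(2 / (finrank ℝ F : ℝ)) * LinearMap.trace ℝ F (A * k) := rfl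

namespace IsQuatFrame

variable {i j k : End ℝ F} (h : IsQuatFrame i j k)
include h

/-- `i` is both `j k` and `-k j`, and the trace is cyclic. -/
theorem trace_i : LinearMap.trace ℝ F i = 0 := by
  have h1 : LinearMap.trace ℝ F (j * k) = LinearMap.trace ℝ F i := by
    congr 1; ext x; exact h.jk x
  have h2 : LinearMap.trace ℝ F (k * j) = -LinearMap.trace ℝ F i := by
    rw [← map_neg]; congr 1; ext x; exact h.kj x
  rw [LinearMap.trace_mul_comm] at h1
  linarith

theorem mul_self : i * i = -1 := by ext x; exact h.ii x
theorem mul_ij : i * j = k := by ext x; exact h.ij x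
theorem mul_ji : j * i = -k := by ext x; exact h.ji x
theorem mul_ik : i * k = -j := by ext x; exact h.ik x
theorem mul_ki : k * i = j := by ext x; exact h.ki x

/-- Multiplying by a unit and taking the trace isolates one coefficient, as products of distinct
units are traceless and squares have trace `-finrank ℝ F`. With `i` the left side is `0`, so `c 0 =
0`; with `j` and `k` it is `2 tr (A k)` and `-2 tr (A j)`, whence the normalization of `rotCoeff`.
The coefficients are thereby given by linear functionals of `A` alone. -/
theorem commutator_eq [FiniteDimensional ℝ F] [Nontrivial F] {A : End ℝ F} {c : Fin 3 → ℝ}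
    (hc : A * i - i * A = c 0 • i + c 1 • j + c 2 • k) :
    A * i - i * A = rotCoeff k A • j - rotCoeff j A • k := by
  have h' := h.rotate
  have h'' := h'.rotate
  have hn : (finrank ℝ F : ℝ) ≠ 0 := Nat.cast_ne_zero.2 finrank_pos.ne'
  have key : ∀ q : End ℝ F, LinearMap.trace ℝ F (A * (i * q)) - LinearMap.trace ℝ F (A * (q * i))
      = c 0 * LinearMap.trace ℝ F (i * q) + c 1 * LinearMap.trace ℝ F (j * q)
        + c 2 * LinearMap.trace ℝ F (k * q) := fun q => by
    have := congrArg (fun T => LinearMap.trace ℝ F (T * q)) hc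
    simp only [sub_mul, add_mul, smul_mul_assoc, map_sub, map_add, map_smul, smul_eq_mul] at this
    rw [← this, mul_assoc, mul_assoc i, LinearMap.trace_mul_comm ℝ i, mul_assoc]
  have t1 : LinearMap.trace ℝ F (-1) = -(finrank ℝ F : ℝ) := by
    rw [map_neg, LinearMap.trace_one]
  have k0 := key i
  have k1 := key j
  have k2 := key k
  simp only [h.mul_self, h'.mul_self, h''.mul_self, h.mul_ij, h.mul_ji, h.mul_ik, h.mul_ki,
    h'.mul_ij, h'.mul_ji, mul_neg, map_neg, h.trace_i, h'.trace_i, h''.trace_i,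
    LinearMap.trace_one] at k0 k1 k2
  have c0 : c 0 = 0 := by
    have : c 0 * (finrank ℝ F : ℝ) = 0 := by linarith
    exact (mul_eq_zero.1 this).resolve_right hn
  have c1 : rotCoeff k A = c 1 := by
    rw [rotCoeff_apply]; field_simp; linarith
  have c2 : -rotCoeff j A = c 2 := by
    rw [rotCoeff_apply]; field_simp; linarith
  rw [hc, c0, c1, ← c2]
  module

end IsQuatFrame

/-! ### Rotations of quaternionic frames -/

/-- The endomorphism `a 0 • I 0 + a 1 • I 1 + a 2 • I 2`. -/
def combo (I : Fin 3 → End ℝ F) (a : Fin 3 → ℝ) : End ℝ F := ∑ j, a j • I j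

theorem combo_apply (I : Fin 3 → End ℝ F) (a : Fin 3 → ℝ) (x : F) :
    combo I a x = a 0 • I 0 x + a 1 • I 1 x + a 2 • I 2 x := by
  simp [combo, Fin.sum_univ_three]

theorem combo_combo {I : Fin 3 → End ℝ F} (h : IsQuatFrame (I 0) (I 1) (I 2)) (a b : Fin 3 → ℝ)
    (x : F) : combo I a (combo I b x) = -(a 0 * b 0 + a 1 * b 1 + a 2 * b 2) • x
      + combo I ![a 1 * b 2 - a 2 * b 1, a 2 * b 0 - a 0 * b 2, a 0 * b 1 - a 1 * b 0] x := by
  simp only [combo_apply, map_add, map_smul, h.ii, h.ij, h.ik, h.ji, h.jj, h.jk, h.ki, h.kj, h.kk,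
    Matrix.cons_val]
  module

theorem exists_unit_orthogonal (a : Fin 3 → ℝ) :
    ∃ b : Fin 3 → ℝ, b 0 ^ 2 + b 1 ^ 2 + b 2 ^ 2 = 1 ∧ a 0 * b 0 + a 1 * b 1 + a 2 * b 2 = 0 := by
  by_cases h : a 0 ^ 2 + a 1 ^ 2 = 0
  · have h0 : a 0 = 0 := by nlinarith [sq_nonneg (a 0), sq_nonneg (a 1)]
    exact ⟨![1, 0, 0], by simp, by simp [h0]⟩
  · have hs : Real.sqrt (a 0 ^ 2 + a 1 ^ 2) ^ 2 = a 0 ^ 2 + a 1 ^ 2 := Real.sq_sqrt (by positivity)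
    have hs0 : Real.sqrt (a 0 ^ 2 + a 1 ^ 2) ≠ 0 := fun h0 => h (by rw [← hs, h0]; simp)
    refine ⟨![-a 1 / Real.sqrt (a 0 ^ 2 + a 1 ^ 2), a 0 / Real.sqrt (a 0 ^ 2 + a 1 ^ 2), 0], ?_, ?_⟩
    · simp only [Matrix.cons_val]
      field_simp
      rw [hs]; ring
    · simp only [Matrix.cons_val]
      field_simp
      ring

/-- Every unit imaginary quaternion is the first vector of a quaternionic frame with the same
span. -/
theorem exists_frame_combo {I : Fin 3 → End ℝ F} (h : IsQuatFrame (I 0) (I 1) (I 2))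
    (a : Fin 3 → ℝ) (ha : a 0 ^ 2 + a 1 ^ 2 + a 2 ^ 2 = 1) :
    ∃ b c : Fin 3 → ℝ, IsQuatFrame (combo I a) (combo I b) (combo I c) ∧
      ∀ l, I l = a l • combo I a + b l • combo I b + c l • combo I c := by
  obtain ⟨b, hb, hab⟩ := exists_unit_orthogonal a
  -- `c` is the cross product `a × b`, so that the product of the imaginary quaternions `a` and `b`,
  -- which are orthogonal, is `c`.
  obtain ⟨c, hc⟩ : ∃ c, c =
    ![a 1 * b 2 - a 2 * b 1, a 2 * b 0 - a 0 * b 2, a 0 * b 1 - a 1 * b 0] := ⟨_, rfl⟩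
  have c0 : c 0 = a 1 * b 2 - a 2 * b 1 := by simp [hc]
  have c1 : c 1 = a 2 * b 0 - a 0 * b 2 := by simp [hc]
  have c2 : c 2 = a 0 * b 1 - a 1 * b 0 := by simp [hc]
  have hcc : c 0 ^ 2 + c 1 ^ 2 + c 2 ^ 2 = 1 := by
    rw [c0, c1, c2]
    linear_combination (b 0 ^ 2 + b 1 ^ 2 + b 2 ^ 2) * ha + hb
      - (a 0 * b 0 + a 1 * b 1 + a 2 * b 2) * hab
  have hac : a 0 * c 0 + a 1 * c 1 + a 2 * c 2 = 0 := by rw [c0, c1, c2]; ring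
  have hbc : b 0 * c 0 + b 1 * c 1 + b 2 * c 2 = 0 := by rw [c0, c1, c2]; ring
  refine ⟨b, c, ⟨fun x => ?_, fun x => ?_, fun x => ?_, fun x => ?_⟩, ?_⟩
  · rw [combo_combo h, combo_apply I ![_, _, _]]
    simp only [Matrix.cons_val]
    rw [show a 0 * a 0 + a 1 * a 1 + a 2 * a 2 = 1 by rw [← ha]; ring]
    module
  · rw [combo_combo h, combo_apply I ![_, _, _]]
    simp only [Matrix.cons_val]
    rw [show b 0 * b 0 + b 1 * b 1 + b 2 * b 2 = 1 by rw [← hb]; ring]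
    module
  · rw [combo_combo h, hab, hc]
    simp
  · rw [combo_combo h, show b 0 * a 0 + b 1 * a 1 + b 2 * a 2 = 0 by rw [← hab]; ring,
      combo_apply I ![_, _, _], combo_apply I c, c0, c1, c2]
    simp only [Matrix.cons_val]
    module
  -- The rows `a, b, c` are orthonormal, so the matrix is orthogonal and its columns are orthonormal
  -- too; this inverts the change of frame.
  · have hM : (!![a 0, a 1, a 2; b 0, b 1, b 2; c 0, c 1, c 2] : Matrix (Fin 3) (Fin 3) ℝ) *
        !![a 0, b 0, c 0; a 1, b 1, c 1; a 2, b 2, c 2] = 1 := by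
      rw [Matrix.one_fin_three, Matrix.mul_fin_three]
      ext l m
      fin_cases l <;> fin_cases m <;> simp <;> linarith
    have hM' := mul_eq_one_comm.1 hM
    rw [Matrix.one_fin_three, Matrix.mul_fin_three] at hM'
    have e : ∀ l m, _ := fun l m => congrFun (congrFun hM' l) m
    have e00 := e 0 0
    have e01 := e 0 1
    have e02 := e 0 2
    have e11 := e 1 1
    have e12 := e 1 2
    have e22 := e 2 2
    simp only [Matrix.of_apply, Matrix.cons_val] at e00 e01 e02 e11 e12 e22
    intro l
    ext x
    simp only [LinearMap.add_apply, LinearMap.smul_apply, combo_apply]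
    fin_cases l
    · simp only [Fin.zero_eta]
      linear_combination (norm := module) -e00 • I 0 x - e01 • I 1 x - e02 • I 2 x
    · simp only [Fin.mk_one]
      linear_combination (norm := module) -e01 • I 0 x - e11 • I 1 x - e12 • I 2 x
    · simp only [Fin.reduceFinMk]
      linear_combination (norm := module) -e02 • I 0 x - e12 • I 1 x - e22 • I 2 x

/-! ### Dimensions -/

theorem exists_indep2 {K : Submodule ℝ F} [FiniteDimensional ℝ F] (hK : 2 ≤ finrank ℝ K) {v : F}
    (hv0 : v ≠ 0) : ∃ w ∈ K, Indep2 v w := by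
  have h1 : ¬ K ≤ ℝ ∙ v := fun hle => by
    have := Submodule.finrank_mono hle
    have := finrank_span_singleton (K := ℝ) hv0
    omega
  obtain ⟨w, hwK, hw⟩ := Set.not_subset.1 h1
  refine ⟨w, hwK, fun a b hab => ?_⟩
  have hb : b = 0 := by
    by_contra hb
    refine hw (Submodule.mem_span_singleton.2 ⟨-(b⁻¹ * a), ?_⟩)
    have : w = b⁻¹ • (b • w) := by rw [smul_smul, inv_mul_cancel₀ hb, one_smul]
    rw [this]
    linear_combination (norm := module) -b⁻¹ • hab
  subst hb
  simpa [hv0] using hab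

theorem exists_indep3 {K : Submodule ℝ F} [FiniteDimensional ℝ F] (hK : 3 ≤ finrank ℝ K) {v w : F}
    (hvw : Indep2 v w) : ∃ u ∈ K, Indep3 u v w := by
  classical
  have h1 : ¬ K ≤ Submodule.span ℝ {v, w} := fun hle => by
    have h2 := Submodule.finrank_mono hle
    have h3 := finrank_span_finset_le_card (R := ℝ) ({v, w} : Finset F)
    have h4 := Finset.card_le_two (a := v) (b := w)
    rw [Set.finrank, Finset.coe_pair] at h3
    omega
  obtain ⟨u, huK, hu⟩ := Set.not_subset.1 h1
  refine ⟨u, huK, fun a b c habc => ?_⟩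
  have ha : a = 0 := by
    by_contra ha
    refine hu (Submodule.mem_span_pair.2 ⟨-(a⁻¹ * b), -(a⁻¹ * c), ?_⟩)
    have : u = a⁻¹ • (a • u) := by rw [smul_smul, inv_mul_cancel₀ ha, one_smul]
    rw [this]
    linear_combination (norm := module) -a⁻¹ • habc
  subst ha
  exact ⟨rfl, hvw b c (by simpa using habc)⟩

namespace IsFQuatCurvature

variable {i j k P : End ℝ F} {R : F →ₗ[ℝ] F →ₗ[ℝ] End ℝ F} {s₁ s₂ s₃ : End ℝ F →ₗ[ℝ] ℝ}
variable (h : IsFQuatCurvature i j k P R s₁ s₂ s₃) [FiniteDimensional ℝ F]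
include h

omit [FiniteDimensional ℝ F] h in
variable (i j k P) in
/-- The map `(v₀, v₁, v₂, v₃) ↦ v₀ + i v₁ + j v₂ + k v₃`. -/
def generatedMap : (LinearMap.ker P × LinearMap.ker P) × (LinearMap.ker P × LinearMap.ker P)
    →ₗ[ℝ] F :=
  LinearMap.coprod
    (LinearMap.coprod (LinearMap.ker P).subtype (i ∘ₗ (LinearMap.ker P).subtype))
    (LinearMap.coprod (j ∘ₗ (LinearMap.ker P).subtype) (k ∘ₗ (LinearMap.ker P).subtype))

omit h in
theorem finrank_generatedMap_domain :
    finrank ℝ ((LinearMap.ker P × LinearMap.ker P) × (LinearMap.ker P × LinearMap.ker P))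
      = 4 * finrank ℝ (LinearMap.ker P) := by
  simp only [Module.finrank_prod]; ring

/-- If `W` were zero, the decomposition would make `generatedMap` onto, contradicting the strict
inequality of dimensions. -/
theorem exists_horiz (hlt : 4 * finrank ℝ (LinearMap.ker P) < finrank ℝ F) :
    ∃ z, IsHoriz i j k P z ∧ z ≠ 0 := by
  by_contra! hz
  have hsurj : Function.Surjective (generatedMap i j k P) := by
    intro x
    obtain ⟨v₁, v₂, v₃, w, h₁, h₂, h₃, hw, e⟩ := h.exists_decomp (h.proj x)
    have hQ : P (x - P x) = 0 := by rw [map_sub, h.proj, sub_self]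
    refine ⟨((⟨x - P x, hQ⟩, ⟨v₁, h₁⟩), (⟨v₂, h₂⟩, ⟨v₃, h₃⟩)), ?_⟩
    have e1 : generatedMap i j k P ((⟨x - P x, hQ⟩, ⟨v₁, h₁⟩), (⟨v₂, h₂⟩, ⟨v₃, h₃⟩))
      = (x - P x + i v₁) + (j v₂ + k v₃) := rfl
    rw [e1, e, hz w hw]
    abel
  have := LinearMap.finrank_le_finrank_of_surjective hsurj
  rw [finrank_generatedMap_domain] at this
  omega

/-- `generatedMap` is always injective, hence bijective when the dimensions agree. A vector of `W`
is then of the form `v₀ + i v₁ + j v₂ + k v₃`, and such a vector is horizontal only if it is zero.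
-/
theorem horiz_eq_zero (heq : finrank ℝ F = 4 * finrank ℝ (LinearMap.ker P)) (z : F)
    (hz : IsHoriz i j k P z) : z = 0 := by
  have hinj : Function.Injective (generatedMap i j k P) := by
    rw [injective_iff_map_eq_zero]
    rintro ⟨⟨⟨v₀, h₀⟩, ⟨v₁, h₁⟩⟩, ⟨⟨v₂, h₂⟩, ⟨v₃, h₃⟩⟩⟩ hv
    have hv : (v₀ + i v₁) + (j v₂ + k v₃) = 0 := hv
    rw [LinearMap.mem_ker] at h₀ h₁ h₂ h₃
    have e := congrArg P hv
    simp only [map_add, h₀, h.proj_i _ h₁, h.proj_j _ h₂, h.proj_k _ h₃, map_zero] at e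
    obtain ⟨rfl, rfl, rfl⟩ := h.eq_zero_of_add_eq_zero h₁ h₂ h₃ (by rw [← e]; abel)
    have : v₀ = 0 := by simpa using hv
    subst this
    rfl
  have hsurj := (LinearMap.injective_iff_surjective_of_finrank_eq_finrank
    (f := generatedMap i j k P) (by rw [finrank_generatedMap_domain, heq])).1 hinj
  obtain ⟨⟨⟨⟨v₀, h₀⟩, ⟨v₁, h₁⟩⟩, ⟨⟨v₂, h₂⟩, ⟨v₃, h₃⟩⟩⟩, hv⟩ := hsurj z
  have hv : (v₀ + i v₁) + (j v₂ + k v₃) = z := hv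
  rw [LinearMap.mem_ker] at h₀ h₁ h₂ h₃
  have e : v₀ = 0 := by
    have e1 := hz.one
    rw [← hv] at e1
    simp only [map_add, h₀, h.proj_i _ h₁, h.proj_j _ h₂, h.proj_k _ h₃] at e1
    simpa using e1
  subst e
  have hv : i v₁ + j v₂ + k v₃ = z := by rw [← hv]; abel
  obtain ⟨rfl, rfl, rfl⟩ := h.eq_zero_of_horiz h₁ h₂ h₃ (hv ▸ hz)
  simpa using hv.symm

/-- The conclusion says that `i [R₀, i] = [R₁, i]`, where `R₀` and `R₁` are the real and imaginary
parts of `R` at `x + √-1 i x`, `y + √-1 i y`, written in the components `j` and `k`. The bounds `8 ≤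
4 r` and `12 ≤ 4 r` provide two, respectively three, independent vectors of `V`. -/
theorem coeffs_of_rank {r : ℕ} (hr : finrank ℝ (LinearMap.ker P) = r)
    (hrank : (4 * r < finrank ℝ F ∧ 8 ≤ 4 * r) ∨ (finrank ℝ F = 4 * r ∧ 12 ≤ 4 * r)) (x y : F) :
    s₂ (R x y - R (i x) (i y)) = s₃ (R x (i y) + R (i x) y) ∧
    s₃ (R x y - R (i x) (i y)) = - s₂ (R x (i y) + R (i x) y) := by
  subst hr
  have hV : ∀ v, P v = 0 → v ≠ 0 → ∃ w, P w = 0 ∧ Indep2 v w := fun v _ hv0 =>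
    exists_indep2 (K := LinearMap.ker P) (by omega) hv0
  rcases hrank with ⟨hlt, h8⟩ | ⟨heq, h12⟩
  · obtain ⟨z, hz, hz0⟩ := h.exists_horiz hlt
    obtain ⟨⟨v, hv⟩, hv0⟩ := Module.finrank_pos_iff_exists_ne_zero.1
      (show 0 < finrank ℝ (LinearMap.ker P) by omega)
    have hc := h.coeffs_eq_zero hz hz0 hv (fun h0 => hv0 (Subtype.ext h0)) hV
    simp [hc]
  · exact h.coeffs_of_generated (h.horiz_eq_zero heq) hV (fun v w _ _ hvw =>
      exists_indep3 (K := LinearMap.ker P) (by omega) hvw) x y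

end IsFQuatCurvature

/-- The algebraic curvature condition: `[R x y, J]` is of type `(0,1)`, as a tangent vector at `J`
of the sphere of admissible complex structures, if `x` and `y` are complex vectors of type
`(0,1)` with respect to `J`. -/
theorem curvature_zeroOne [FiniteDimensional ℝ F] {I : Fin 3 → End ℝ F}
    (hI : IsQuatFrame (I 0) (I 1) (I 2)) {P : End ℝ F} (proj : ∀ x, P (P x) = P x)
    (proj_I : ∀ l v, P v = 0 → P (I l v) = I l v) {R : F →ₗ[ℝ] F →ₗ[ℝ] End ℝ F}
    (swap : ∀ x y, R x y = -R y x) (left_proj : ∀ x y, R (P x) y = R x y)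
    (comm_proj : ∀ x y z, R x y (P z) = P (R x y z))
    (bianchi : ∀ x y z, R x y (P z) + R y z (P x) + R z x (P y) = 0)
    (span : ∀ x y l, ∃ c : Fin 3 → ℝ, ∀ z,
      R x y (I l z) - I l (R x y z) = ∑ m, c m • I m z)
    {r : ℕ} (hr : finrank ℝ (LinearMap.ker P) = r)
    (hrank : (4 * r < finrank ℝ F ∧ 8 ≤ 4 * r) ∨ (finrank ℝ F = 4 * r ∧ 12 ≤ 4 * r))
    (a : Fin 3 → ℝ) (ha : a 0 ^ 2 + a 1 ^ 2 + a 2 ^ 2 = 1) (x y z : F) :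
    combo I a ((R x y - R (combo I a x) (combo I a y)) (combo I a z)
        - combo I a ((R x y - R (combo I a x) (combo I a y)) z))
      = (R x (combo I a y) + R (combo I a x) y) (combo I a z)
        - combo I a ((R x (combo I a y) + R (combo I a x) y) z) := by
  obtain ⟨b, c, hF, hspan⟩ := exists_frame_combo hI a ha
  have : Nontrivial F := by
    refine Module.nontrivial_of_finrank_pos (R := ℝ) ?_
    omega
  have hproj : ∀ a v, P v = 0 → P (combo I a v) = combo I a v := fun a v hv => by
    simp only [combo_apply, map_add, map_smul, proj_I _ v hv]
  -- The curvature preserves the span of the given frame, which is also the span of the rotated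
  -- frame.
  have hcomm : ∀ x y d, ∃ e : Fin 3 → ℝ, R x y * combo I d - combo I d * R x y
      = e 0 • combo I a + e 1 • combo I b + e 2 • combo I c := by
    intro x y d
    choose e he using span x y
    have h1 : R x y * combo I d - combo I d * R x y = ∑ l, ∑ m, (d l * e l m) • I m := by
      ext z
      simp only [LinearMap.sub_apply, Module.End.mul_apply, combo, LinearMap.sum_apply,
        LinearMap.smul_apply, map_sum, map_smul, ← Finset.sum_sub_distrib, ← smul_sub, he,
        Finset.smul_sum, mul_smul]
    refine ⟨![∑ l, ∑ m, d l * e l m * a m, ∑ l, ∑ m, d l * e l m * b m,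
      ∑ l, ∑ m, d l * e l m * c m], ?_⟩
    rw [h1]
    simp only [Matrix.cons_val, Finset.sum_smul, ← Finset.sum_add_distrib]
    refine Finset.sum_congr rfl fun l _ => Finset.sum_congr rfl fun m _ => ?_
    rw [hspan m, ← hspan m]
    conv_lhs => rw [hspan m]
    module
  have hap : ∀ {i j k : End ℝ F} (_ : IsQuatFrame i j k) {A : End ℝ F},
      (∃ e : Fin 3 → ℝ, A * i - i * A = e 0 • i + e 1 • j + e 2 • k) → ∀ z,
      A (i z) = i (A z) + rotCoeff k A • j z - rotCoeff j A • k z := by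
    rintro i j k hF A ⟨e, he⟩ z
    have := LinearMap.congr_fun (hF.commutator_eq he) z
    simp only [LinearMap.sub_apply, Module.End.mul_apply, LinearMap.smul_apply] at this
    linear_combination (norm := module) this
  have h : IsFQuatCurvature (combo I a) (combo I b) (combo I c) P R (rotCoeff (combo I a))
      (rotCoeff (combo I b)) (rotCoeff (combo I c)) :=
    { frame := hF
      proj := proj
      proj_i := hproj a
      proj_j := hproj b
      proj_k := hproj c
      swap := swap
      left_proj := left_proj
      comm_proj := comm_proj
      bianchi := bianchi
      apply_i := fun x y => hap hF (hcomm x y a)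
      apply_j := fun x y => hap hF.rotate (by
        obtain ⟨e, he⟩ := hcomm x y b
        exact ⟨![e 1, e 2, e 0], by rw [he]; simp only [Matrix.cons_val]; abel⟩)
      apply_k := fun x y => hap hF.rotate.rotate (by
        obtain ⟨e, he⟩ := hcomm x y c
        exact ⟨![e 2, e 0, e 1], by rw [he]; simp only [Matrix.cons_val]; abel⟩) }
  obtain ⟨h1, h2⟩ := h.coeffs_of_rank hr hrank x y
  simp only [LinearMap.sub_apply, LinearMap.add_apply, h.apply_i, map_sub, map_add, map_smul,
    hF.ij, hF.ik]
  simp only [map_sub, map_add] at h1 h2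
  linear_combination (norm := module) h1 • combo I b z + h2 • combo I c z

end LinearAlgebra
end FQuat
end

/-! ### Connections `d + A` on a trivial bundle over a vector space: Ricci and Bianchi identities.
-/

noncomputable section
namespace FQuat
section FlatCurvature

variable {B : Type*} [NormedAddCommGroup B] [NormedSpace ℝ B]
  {F : Type*} [NormedAddCommGroup F] [NormedSpace ℝ F]

/-- The covariant derivative of the endomorphism field `S` with respect to the connection
`d + A` on the trivial bundle with fibre `F`. -/
def covEnd (A : B → B →L[ℝ] F →L[ℝ] F) (S : B → F →L[ℝ] F) (b X : B) : F →L[ℝ] F :=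
  fderiv ℝ S b X + (A b X * S b - S b * A b X)

/-- The curvature of the connection `d + A` on the trivial bundle with fibre `F`. -/
def curvA (A : B → B →L[ℝ] F →L[ℝ] F) (b X Y : B) : F →L[ℝ] F :=
  fderiv ℝ A b X Y - fderiv ℝ A b Y X + (A b X * A b Y - A b Y * A b X)

theorem hasFDerivAt_mul_apply {S T : B → F →L[ℝ] F} {b : B} (hS : DifferentiableAt ℝ S b)
    (hT : DifferentiableAt ℝ T b) (X : B) :
    fderiv ℝ (fun c => S c * T c) b X = fderiv ℝ S b X * T b + S b * fderiv ℝ T b X := by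
  have := congrArg (fun L => L X) (hS.hasFDerivAt.mul' hT.hasFDerivAt).fderiv
  simp only [_root_.add_apply, _root_.smul_apply] at this
  rw [add_comm]
  exact this

theorem fderiv_eval {G G' : Type*} [NormedAddCommGroup G] [NormedSpace ℝ G]
    [NormedAddCommGroup G'] [NormedSpace ℝ G'] {L : B → G' →L[ℝ] G} {b : B}
    (hL : DifferentiableAt ℝ L b) (X : B) (Y : G') :
    fderiv ℝ (fun c => L c Y) b X = fderiv ℝ L b X Y := by
  rw [fderiv_clm_apply hL (differentiableAt_const Y)]
  simp

variable {A : B → B →L[ℝ] F →L[ℝ] F} {S : B → F →L[ℝ] F} {b : B}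

theorem fderiv_covEnd (hA : DifferentiableAt ℝ A b) (hS : ContDiffAt ℝ 2 S b) (X Y : B) :
    fderiv ℝ (fun c => covEnd A S c Y) b X = fderiv ℝ (fderiv ℝ S) b X Y
      + (fderiv ℝ A b X Y * S b + A b Y * fderiv ℝ S b X
        - (fderiv ℝ S b X * A b Y + S b * fderiv ℝ A b X Y)) := by
  have hS1 : DifferentiableAt ℝ S b := hS.differentiableAt (by norm_num)
  have hS2 : DifferentiableAt ℝ (fderiv ℝ S) b :=
    (hS.fderiv_right (m := 1) (by norm_num)).differentiableAt (by norm_num)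
  have hAY : DifferentiableAt ℝ (fun c => A c Y) b := hA.clm_apply (differentiableAt_const _)
  have hSY : DifferentiableAt ℝ (fun c => fderiv ℝ S c Y) b :=
    hS2.clm_apply (differentiableAt_const _)
  have h1 : DifferentiableAt ℝ (fun c => A c Y * S c) b := hAY.mul hS1
  have h2 : DifferentiableAt ℝ (fun c => S c * A c Y) b := hS1.mul hAY
  have e : fderiv ℝ (fun c => covEnd A S c Y) b = fderiv ℝ (fun c => fderiv ℝ S c Y) b +
      (fderiv ℝ (fun c => A c Y * S c) b - fderiv ℝ (fun c => S c * A c Y) b) := by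
    have h3 : DifferentiableAt ℝ (fun c => A c Y * S c - S c * A c Y) b := h1.sub h2
    rw [← fderiv_fun_sub h1 h2, ← fderiv_fun_add hSY h3]
    rfl
  rw [e, _root_.add_apply, _root_.sub_apply,
    hasFDerivAt_mul_apply hAY hS1, hasFDerivAt_mul_apply hS1 hAY, fderiv_eval hS2, fderiv_eval hA]

/-- The Ricci identity for endomorphism fields. -/
theorem curvA_commutator (hA : DifferentiableAt ℝ A b) (hS : ContDiffAt ℝ 2 S b) (X Y : B) :
    curvA A b X Y * S b - S b * curvA A b X Y =
      (fderiv ℝ (fun c => covEnd A S c Y) b X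
        + (A b X * covEnd A S b Y - covEnd A S b Y * A b X))
      - (fderiv ℝ (fun c => covEnd A S c X) b Y
        + (A b Y * covEnd A S b X - covEnd A S b X * A b Y)) := by
  have hsymm : fderiv ℝ (fderiv ℝ S) b X Y = fderiv ℝ (fderiv ℝ S) b Y X :=
    (hS.isSymmSndFDerivAt (by simp)) X Y
  rw [fderiv_covEnd hA hS, fderiv_covEnd hA hS, hsymm]
  simp only [curvA, covEnd]
  noncomm_ring

theorem curvA_commutator_of_parallel (hA : DifferentiableAt ℝ A b) (hS : ContDiffAt ℝ 2 S b)
    (hpar : ∀ᶠ c in nhds b, ∀ X, covEnd A S c X = 0) (X Y : B) :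
    curvA A b X Y * S b = S b * curvA A b X Y := by
  have h1 : ∀ Y, fderiv ℝ (fun c => covEnd A S c Y) b = 0 := fun Y => by
    have : (fun c => covEnd A S c Y) =ᶠ[nhds b] fun _ => 0 := hpar.mono fun c hc => hc Y
    rw [this.fderiv_eq]; simp
  have h2 := curvA_commutator hA hS X Y
  rw [h1, h1, hpar.self_of_nhds, hpar.self_of_nhds] at h2
  simpa [sub_eq_zero] using h2

/-- By the Ricci identity it is enough that second covariant derivatives of the frame stay in its
span. The coefficients of `∇ I_l`, given only pointwise, are differentiable because they are traces,
`-(1/n) tr (I_m ∇ I_l)` with `n = finrank ℝ F`; the Leibniz rule then applies to the resulting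
expansion. -/
theorem curvA_commutator_mem_span [FiniteDimensional ℝ F] {I : Fin 3 → B → F →L[ℝ] F}
    (hA : DifferentiableAt ℝ A b) (hI : ∀ l, ContDiffAt ℝ 2 (I l) b) [Nontrivial F]
    (hq : ∀ᶠ c in nhds b, IsQuatFrame (I 0 c : F →ₗ[ℝ] F) (I 1 c) (I 2 c))
    (hspan : ∀ᶠ c in nhds b, ∀ X l, ∃ a : Fin 3 → ℝ, covEnd A (I l) c X = ∑ m, a m • I m c)
    (X Y : B) (l : Fin 3) :
    ∃ a : Fin 3 → ℝ, curvA A b X Y * I l b - I l b * curvA A b X Y = ∑ m, a m • I m b := by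
  obtain ⟨τ, hτ⟩ : ∃ τ : (F →L[ℝ] F) →L[ℝ] ℝ, ∀ T, τ T = LinearMap.trace ℝ F (T : F →ₗ[ℝ] F) :=
    ⟨LinearMap.toContinuousLinearMap (LinearMap.trace ℝ F ∘ₗ ContinuousLinearMap.coeLM ℝ),
      fun T => rfl⟩
  have hI1 : ∀ l, DifferentiableAt ℝ (I l) b := fun l => (hI l).differentiableAt (by norm_num)
  have hn : (finrank ℝ F : ℝ) ≠ 0 := Nat.cast_ne_zero.2 finrank_pos.ne'
  have hN : ∀ Y, DifferentiableAt ℝ (fun c => covEnd A (I l) c Y) b := fun Y => by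
    have hS2 : DifferentiableAt ℝ (fderiv ℝ (I l)) b :=
      ((hI l).fderiv_right (m := 1) (by norm_num)).differentiableAt (by norm_num)
    have hAY : DifferentiableAt ℝ (fun c => A c Y) b := hA.clm_apply (differentiableAt_const _)
    exact (hS2.clm_apply (differentiableAt_const _)).add
      ((hAY.mul (hI1 l)).sub ((hI1 l).mul hAY))
  have hcoef : ∀ᶠ c in nhds b, ∀ Y, covEnd A (I l) c Y
      = ∑ m, (-(finrank ℝ F : ℝ)⁻¹ * τ (I m c * covEnd A (I l) c Y)) • I m c := by
    filter_upwards [hq, hspan] with c hc hs Y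
    obtain ⟨a, ha⟩ := hs Y l
    have h' := hc.rotate
    have h'' := h'.rotate
    have t : ∀ m, τ (I m c * covEnd A (I l) c Y) = -(finrank ℝ F : ℝ) * a m := by
      intro m
      have e1 : ((I m c * covEnd A (I l) c Y : F →L[ℝ] F) : F →ₗ[ℝ] F)
          = a 0 • ((I m c : F →ₗ[ℝ] F) * (I 0 c : F →ₗ[ℝ] F))
          + a 1 • ((I m c : F →ₗ[ℝ] F) * (I 1 c : F →ₗ[ℝ] F))
          + a 2 • ((I m c : F →ₗ[ℝ] F) * (I 2 c : F →ₗ[ℝ] F)) := by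
        rw [ha, Fin.sum_univ_three]
        ext x
        simp
      rw [hτ, e1]
      fin_cases m
      · simp [hc.mul_self, hc.mul_ij, hc.mul_ik, h'.trace_i, h''.trace_i]; ring
      · simp [h'.mul_self, hc.mul_ji, h'.mul_ij, hc.trace_i, h''.trace_i]; ring
      · simp [h''.mul_self, hc.mul_ki, h'.mul_ji, hc.trace_i, h'.trace_i]; ring
    simp only [t]
    rw [ha]
    refine Finset.sum_congr rfl fun m _ => ?_
    congr 1
    field_simp
  have hder : ∀ X Y, ∃ a : Fin 3 → ℝ, fderiv ℝ (fun c => covEnd A (I l) c Y) b X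
      + (A b X * covEnd A (I l) b Y - covEnd A (I l) b Y * A b X) = ∑ m, a m • I m b := by
    intro X Y
    obtain ⟨f, hf⟩ : ∃ f : Fin 3 → B → ℝ, ∀ m c, f m c =
      -(finrank ℝ F : ℝ)⁻¹ * τ (I m c * covEnd A (I l) c Y) := ⟨_, fun _ _ => rfl⟩
    have hfd : ∀ m, DifferentiableAt ℝ (f m) b := fun m => by
      rw [show f m = _ from funext (hf m)]
      exact (τ.differentiableAt.comp b ((hI1 m).mul (hN Y))).const_mul _
    have h1 : (fun c => covEnd A (I l) c Y) =ᶠ[nhds b] fun c => ∑ m, f m c • I m c := by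
      filter_upwards [hcoef] with c hc
      simp only [hf]
      exact hc Y
    choose g hg using fun m => hspan.self_of_nhds X m
    have hfI : ∀ m, DifferentiableAt ℝ (fun c => f m c • I m c) b := fun m => (hfd m).smul (hI1 m)
    rw [h1.fderiv_eq, fderiv_fun_sum (fun m _ => hfI m),
      show covEnd A (I l) b Y = _ from h1.self_of_nhds]
    refine ⟨fun n => fderiv ℝ (f n) b X + ∑ m, f m b * g m n, ?_⟩
    simp only [_root_.sum_apply, Finset.mul_sum, Finset.sum_mul,
      ← Finset.sum_sub_distrib, ← Finset.sum_add_distrib]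
    have e2 : ∀ m, fderiv ℝ (fun c => f m c • I m c) b X
        + (A b X * f m b • I m b - f m b • I m b * A b X)
        = fderiv ℝ (f m) b X • I m b + f m b • ∑ n, g m n • I n b := fun m => by
      rw [← hg m, fderiv_fun_smul (hfd m) (hI1 m), covEnd]
      simp only [_root_.add_apply, _root_.smul_apply,
        ContinuousLinearMap.smulRight_apply, mul_smul_comm, smul_mul_assoc]
      module
    simp only [e2, Finset.sum_add_distrib, add_smul, Finset.sum_smul, Finset.smul_sum, mul_smul]
    rw [Finset.sum_comm (f := fun m n => f m b • g m n • I n b)]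
  obtain ⟨a₁, h₁⟩ := hder X Y
  obtain ⟨a₂, h₂⟩ := hder Y X
  refine ⟨a₁ - a₂, ?_⟩
  rw [curvA_commutator hA (hI l), h₁, h₂]
  simp [sub_smul]

/-- The first Bianchi identity, for a form `ι` with values in the trivial bundle with
`d^∇ ι = 0`. -/
theorem curvA_bianchi {ι : B → B →L[ℝ] F} (hA : DifferentiableAt ℝ A b)
    (hι : ContDiffAt ℝ 2 ι b)
    (htors : ∀ᶠ c in nhds b, ∀ X Y,
      fderiv ℝ ι c X Y + A c X (ι c Y) = fderiv ℝ ι c Y X + A c Y (ι c X)) (X Y Z : B) :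
    curvA A b X Y (ι b Z) + curvA A b Y Z (ι b X) + curvA A b Z X (ι b Y) = 0 := by
  have hι1 : DifferentiableAt ℝ ι b := hι.differentiableAt (by norm_num)
  have hι2 : DifferentiableAt ℝ (fderiv ℝ ι) b :=
    (hι.fderiv_right (m := 1) (by norm_num)).differentiableAt (by norm_num)
  have hsymm : ∀ X Y, fderiv ℝ (fderiv ℝ ι) b X Y = fderiv ℝ (fderiv ℝ ι) b Y X :=
    (hι.isSymmSndFDerivAt (by simp))
  have hder : ∀ X Y Z, fderiv ℝ (fun c => fderiv ℝ ι c X Y + A c X (ι c Y)) b Z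
      = fderiv ℝ (fderiv ℝ ι) b Z X Y + (fderiv ℝ A b Z X (ι b Y) + A b X (fderiv ℝ ι b Z Y)) := by
    intro X Y Z
    have hAX : DifferentiableAt ℝ (fun c => A c X) b := hA.clm_apply (differentiableAt_const _)
    have hιX : DifferentiableAt ℝ (fun c => fderiv ℝ ι c X) b :=
      hι2.clm_apply (differentiableAt_const _)
    have hιY : DifferentiableAt ℝ (fun c => ι c Y) b := hι1.clm_apply (differentiableAt_const _)
    have h1 : DifferentiableAt ℝ (fun c => fderiv ℝ ι c X Y) b :=
      hιX.clm_apply (differentiableAt_const _)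
    rw [fderiv_fun_add h1 (hAX.clm_apply hιY), _root_.add_apply, fderiv_eval hιX,
      fderiv_eval hι2, fderiv_clm_apply hAX hιY]
    simp only [_root_.add_apply, ContinuousLinearMap.comp_apply,
      ContinuousLinearMap.flip_apply, fderiv_eval hι1, fderiv_eval hA]
    abel
  have hs : ∀ X Y Z, fderiv ℝ (fun c => fderiv ℝ ι c X Y + A c X (ι c Y)) b Z
      = fderiv ℝ (fun c => fderiv ℝ ι c Y X + A c Y (ι c X)) b Z := fun X Y Z => by
    have : (fun c => fderiv ℝ ι c X Y + A c X (ι c Y))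
        =ᶠ[nhds b] fun c => fderiv ℝ ι c Y X + A c Y (ι c X) := htors.mono fun c hc => hc X Y
    rw [this.fderiv_eq]
  -- The torsion identity is differentiated in the remaining direction, and `A` is applied to it. In
  -- the cyclic sum the second derivatives of `ι` cancel by symmetry.
  have s1 := hs X Y Z
  have s2 := hs Y Z X
  have s3 := hs Z X Y
  have t := htors.self_of_nhds
  have t1 := congrArg (A b Z) (t X Y)
  have t2 := congrArg (A b X) (t Y Z)
  have t3 := congrArg (A b Y) (t Z X)
  simp only [hder, map_add] at s1 s2 s3 t1 t2 t3
  rw [hsymm Z X, hsymm Z Y] at s1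
  rw [hsymm X Y] at s2
  simp only [curvA, _root_.add_apply, _root_.sub_apply,
    mul_apply_eq_comp]
  linear_combination (norm := module) s1 + s2 + s3 + t1 + t2 + t3

end FlatCurvature
end FQuat
end

/-! ### Derivatives of vector valued functions along vector fields on a manifold. -/

noncomputable section
namespace FQuat
section DirectionalDerivative

variable {EN : Type*} [NormedAddCommGroup EN] [NormedSpace ℝ EN]
  {H : Type*} [TopologicalSpace H] {I : ModelWithCorners ℝ EN H} [I.Boundaryless]
  {N : Type*} [TopologicalSpace N] [ChartedSpace H N]
  {G : Type*} [NormedAddCommGroup G] [NormedSpace ℝ G]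
  {G' : Type*} [NormedAddCommGroup G'] [NormedSpace ℝ G']

theorem mdifferentiableAt_iff_chart {u : N → G} {z : N} :
    MDifferentiableAt I 𝓘(ℝ, G) u z ↔
      ContinuousAt u z ∧ DifferentiableAt ℝ (u ∘ (extChartAt I z).symm) (extChartAt I z z) := by
  rw [mdifferentiableAt_iff]
  simp only [I.range_eq_univ, differentiableWithinAt_univ]
  rfl

theorem mvfderiv_eq_fderiv {u : N → G} {z : N} (hu : MDifferentiableAt I 𝓘(ℝ, G) u z)
    (v : TangentSpace I z) :
    mvfderiv I u z v = fderiv ℝ (u ∘ (extChartAt I z).symm) (extChartAt I z z) v := by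
  rw [hu.mvfderiv]
  simp only [I.range_eq_univ, fderivWithin_univ]
  rfl

omit [I.Boundaryless] in
theorem mvfderiv_congr {u u' : N → G} {z : N} (h : u =ᶠ[nhds z] u') :
    mvfderiv I u z = mvfderiv I u' z := by
  have := h.self_of_nhds
  ext v
  simp only [mvfderiv, h.mfderiv_eq]
  rfl

omit [I.Boundaryless] in
theorem mdifferentiableAt_comp' {g : G → G'} {u : N → G} {z : N}
    (hg : DifferentiableAt ℝ g (u z)) (hu : MDifferentiableAt I 𝓘(ℝ, G) u z) :
    MDifferentiableAt I 𝓘(ℝ, G') (fun w => g (u w)) z :=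
  MDifferentiableAt.comp z hg.mdifferentiableAt hu

theorem mvfderiv_comp' {g : G → G'} {u : N → G} {z : N}
    (hg : DifferentiableAt ℝ g (u z)) (hu : MDifferentiableAt I 𝓘(ℝ, G) u z)
    (v : TangentSpace I z) :
    mvfderiv I (fun w => g (u w)) z v = fderiv ℝ g (u z) (mvfderiv I u z v) := by
  have hz : u z = (u ∘ (extChartAt I z).symm) (extChartAt I z z) := by simp
  rw [mvfderiv_eq_fderiv (mdifferentiableAt_comp' hg hu), mvfderiv_eq_fderiv hu]
  rw [hz] at hg
  have := fderiv_comp (extChartAt I z z) hg (mdifferentiableAt_iff_chart.1 hu).2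
  rw [← hz] at this
  exact congrArg (fun L => L v) this

omit [I.Boundaryless] in
theorem mdifferentiableAt_clm_apply {L : N → G →L[ℝ] G'} {u : N → G} {z : N}
    (hL : MDifferentiableAt I 𝓘(ℝ, G →L[ℝ] G') L z) (hu : MDifferentiableAt I 𝓘(ℝ, G) u z) :
    MDifferentiableAt I 𝓘(ℝ, G') (fun w => L w (u w)) z :=
  hL.clm_apply hu

theorem mvfderiv_clm_apply {L : N → G →L[ℝ] G'} {u : N → G} {z : N}
    (hL : MDifferentiableAt I 𝓘(ℝ, G →L[ℝ] G') L z) (hu : MDifferentiableAt I 𝓘(ℝ, G) u z)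
    (v : TangentSpace I z) :
    mvfderiv I (fun w => L w (u w)) z v = mvfderiv I L z v (u z) + L z (mvfderiv I u z v) := by
  rw [mvfderiv_eq_fderiv (hL.clm_apply hu), mvfderiv_eq_fderiv hL, mvfderiv_eq_fderiv hu]
  have := fderiv_clm_apply (mdifferentiableAt_iff_chart.1 hL).2 (mdifferentiableAt_iff_chart.1 hu).2
  refine (congrArg (fun T => T v) this).trans ?_
  change (L ((extChartAt I z).symm (extChartAt I z z)))
      (fderiv ℝ (u ∘ (extChartAt I z).symm) (extChartAt I z z) v)
    + (fderiv ℝ (L ∘ (extChartAt I z).symm) (extChartAt I z z) v)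
      (u ((extChartAt I z).symm (extChartAt I z z))) = _
  rw [extChartAt_to_inv, add_comm]

omit [I.Boundaryless] in
theorem mdifferentiableAt_mul {S T : N → G →L[ℝ] G} {z : N}
    (hS : MDifferentiableAt I 𝓘(ℝ, G →L[ℝ] G) S z) (hT : MDifferentiableAt I 𝓘(ℝ, G →L[ℝ] G) T z) :
    MDifferentiableAt I 𝓘(ℝ, G →L[ℝ] G) (fun w => S w * T w) z :=
  hS.clm_comp hT

theorem mvfderiv_mul_apply {S T : N → G →L[ℝ] G} {z : N}
    (hS : MDifferentiableAt I 𝓘(ℝ, G →L[ℝ] G) S z) (hT : MDifferentiableAt I 𝓘(ℝ, G →L[ℝ] G) T z)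
    (v : TangentSpace I z) :
    mvfderiv I (fun w => S w * T w) z v = mvfderiv I S z v * T z + S z * mvfderiv I T z v := by
  rw [mvfderiv_eq_fderiv (mdifferentiableAt_mul hS hT), mvfderiv_eq_fderiv hS,
    mvfderiv_eq_fderiv hT]
  refine (hasFDerivAt_mul_apply (mdifferentiableAt_iff_chart.1 hS).2
    (mdifferentiableAt_iff_chart.1 hT).2 _).trans ?_
  simp

variable [IsManifold I 2 N]

/-- A vector field in the chart at `z`. -/
def chartField (z : N) (ξ : ∀ w : N, TangentSpace I w) : EN → EN :=
  VectorField.mpullbackWithin 𝓘(ℝ, EN) I (extChartAt I z).symm ξ (Set.range I)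

theorem differentiableAt_chartField [CompleteSpace EN] {z : N} {ξ : ∀ w : N, TangentSpace I w}
    (hξ : ContMDiffAt I I.tangent 1 (fun w => (⟨w, ξ w⟩ : TangentBundle I N)) z) :
    DifferentiableAt ℝ (chartField z ξ) (extChartAt I z z) := by
  have h := contMDiffWithinAt_vectorSpace_iff_contDiffWithinAt.1
      (VectorField.contMDiffWithinAt_mpullbackWithin_extChartAt_symm (m := 1) (n := 2)
        (s := Set.univ) (contMDiffWithinAt_univ.2 hξ) uniqueMDiffOn_univ (Set.mem_univ _) 
        (by norm_num))
  have h2 : ContDiffAt ℝ 1 (chartField z ξ) (extChartAt I z z) := by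
    refine h.contDiffAt ?_
    simp only [Set.preimage_univ, Set.inter_univ]
    exact extChartAt_target_mem_nhds z
  exact h2.differentiableAt (by norm_num)

/-- Near the centre of the chart its inverse has invertible differential, so pulling the field back
and then differentiating in the chart is the same as differentiating along the field. Derivatives
along fields become ordinary ones, which can be differentiated again. -/
theorem mvfderiv_field_eq {f : N → G} {z : N}
    (hf : ∀ᶠ w in nhds z, MDifferentiableAt I 𝓘(ℝ, G) f w) (ξ : ∀ w : N, TangentSpace I w) :
    (fun w => mvfderiv I f w (ξ w)) ∘ (extChartAt I z).symm =ᶠ[nhds (extChartAt I z z)]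
      fun p => fderiv ℝ (f ∘ (extChartAt I z).symm) p (chartField z ξ p) := by
  have h1 : ∀ᶠ p in nhds (extChartAt I z z),
      MDifferentiableAt I 𝓘(ℝ, G) f ((extChartAt I z).symm p) := by
    have := (continuousAt_extChartAt_symm (I := I) z).eventually (by simpa using hf)
    exact this
  filter_upwards [h1, extChartAt_target_mem_nhds (I := I) z] with p hp hpt
  have hinv := isInvertible_mfderivWithin_extChartAt_symm (I := I) (x := z) hpt
  have hd : MDifferentiableAt 𝓘(ℝ, EN) I (extChartAt I z).symm p := by
    have := mdifferentiableWithinAt_extChartAt_symm (I := I) hpt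
    rwa [I.range_eq_univ, mdifferentiableWithinAt_univ] at this
  rw [I.range_eq_univ, mfderivWithin_univ] at hinv
  have e2 : ∀ c : EN, fderiv ℝ (f ∘ (extChartAt I z).symm) p c
      = mfderiv I 𝓘(ℝ, G) f ((extChartAt I z).symm p)
        (mfderiv 𝓘(ℝ, EN) I (extChartAt I z).symm p c) := fun c =>
    (congrArg (fun T : EN →L[ℝ] G => T c) mfderiv_eq_fderiv).symm.trans
      (DFunLike.congr_fun (mfderiv_comp p hp hd) c)
  refine Eq.trans ?_ (e2 _).symm
  simp only [chartField, VectorField.mpullbackWithin_apply, I.range_eq_univ, mfderivWithin_univ]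
  have : (mfderiv 𝓘(ℝ, EN) I (extChartAt I z).symm p)
      ((mfderiv 𝓘(ℝ, EN) I (extChartAt I z).symm p).inverse (ξ ((extChartAt I z).symm p)))
      = ξ ((extChartAt I z).symm p) := hinv.self_apply_inverse _
  exact (congrArg (mfderiv I 𝓘(ℝ, G) f ((extChartAt I z).symm p)) this).symm

omit [I.Boundaryless] in
theorem eventually_mdifferentiableAt {f : N → G} {z : N}
    (hf : ContMDiffAt I 𝓘(ℝ, G) 2 f z) : ∀ᶠ w in nhds z, MDifferentiableAt I 𝓘(ℝ, G) f w := by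
  have := (contMDiffAt_iff_contMDiffAt_nhds (by simp)).1 (hf.of_le (m := 1) (by norm_num))
  exact this.mono fun w hw => hw.mdifferentiableAt (by norm_num)

omit [IsManifold I 2 N] in
theorem contDiffAt_chart {f : N → G} {z : N} {n : WithTop ℕ∞}
    (hf : ContMDiffAt I 𝓘(ℝ, G) n f z) :
    ContDiffAt ℝ n (f ∘ (extChartAt I z).symm) (extChartAt I z z) := by
  have := (contMDiffAt_iff.1 hf).2
  rw [I.range_eq_univ, contDiffWithinAt_univ] at this
  exact this

variable [CompleteSpace EN]

theorem mdifferentiableAt_mvfderiv_field {f : N → G} {z : N} (hf : ContMDiffAt I 𝓘(ℝ, G) 2 f z)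
    {ξ : ∀ w : N, TangentSpace I w}
    (hξ : ContMDiffAt I I.tangent 1 (fun w => (⟨w, ξ w⟩ : TangentBundle I N)) z) :
    MDifferentiableAt I 𝓘(ℝ, G) (fun w => mvfderiv I f w (ξ w)) z := by
  have h0 := mvfderiv_field_eq (eventually_mdifferentiableAt hf) ξ
  have h1 : DifferentiableAt ℝ ((fun w => mvfderiv I f w (ξ w)) ∘ (extChartAt I z).symm)
      (extChartAt I z z) := by
    refine DifferentiableAt.congr_of_eventuallyEq ?_ h0
    exact (((contDiffAt_chart hf).fderiv_right (m := 1) (by norm_num)).differentiableAt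
      (by norm_num)).clm_apply (differentiableAt_chartField hξ)
  refine mdifferentiableAt_iff_chart.2 ⟨?_, h1⟩
  have h2 : ContinuousAt (((fun w => mvfderiv I f w (ξ w)) ∘ (extChartAt I z).symm) ∘
      extChartAt I z) z := h1.continuousAt.comp (continuousAt_extChartAt z)
  refine h2.congr ?_
  filter_upwards [extChartAt_source_mem_nhds (I := I) z] with w hw
  simp only [Function.comp]
  rw [(extChartAt I z).left_inv hw]

/-- The Lie bracket of two vector fields, as a derivation of vector valued functions. -/
theorem mvfderiv_mlieBracket {f : N → G} {z : N} (hf : ContMDiffAt I 𝓘(ℝ, G) 2 f z)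
    {ξ η : ∀ w : N, TangentSpace I w}
    (hξ : ContMDiffAt I I.tangent 1 (fun w => (⟨w, ξ w⟩ : TangentBundle I N)) z)
    (hη : ContMDiffAt I I.tangent 1 (fun w => (⟨w, η w⟩ : TangentBundle I N)) z) :
    mvfderiv I f z (VectorField.mlieBracket I ξ η z)
      = mvfderiv I (fun w => mvfderiv I f w (η w)) z (ξ z)
        - mvfderiv I (fun w => mvfderiv I f w (ξ w)) z (η z) := by
  have hev := eventually_mdifferentiableAt hf
  have hC := contDiffAt_chart hf
  have hC2 := (hC.fderiv_right (m := 1) (by norm_num)).differentiableAt (by norm_num)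
  have hval : ∀ ξ : ∀ w : N, TangentSpace I w, chartField z ξ (extChartAt I z z) = ξ z := by
    intro ξ
    simp only [chartField, VectorField.mpullbackWithin_apply, mfderivWithin_range_extChartAt_symm]
    have : ∀ w (hw : w = z), (ContinuousLinearMap.id ℝ EN).inverse (ξ w) = ξ z := by
      rintro w rfl
      rw [ContinuousLinearMap.inverse_id]
      rfl
    exact this _ (extChartAt_to_inv z)
  -- At the centre of its own chart the differential of the chart is the identity, so the bracket
  -- there is that of the fields read in the chart.
  have hbr : (VectorField.mlieBracket I ξ η z : EN)
      = fderiv ℝ (chartField z η) (extChartAt I z z) (ξ z)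
        - fderiv ℝ (chartField z ξ) (extChartAt I z z) (η z) := by
    rw [← hval ξ, ← hval η]
    rw [VectorField.mlieBracket, VectorField.mlieBracketWithin_apply, mfderiv_extChartAt_self,
      Set.preimage_univ, Set.univ_inter]
    simp only [I.range_eq_univ]
    have e : ∀ (V W : EN → EN) (p : EN), (ContinuousLinearMap.id ℝ EN).inverse
        (VectorField.lieBracketWithin ℝ V W Set.univ p)
        = fderiv ℝ W p (V p) - fderiv ℝ V p (W p) := fun V W p => by
      rw [ContinuousLinearMap.inverse_id, VectorField.lieBracketWithin_univ]; rfl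
    simp only [chartField, I.range_eq_univ]
    exact e _ _ _
  have hsymm := hC.isSymmSndFDerivAt (by simp) (ξ z) (η z)
  rw [mvfderiv_eq_fderiv hev.self_of_nhds,
    mvfderiv_eq_fderiv (mdifferentiableAt_mvfderiv_field hf hη),
    mvfderiv_eq_fderiv (mdifferentiableAt_mvfderiv_field hf hξ),
    (mvfderiv_field_eq hev ξ).fderiv_eq, (mvfderiv_field_eq hev η).fderiv_eq,
    fderiv_clm_apply hC2 (differentiableAt_chartField hξ),
    fderiv_clm_apply hC2 (differentiableAt_chartField hη)]
  have key : ∀ a b c : EN, a = b - c → fderiv ℝ (f ∘ (extChartAt I z).symm) (extChartAt I z z) a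
      = fderiv ℝ (f ∘ (extChartAt I z).symm) (extChartAt I z z) b
        - fderiv ℝ (f ∘ (extChartAt I z).symm) (extChartAt I z z) c := by
    rintro _ b c rfl
    exact map_sub _ _ _
  refine (key _ _ _ hbr).trans ?_
  rw [hval, hval]
  have e : ∀ (a b c d : G), c = d → a - b = a + c - (b + d) := by
    rintro a b c d rfl; abel
  exact e _ _ _ _ hsymm

end DirectionalDerivative
end FQuat
end

/-! ### Covariant derivatives along a map, and the bracket on a twistor space. -/

noncomputable section
namespace FQuat
section BracketCalculus

variable {EN : Type*} [NormedAddCommGroup EN] [NormedSpace ℝ EN]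
  {H : Type*} [TopologicalSpace H] {I : ModelWithCorners ℝ EN H}
  {N : Type*} [TopologicalSpace N] [ChartedSpace H N]
  {B : Type*} [NormedAddCommGroup B] [NormedSpace ℝ B]
  {F : Type*} [NormedAddCommGroup F] [NormedSpace ℝ F]

/-- The covariant derivative along `v` of a section `u` of the pull back by `x : N → B` of the
trivial bundle with fibre `F`, endowed with the connection `d + A`. -/
def covSec (I : ModelWithCorners ℝ EN H) (A : B → B →L[ℝ] F →L[ℝ] F) (x : N → B) (u : N → F)
    (z : N) (v : TangentSpace I z) : F :=
  mvfderiv I u z v + A (x z) (mvfderiv I x z v) (u z)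

/-- The covariant derivative along `v` of a section `T` of the pull back by `x : N → B` of the
endomorphism bundle of the trivial bundle with fibre `F`, endowed with the connection `d + A`. -/
def covHom (I : ModelWithCorners ℝ EN H) (A : B → B →L[ℝ] F →L[ℝ] F) (x : N → B)
    (T : N → F →L[ℝ] F) (z : N) (v : TangentSpace I z) : F →L[ℝ] F :=
  mvfderiv I T z v + (A (x z) (mvfderiv I x z v) * T z - T z * A (x z) (mvfderiv I x z v))

variable [I.Boundaryless] {A : B → B →L[ℝ] F →L[ℝ] F} {x : N → B} {z : N}

theorem covSec_apply {T : N → F →L[ℝ] F} {u : N → F}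
    (hT : MDifferentiableAt I 𝓘(ℝ, F →L[ℝ] F) T z) (hu : MDifferentiableAt I 𝓘(ℝ, F) u z)
    (v : TangentSpace I z) :
    covSec I A x (fun w => T w (u w)) z v
      = covHom I A x T z v (u z) + T z (covSec I A x u z v) := by
  rw [covSec, mvfderiv_clm_apply hT hu, covHom, covSec]
  simp only [_root_.add_apply, _root_.sub_apply, mul_apply_eq_comp, map_add]
  abel

theorem covHom_mul {T U : N → F →L[ℝ] F}
    (hT : MDifferentiableAt I 𝓘(ℝ, F →L[ℝ] F) T z) (hU : MDifferentiableAt I 𝓘(ℝ, F →L[ℝ] F) U z)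
    (v : TangentSpace I z) :
    covHom I A x (fun w => T w * U w) z v
      = covHom I A x T z v * U z + T z * covHom I A x U z v := by
  rw [covHom, mvfderiv_mul_apply hT hU, covHom, covHom]
  noncomm_ring

omit [I.Boundaryless] in
theorem covHom_congr {T U : N → F →L[ℝ] F} (h : T =ᶠ[nhds z] U) (v : TangentSpace I z) :
    covHom I A x T z v = covHom I A x U z v := by
  rw [covHom, covHom, mvfderiv_congr h, h.self_of_nhds]

omit [I.Boundaryless] in
theorem covSec_congr {T U : N → F} (h : T =ᶠ[nhds z] U) (v : TangentSpace I z) :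
    covSec I A x T z v = covSec I A x U z v := by
  rw [covSec, covSec, mvfderiv_congr h, h.self_of_nhds]

variable [IsManifold I 2 N] [CompleteSpace EN]

theorem mdifferentiableAt_covHom {J : N → F →L[ℝ] F} (hJ : ContMDiffAt I 𝓘(ℝ, F →L[ℝ] F) 2 J z)
    (hx : ContMDiffAt I 𝓘(ℝ, B) 2 x z) (hA : DifferentiableAt ℝ A (x z))
    {η : ∀ w : N, TangentSpace I w}
    (hη : ContMDiffAt I I.tangent 1 (fun w => (⟨w, η w⟩ : TangentBundle I N)) z) :
    MDifferentiableAt I 𝓘(ℝ, F →L[ℝ] F) (fun w => covHom I A x J w (η w)) z := by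
  have hJ1 : MDifferentiableAt I 𝓘(ℝ, F →L[ℝ] F) J z := hJ.mdifferentiableAt (by norm_num)
  have h3 : MDifferentiableAt I 𝓘(ℝ, F →L[ℝ] F) (fun w => A (x w) (mvfderiv I x w (η w))) z :=
    mdifferentiableAt_clm_apply
      (mdifferentiableAt_comp' hA (hx.mdifferentiableAt (by norm_num)))
      (mdifferentiableAt_mvfderiv_field hx hη)
  exact (mdifferentiableAt_mvfderiv_field hJ hη).add
    ((mdifferentiableAt_mul h3 hJ1).sub (mdifferentiableAt_mul hJ1 h3))

set_option synthInstance.maxHeartbeats 200000 in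
/-- The Ricci identity for endomorphism fields of a pulled back bundle. -/
theorem covHom_mlieBracket {J : N → F →L[ℝ] F} (hJ : ContMDiffAt I 𝓘(ℝ, F →L[ℝ] F) 2 J z)
    (hx : ContMDiffAt I 𝓘(ℝ, B) 2 x z) (hA : DifferentiableAt ℝ A (x z))
    {ξ η : ∀ w : N, TangentSpace I w}
    (hξ : ContMDiffAt I I.tangent 1 (fun w => (⟨w, ξ w⟩ : TangentBundle I N)) z)
    (hη : ContMDiffAt I I.tangent 1 (fun w => (⟨w, η w⟩ : TangentBundle I N)) z) :
    covHom I A x J z (VectorField.mlieBracket I ξ η z)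
      = covHom I A x (fun w => covHom I A x J w (η w)) z (ξ z)
        - covHom I A x (fun w => covHom I A x J w (ξ w)) z (η z)
        - (curvA A (x z) (mvfderiv I x z (ξ z)) (mvfderiv I x z (η z)) * J z
          - J z * curvA A (x z) (mvfderiv I x z (ξ z)) (mvfderiv I x z (η z))) := by
  have hx1 : MDifferentiableAt I 𝓘(ℝ, B) x z := hx.mdifferentiableAt (by norm_num)
  have hJ1 : MDifferentiableAt I 𝓘(ℝ, F →L[ℝ] F) J z := hJ.mdifferentiableAt (by norm_num)
  have hAx : MDifferentiableAt I 𝓘(ℝ, B →L[ℝ] F →L[ℝ] F) (fun w => A (x w)) z :=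
    mdifferentiableAt_comp' hA hx1
  have hd : ∀ {η ξ : ∀ w : N, TangentSpace I w}
      (_ : ContMDiffAt I I.tangent 1 (fun w => (⟨w, η w⟩ : TangentBundle I N)) z),
      mvfderiv I (fun w => covHom I A x J w (η w)) z (ξ z)
        = mvfderiv I (fun w => mvfderiv I J w (η w)) z (ξ z)
        + ((fderiv ℝ A (x z) (mvfderiv I x z (ξ z)) (mvfderiv I x z (η z))
            + A (x z) (mvfderiv I (fun w => mvfderiv I x w (η w)) z (ξ z))) * J z
          + A (x z) (mvfderiv I x z (η z)) * mvfderiv I J z (ξ z)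
          - (mvfderiv I J z (ξ z) * A (x z) (mvfderiv I x z (η z))
            + J z * (fderiv ℝ A (x z) (mvfderiv I x z (ξ z)) (mvfderiv I x z (η z))
            + A (x z) (mvfderiv I (fun w => mvfderiv I x w (η w)) z (ξ z))))) := by
    intro η ξ hη
    have h1 := mdifferentiableAt_mvfderiv_field hJ hη
    have h2 := mdifferentiableAt_mvfderiv_field hx hη
    have h3 : MDifferentiableAt I 𝓘(ℝ, F →L[ℝ] F) (fun w => A (x w) (mvfderiv I x w (η w))) z :=
      mdifferentiableAt_clm_apply hAx h2
    have h4 := mdifferentiableAt_mul h3 hJ1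
    have h5 := mdifferentiableAt_mul hJ1 h3
    have e1 := congrArg (fun L => L (ξ z)) (mvfderiv_add h1 (h4.sub h5))
    have e2 := congrArg (fun L => L (ξ z)) (mvfderiv_sub h4 h5)
    simp only [_root_.add_apply, _root_.sub_apply] at e1 e2
    refine e1.trans ?_
    have e3 := mvfderiv_comp' (G' := B →L[ℝ] F →L[ℝ] F) hA hx1 (ξ z)
    have e4 := mvfderiv_clm_apply hAx h2 (ξ z)
    rw [e3] at e4
    rw [e2, mvfderiv_mul_apply h3 hJ1, mvfderiv_mul_apply hJ1 h3, e4]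
  have d1 := hd (ξ := ξ) hη
  have d2 := hd (ξ := η) hξ
  rw [covHom, mvfderiv_mlieBracket hJ hξ hη, mvfderiv_mlieBracket hx hξ hη,
    covHom.eq_1 I A x (fun w => covHom I A x J w (η w)),
    covHom.eq_1 I A x (fun w => covHom I A x J w (ξ w)), d1, d2]
  simp only [covHom, curvA, map_sub]
  noncomm_ring

/-- The torsion-freeness of a connection, for vector fields along a map. -/
theorem apply_mlieBracket {P : B → F →L[ℝ] F} {ι : B → B →L[ℝ] F}
    (hx : ContMDiffAt I 𝓘(ℝ, B) 2 x z) (hP : DifferentiableAt ℝ P (x z))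
    (hι : DifferentiableAt ℝ ι (x z)) (hpar : ∀ X, covEnd A P (x z) X = 0)
    (htors : ∀ X Y, fderiv ℝ ι (x z) X Y + A (x z) X (ι (x z) Y)
      = fderiv ℝ ι (x z) Y X + A (x z) Y (ι (x z) X))
    {ξ η : ∀ w : N, TangentSpace I w}
    (hξ : ContMDiffAt I I.tangent 1 (fun w => (⟨w, ξ w⟩ : TangentBundle I N)) z)
    (hη : ContMDiffAt I I.tangent 1 (fun w => (⟨w, η w⟩ : TangentBundle I N)) z)
    {e f : N → F} (he : MDifferentiableAt I 𝓘(ℝ, F) e z) (hf : MDifferentiableAt I 𝓘(ℝ, F) f z)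
    (heξ : ∀ᶠ w in nhds z, P (x w) (e w) = ι (x w) (mvfderiv I x w (ξ w)))
    (hfη : ∀ᶠ w in nhds z, P (x w) (f w) = ι (x w) (mvfderiv I x w (η w))) :
    ι (x z) (mvfderiv I x z (VectorField.mlieBracket I ξ η z))
      = P (x z) (covSec I A x f z (ξ z) - covSec I A x e z (η z)) := by
  have hx1 : MDifferentiableAt I 𝓘(ℝ, B) x z := hx.mdifferentiableAt (by norm_num)
  have hPx : MDifferentiableAt I 𝓘(ℝ, F →L[ℝ] F) (fun w => P (x w)) z :=
    mdifferentiableAt_comp' hP hx1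
  have hιx : MDifferentiableAt I 𝓘(ℝ, B →L[ℝ] F) (fun w => ι (x w)) z :=
    mdifferentiableAt_comp' hι hx1
  have key : ∀ {η ξ : ∀ w : N, TangentSpace I w}
      (_ : ContMDiffAt I I.tangent 1 (fun w => (⟨w, η w⟩ : TangentBundle I N)) z) {f : N → F}
      (_ : MDifferentiableAt I 𝓘(ℝ, F) f z)
      (_ : ∀ᶠ w in nhds z, P (x w) (f w) = ι (x w) (mvfderiv I x w (η w))),
      P (x z) (covSec I A x f z (ξ z)) = fderiv ℝ ι (x z) (mvfderiv I x z (ξ z))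
        (mvfderiv I x z (η z)) + A (x z) (mvfderiv I x z (ξ z)) (ι (x z) (mvfderiv I x z (η z)))
        + ι (x z) (mvfderiv I (fun w => mvfderiv I x w (η w)) z (ξ z)) := by
    intro η ξ hη f hf hfη
    have h2 := mdifferentiableAt_mvfderiv_field hx hη
    -- The relation `P f = ι (x_* η)` is differentiated along `ξ`; as `P` is parallel, its
    -- derivative only contributes commutators with `A`, and the left side becomes `P (∇_ξ f)`.
    have e1 := congrArg (fun L => L (ξ z)) (mvfderiv_congr (I := I) hfη)
    rw [mvfderiv_clm_apply hPx hf, mvfderiv_clm_apply hιx h2, mvfderiv_comp' hP hx1,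
      mvfderiv_comp' hι hx1] at e1
    have e2 := congrArg (fun T : F →L[ℝ] F => T (f z)) (hpar (mvfderiv I x z (ξ z)))
    simp only [covEnd, _root_.add_apply, _root_.sub_apply, mul_apply_eq_comp,
      hfη.self_of_nhds, _root_.zero_apply] at e2
    rw [covSec, map_add]
    linear_combination (norm := module) e1 - e2
  rw [map_sub, key hη hf hfη, key hξ he heξ, mvfderiv_mlieBracket hx hξ hη, map_sub,
    htors (mvfderiv I x z (η z))]
  abel

omit [I.Boundaryless] [IsManifold I 2 N] [CompleteSpace EN] in
theorem covHom_sub_right (T : N → F →L[ℝ] F) (v w : TangentSpace I z) :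
    covHom I A x T z (v - w) = covHom I A x T z v - covHom I A x T z w := by
  simp only [covHom, map_sub]
  noncomm_ring

omit [I.Boundaryless] [IsManifold I 2 N] [CompleteSpace EN] in
theorem covHom_add_right (T : N → F →L[ℝ] F) (v w : TangentSpace I z) :
    covHom I A x T z (v + w) = covHom I A x T z v + covHom I A x T z w := by
  simp only [covHom, map_add]
  noncomm_ring

/-- The integrability, at a point, of the distribution of a twistor space, in terms of sections
of the pull back of a trivial bundle. -/
theorem twistor_bracket {P : B → F →L[ℝ] F} {ι : B → B →L[ℝ] F} {J : N → F →L[ℝ] F}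
    (hx : ContMDiffAt I 𝓘(ℝ, B) 2 x z) (hJ : ContMDiffAt I 𝓘(ℝ, F →L[ℝ] F) 2 J z)
    (hA : DifferentiableAt ℝ A (x z)) (hP : DifferentiableAt ℝ P (x z))
    (hι : DifferentiableAt ℝ ι (x z)) (hpar : ∀ X, covEnd A P (x z) X = 0)
    (htors : ∀ X Y, fderiv ℝ ι (x z) X Y + A (x z) X (ι (x z) Y)
      = fderiv ℝ ι (x z) Y X + A (x z) Y (ι (x z) X))
    (hsq : ∀ᶠ w in nhds z, J w * J w = -1)
    {ξ η : Fin 2 → ∀ w : N, TangentSpace I w}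
    (hξ : ∀ i, ContMDiffAt I I.tangent 1 (fun w => (⟨w, ξ i w⟩ : TangentBundle I N)) z)
    (hη : ∀ i, ContMDiffAt I I.tangent 1 (fun w => (⟨w, η i w⟩ : TangentBundle I N)) z)
    {e f : Fin 2 → N → F} (he : ∀ i, MDifferentiableAt I 𝓘(ℝ, F) (e i) z)
    (hf : ∀ i, MDifferentiableAt I 𝓘(ℝ, F) (f i) z)
    (heξ : ∀ i, ∀ᶠ w in nhds z, P (x w) (e i w) = ι (x w) (mvfderiv I x w (ξ i w)))
    (hfη : ∀ i, ∀ᶠ w in nhds z, P (x w) (f i w) = ι (x w) (mvfderiv I x w (η i w)))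
    (hJe : ∀ᶠ w in nhds z, J w (e 0 w) = e 1 w) (hJf : ∀ᶠ w in nhds z, J w (f 0 w) = f 1 w)
    (hVξ : ∀ᶠ w in nhds z, J w * covHom I A x J w (ξ 0 w) = covHom I A x J w (ξ 1 w))
    (hVη : ∀ᶠ w in nhds z, J w * covHom I A x J w (η 0 w) = covHom I A x J w (η 1 w))
    (hcurv : ∀ R₀ R₁ : F →L[ℝ] F,
      R₀ = curvA A (x z) (mvfderiv I x z (ξ 0 z)) (mvfderiv I x z (η 0 z))
        - curvA A (x z) (mvfderiv I x z (ξ 1 z)) (mvfderiv I x z (η 1 z)) →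
      R₁ = curvA A (x z) (mvfderiv I x z (ξ 0 z)) (mvfderiv I x z (η 1 z))
        + curvA A (x z) (mvfderiv I x z (ξ 1 z)) (mvfderiv I x z (η 0 z)) →
      J z * (R₀ * J z - J z * R₀) = R₁ * J z - J z * R₁)
    {ζ : Fin 2 → TangentSpace I z}
    (hζ₀ : ζ 0 = VectorField.mlieBracket I (ξ 0) (η 0) z - VectorField.mlieBracket I (ξ 1) (η 1) z)
    (hζ₁ : ζ 1 = VectorField.mlieBracket I (ξ 0) (η 1) z
      + VectorField.mlieBracket I (ξ 1) (η 0) z) :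
    (∃ d : Fin 2 → F, J z (d 0) = d 1 ∧ ∀ i, ι (x z) (mvfderiv I x z (ζ i)) = P (x z) (d i)) ∧
      J z * covHom I A x J z (ζ 0) = covHom I A x J z (ζ 1) := by
  have hJ1 : MDifferentiableAt I 𝓘(ℝ, F →L[ℝ] F) J z := hJ.mdifferentiableAt (by norm_num)
  have hsq' := hsq.self_of_nhds
  have hJJ : ∀ y, J z (J z y) = -y := fun y => by
    simpa using congrArg (fun T : F →L[ℝ] F => T y) hsq'
  have vξ := hVξ.self_of_nhds
  have vη := hVη.self_of_nhds
  constructor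
  -- These are the real and imaginary parts of `∇_ξ f - ∇_η e`, for complex `ξ`, `η`, `e`, `f`.
  · refine ⟨![covSec I A x (f 0) z (ξ 0 z) - covSec I A x (e 0) z (η 0 z)
      - (covSec I A x (f 1) z (ξ 1 z) - covSec I A x (e 1) z (η 1 z)),
      covSec I A x (f 1) z (ξ 0 z) - covSec I A x (e 0) z (η 1 z)
      + (covSec I A x (f 0) z (ξ 1 z) - covSec I A x (e 1) z (η 0 z))], ?_, ?_⟩
    -- Differentiating `e 1 = J (e 0)` produces terms `(∇_v J) (e 0)`. They cancel in `J d₀ = d₁`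
    -- because the vertical parts of `ξ` and `η` have type `(0,1)`.
    · have he1 : ∀ v, covSec I A x (e 1) z v
          = covHom I A x J z v (e 0 z) + J z (covSec I A x (e 0) z v) := fun v => by
        rw [← covSec_apply hJ1 (he 0), covSec_congr hJe]
      have hf1 : ∀ v, covSec I A x (f 1) z v
          = covHom I A x J z v (f 0 z) + J z (covSec I A x (f 0) z v) := fun v => by
        rw [← covSec_apply hJ1 (hf 0), covSec_congr hJf]
      simp only [Matrix.cons_val_zero, Matrix.cons_val_one, he1, hf1, ← vξ, ← vη, map_sub, map_add,
        mul_apply_eq_comp, hJJ]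
      abel
    · have h00 := apply_mlieBracket hx hP hι hpar htors (hξ 0) (hη 0) (he 0) (hf 0) (heξ 0) (hfη 0)
      have h01 := apply_mlieBracket hx hP hι hpar htors (hξ 0) (hη 1) (he 0) (hf 1) (heξ 0) (hfη 1)
      have h10 := apply_mlieBracket hx hP hι hpar htors (hξ 1) (hη 0) (he 1) (hf 0) (heξ 1) (hfη 0)
      have h11 := apply_mlieBracket hx hP hι hpar htors (hξ 1) (hη 1) (he 1) (hf 1) (heξ 1) (hfη 1)
      intro i
      fin_cases i
      · simp only [Fin.zero_eta, hζ₀, map_sub, h00, h11, Matrix.cons_val_zero]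
      · simp only [Fin.mk_one, hζ₁, map_add, map_sub, h01, h10, Matrix.cons_val_one, Matrix.cons_val_fin_one]
  · have dξ := fun i => mdifferentiableAt_covHom (A := A) hJ hx hA (hξ i)
    have dη := fun i => mdifferentiableAt_covHom (A := A) hJ hx hA (hη i)
    -- The type condition on the vertical part holds near `z`, so it can be differentiated.
    have hξ1 : ∀ v, covHom I A x (fun w => covHom I A x J w (ξ 1 w)) z v
        = covHom I A x J z v * covHom I A x J z (ξ 0 z)
          + J z * covHom I A x (fun w => covHom I A x J w (ξ 0 w)) z v := fun v => by
      rw [← covHom_mul hJ1 (dξ 0), covHom_congr hVξ]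
    have hη1 : ∀ v, covHom I A x (fun w => covHom I A x J w (η 1 w)) z v
        = covHom I A x J z v * covHom I A x J z (η 0 z)
          + J z * covHom I A x (fun w => covHom I A x J w (η 0 w)) z v := fun v => by
      rw [← covHom_mul hJ1 (dη 0), covHom_congr hVη]
    have hc := hcurv _ _ rfl rfl
    have hJJ' : ∀ T, J z * (J z * T) = -T := fun T => by rw [← mul_assoc, hsq', neg_one_mul]
    rw [hζ₀, hζ₁, covHom_sub_right, covHom_add_right, covHom_mlieBracket hJ hx hA (hξ 0) (hη 0),
      covHom_mlieBracket hJ hx hA (hξ 0) (hη 1), covHom_mlieBracket hJ hx hA (hξ 1) (hη 0),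
      covHom_mlieBracket hJ hx hA (hξ 1) (hη 1)]
    simp only [hξ1, hη1, ← vξ, ← vη]
    simp only [mul_sub, mul_add, sub_mul, add_mul, hJJ', mul_assoc] at hc ⊢
    -- The second derivatives of `J` and the products of its first derivatives cancel; what remains
    -- is the curvature condition.
    linear_combination (norm := abel) -hc

end BracketCalculus
end FQuat
end

/-! ### Representatives of sections, bundle maps and connections in a chart and a trivialization. -/

noncomputable section
namespace FQuat
section LocalRepresentatives

set_option linter.unusedSectionVars false

/-- With `G` of finite dimension, a continuous linear map is, through a basis, the finite family of
its values on the basis vectors. -/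
theorem contDiffAt_of_apply {D G H : Type*} [NormedAddCommGroup D] [NormedSpace ℝ D]
    [NormedAddCommGroup G] [NormedSpace ℝ G] [NormedAddCommGroup H] [NormedSpace ℝ H]
    [FiniteDimensional ℝ G] {n : WithTop ℕ∞} {f : D → G →L[ℝ] H} {b : D}
    (h : ∀ y, ContDiffAt ℝ n (fun x => f x y) b) : ContDiffAt ℝ n f b := by
  let e₁ := ContinuousLinearEquiv.ofFinrankEq (𝕜 := ℝ) (E := G) (F := Fin (finrank ℝ G) → ℝ)
    (Module.finrank_fin_fun ℝ).symm
  let e₂ := (e₁.arrowCongr (1 : H ≃L[ℝ] H)).trans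
    (ContinuousLinearEquiv.piRing (Fin (finrank ℝ G)))
  have h1 : ContDiffAt ℝ n (fun x => e₂ (f x)) b := contDiffAt_pi.2 fun i => h _
  have h2 := e₂.symm.contDiff.contDiffAt.comp b h1
  refine h2.congr_of_eventuallyEq (Filter.Eventually.of_forall fun x => ?_)
  simp

variable {B : Type*} [NormedAddCommGroup B] [NormedSpace ℝ B]
  {M : Type*} [TopologicalSpace M] [ChartedSpace B M] [IsManifold 𝓘(ℝ, B) ∞ M]
  {F : Type*} [NormedAddCommGroup F] [NormedSpace ℝ F]
  {E : M → Type*} [TopologicalSpace (TotalSpace F E)]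
  [∀ x, AddCommGroup (E x)] [∀ x, Module ℝ (E x)] [∀ x, TopologicalSpace (E x)]
  [FiberBundle F E] [VectorBundle ℝ F E]
  {G : Type*} [NormedAddCommGroup G] [NormedSpace ℝ G]
  {E' : M → Type*} [TopologicalSpace (TotalSpace G E')]
  [∀ x, AddCommGroup (E' x)] [∀ x, Module ℝ (E' x)] [∀ x, TopologicalSpace (E' x)]
  [FiberBundle G E'] [VectorBundle ℝ G E']

variable (B F E) in
/-- The open set where the chart and the trivialization at `x₀` are defined. -/
def localDomain (x₀ : M) : Set M := (trivializationAt F E x₀).baseSet ∩ (chartAt B x₀).source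

theorem localDomain_mem_nhds (x₀ : M) : localDomain B F E x₀ ∈ nhds x₀ :=
  Filter.inter_mem ((trivializationAt F E x₀).open_baseSet.mem_nhds
    (FiberBundle.mem_baseSet_trivializationAt F E x₀)) (chart_source_mem_nhds B x₀)

/-- The section of `E` near `x₀` with the given representative in the chart and in the
trivialization at `x₀`. -/
def localSection (x₀ : M) (u : B → F) (y : M) : E y :=
  (trivializationAt F E x₀).symmL ℝ y (u (extChartAt 𝓘(ℝ, B) x₀ y))

variable (F G) in
/-- The representative in the chart and in the trivializations at `x₀` of a bundle map. -/
def homRep (x₀ : M) (T : ∀ y, E y →L[ℝ] E' y) (b : B) : F →L[ℝ] G :=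
  ContinuousLinearMap.inCoordinates F E G E' x₀ ((extChartAt 𝓘(ℝ, B) x₀).symm b) x₀
    ((extChartAt 𝓘(ℝ, B) x₀).symm b) (T ((extChartAt 𝓘(ℝ, B) x₀).symm b))

theorem homRep_apply (x₀ : M) (T : ∀ y, E y →L[ℝ] E' y) (b : B) (f : F) :
    homRep F G x₀ T b f = (trivializationAt G E' x₀).continuousLinearMapAt ℝ
      ((extChartAt 𝓘(ℝ, B) x₀).symm b) (T ((extChartAt 𝓘(ℝ, B) x₀).symm b)
      ((trivializationAt F E x₀).symmL ℝ ((extChartAt 𝓘(ℝ, B) x₀).symm b) f)) := rfl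

theorem homRep_extChartAt {x₀ y : M} (hy : y ∈ (chartAt B x₀).source)
    (T : ∀ y, E y →L[ℝ] E' y) (f : F) :
    homRep F G x₀ T (extChartAt 𝓘(ℝ, B) x₀ y) f
      = (trivializationAt G E' x₀).continuousLinearMapAt ℝ y
        (T y ((trivializationAt F E x₀).symmL ℝ y f)) := by
  rw [homRep, (extChartAt 𝓘(ℝ, B) x₀).left_inv (by simpa using hy)]
  rfl

theorem apply_localSection {x₀ y : M} (hy : y ∈ localDomain B G E' x₀)
    (T : ∀ y, E y →L[ℝ] E' y) (u : B → F) :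
    T y (localSection x₀ u y) = localSection x₀ (fun b => homRep F G x₀ T b (u b)) y := by
  rw [localSection, localSection, homRep_extChartAt hy.2, Trivialization.symmL_continuousLinearMapAt _ hy.1]

theorem contDiffAt_homRep [∀ x, IsTopologicalAddGroup (E' x)] [∀ x, ContinuousSMul ℝ (E' x)]
    {x₀ : M} {T : ∀ y, E y →L[ℝ] E' y} {n : WithTop ℕ∞}
    (hT : ContMDiffAt 𝓘(ℝ, B) (𝓘(ℝ, B).prod 𝓘(ℝ, F →L[ℝ] G)) n
      (fun x => TotalSpace.mk' (F →L[ℝ] G) (E := fun x => E x →L[ℝ] E' x) x (T x)) x₀) :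
    ContDiffAt ℝ n (homRep F G x₀ T) (extChartAt 𝓘(ℝ, B) x₀ x₀) :=
  contDiffAt_chart ((contMDiffAt_hom_bundle _).1 hT).2

theorem contMDiffAt_localSection [ContMDiffVectorBundle ∞ F E 𝓘(ℝ, B)] {x₀ y : M}
    (hy : y ∈ localDomain B F E x₀) (f : F) :
    ContMDiffAt 𝓘(ℝ, B) (𝓘(ℝ, B).prod 𝓘(ℝ, F)) ∞
      (fun x => TotalSpace.mk' F x (localSection (B := B) (E := E) x₀ (fun _ => f) x)) y := by
  rw [(trivializationAt F E x₀).contMDiffAt_section_iff hy.1]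
  refine (contMDiffAt_const (c := f)).congr_of_eventuallyEq ?_
  filter_upwards [(trivializationAt F E x₀).open_baseSet.mem_nhds hy.1] with w hw
  rw [localSection, ← Trivialization.continuousLinearMapAt_apply_of_mem (R := ℝ) _ hw,
    Trivialization.continuousLinearMapAt_symmL _ hw]

theorem mdifferentiableAt_localSection [ContMDiffVectorBundle 1 F E 𝓘(ℝ, B)] {x₀ y : M}
    (hy : y ∈ localDomain B F E x₀) {u : B → F}
    (hu : DifferentiableAt ℝ u (extChartAt 𝓘(ℝ, B) x₀ y)) :
    MDifferentiableAt 𝓘(ℝ, B) (𝓘(ℝ, B).prod 𝓘(ℝ, F))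
      (fun x => TotalSpace.mk' F x (localSection (E := E) x₀ u x)) y := by
  have : IsManifold 𝓘(ℝ, B) 1 M := .of_le (n := ∞) (by simp)
  rw [(trivializationAt F E x₀).mdifferentiableAt_section_iff _ _ hy.1]
  refine (mdifferentiableAt_comp' hu
    (mdifferentiableAt_extChartAt hy.2)).congr_of_eventuallyEq ?_
  filter_upwards [(trivializationAt F E x₀).open_baseSet.mem_nhds hy.1] with w hw
  rw [localSection, ← Trivialization.continuousLinearMapAt_apply_of_mem (R := ℝ) _ hw,
    Trivialization.continuousLinearMapAt_symmL _ hw]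

omit [IsManifold 𝓘(ℝ, B) ∞ M] in
theorem continuousLinearMapAt_eq_mvfderiv [IsManifold 𝓘(ℝ, B) 1 M] {x₀ y : M}
    (hy : y ∈ (chartAt B x₀).source) (X : TangentSpace 𝓘(ℝ, B) y) :
    (trivializationAt B (TangentSpace 𝓘(ℝ, B)) x₀).continuousLinearMapAt ℝ y X
      = mvfderiv 𝓘(ℝ, B) (extChartAt 𝓘(ℝ, B) x₀) y X := by
  rw [TangentBundle.continuousLinearMapAt_trivializationAt hy]
  rfl

omit [IsManifold 𝓘(ℝ, B) ∞ M] in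
theorem symmL_mvfderiv_extChartAt [IsManifold 𝓘(ℝ, B) 1 M] {x₀ y : M}
    (hy : y ∈ (chartAt B x₀).source) (X : TangentSpace 𝓘(ℝ, B) y) :
    (trivializationAt B (TangentSpace 𝓘(ℝ, B)) x₀).symmL ℝ y
      (mvfderiv 𝓘(ℝ, B) (extChartAt 𝓘(ℝ, B) x₀) y X) = X := by
  rw [← continuousLinearMapAt_eq_mvfderiv hy]
  exact Trivialization.symmL_continuousLinearMapAt _ hy X

omit [IsManifold 𝓘(ℝ, B) ∞ M] in
theorem mvfderiv_extChartAt_symmL [IsManifold 𝓘(ℝ, B) 1 M] {x₀ y : M}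
    (hy : y ∈ (chartAt B x₀).source) (X : B) :
    mvfderiv 𝓘(ℝ, B) (extChartAt 𝓘(ℝ, B) x₀) y
      ((trivializationAt B (TangentSpace 𝓘(ℝ, B)) x₀).symmL ℝ y X) = X := by
  rw [← continuousLinearMapAt_eq_mvfderiv hy]
  exact Trivialization.continuousLinearMapAt_symmL _ hy X

variable [FiniteDimensional ℝ B] [T2Space M] [FiniteDimensional ℝ F]
  [∀ x, IsTopologicalAddGroup (E x)] [∀ x, ContinuousSMul ℝ (E x)]
  [ContMDiffVectorBundle ∞ F E 𝓘(ℝ, B)]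

/-- The constant sections in the trivialization at `x₀` agree near `x₀` with global sections. -/
theorem exists_global_sections (x₀ : M) : ∃ σ : F →ₗ[ℝ] ∀ y, E y,
    (∀ f, ContMDiff 𝓘(ℝ, B) (𝓘(ℝ, B).prod 𝓘(ℝ, F)) ∞
      (fun x => TotalSpace.mk' F x (σ f x))) ∧
    ∀ᶠ y in nhds x₀, ∀ f, σ f y = localSection (B := B) x₀ (fun _ => f) y := by
  -- The smoothness of the connection will be used for sections smooth on the whole of `M`, hence
  -- the cut-off by a bump function supported where the trivialization and the chart are defined.
  obtain ⟨χ, -, hχ⟩ := (SmoothBumpFunction.nhds_basis_tsupport (I := 𝓘(ℝ, B)) x₀).mem_iff.1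
    (localDomain_mem_nhds (B := B) (F := F) (E := E) x₀)
  refine ⟨{ toFun := fun f => (χ : M → ℝ) • fun y => localSection (B := B) x₀ (fun _ => f) y
            map_add' := fun f g => ?_
            map_smul' := fun c f => ?_ }, fun f => ?_, ?_⟩
  · ext y
    simp [localSection]
  · ext y
    simp [localSection, smul_comm c]
  · intro y
    by_cases hy : y ∈ tsupport χ
    · exact ContMDiffAt.smul_section χ.contMDiffAt (contMDiffAt_localSection (hχ hy) f)
    · refine (contMDiff_zeroSection ℝ E y).congr_of_eventuallyEq ?_
      filter_upwards [notMem_tsupport_iff_eventuallyEq.1 hy] with w hw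
      simp [hw, zeroSection]
  · filter_upwards [χ.eventuallyEq_one] with y hy f
    simp [hy]

/-- The connection form of a smooth connection, in the trivialization at `x₀`. -/
theorem exists_connForm {nabla : CovariantDerivative 𝓘(ℝ, B) F E}
    (hsmooth : CovariantDerivative.ContMDiffCovariantDerivative nabla ∞) (x₀ : M) :
    ∃ A : B → B →L[ℝ] F →L[ℝ] F, DifferentiableAt ℝ A (extChartAt 𝓘(ℝ, B) x₀ x₀) ∧
      ∀ᶠ y in nhds x₀, ∀ u : B → F, DifferentiableAt ℝ u (extChartAt 𝓘(ℝ, B) x₀ y) →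
        ∀ X : TangentSpace 𝓘(ℝ, B) y,
        (trivializationAt F E x₀).continuousLinearMapAt ℝ y (nabla (localSection x₀ u) y X)
          = fderiv ℝ u (extChartAt 𝓘(ℝ, B) x₀ y) (mvfderiv 𝓘(ℝ, B) (extChartAt 𝓘(ℝ, B) x₀) y X)
            + A (extChartAt 𝓘(ℝ, B) x₀ y) (mvfderiv 𝓘(ℝ, B) (extChartAt 𝓘(ℝ, B) x₀) y X)
              (u (extChartAt 𝓘(ℝ, B) x₀ y)) := by
  have : IsManifold 𝓘(ℝ, B) 1 M := .of_le (n := ∞) (by simp)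
  have : ContMDiffVectorBundle 1 F E 𝓘(ℝ, B) := .of_le (n := ∞) (by simp)
  obtain ⟨σ, hσ, hloc⟩ := exists_global_sections (B := B) (F := F) (E := E) x₀
  have hσ1 : ∀ f y, MDifferentiableAt 𝓘(ℝ, B) (𝓘(ℝ, B).prod 𝓘(ℝ, F))
      (fun x => TotalSpace.mk' F x (σ f x)) y := fun f y => (hσ f y).mdifferentiableAt (by simp)
  have hn : ∀ f, ContDiffAt ℝ ∞ (homRep B F x₀ (nabla (σ f))) (extChartAt 𝓘(ℝ, B) x₀ x₀) := fun f =>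
    contDiffAt_homRep ((contMDiffOn_univ.1 (hsmooth.contMDiff.contMDiff
      (contMDiffOn_univ.2 (hσ f)))) x₀)
  have hadd : ∀ f g y, nabla (σ (f + g)) y = nabla (σ f) y + nabla (σ g) y := fun f g y => by
    rw [map_add]
    exact nabla.isCovariantDerivativeOnUniv.add (hσ1 f _) (hσ1 g _)
  have hsmul : ∀ (c : ℝ) f y, nabla (σ (c • f)) y = c • nabla (σ f) y := fun c f y => by
    rw [map_smul]
    exact nabla.isCovariantDerivativeOnUniv.smul_const c (hσ1 f _)
  -- The connection form at `f` is the derivative of the section that is constant, equal to `f`,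
  -- near `x₀`.
  obtain ⟨A, hA⟩ : ∃ A : B → B →L[ℝ] F →L[ℝ] F, ∀ b X f,
      A b X f = homRep B F x₀ (nabla (σ f)) b X := ⟨fun b => LinearMap.toContinuousLinearMap
    (LinearMap.toContinuousLinearMap.toLinearMap ∘ₗ
      LinearMap.mk₂ ℝ (fun X f => homRep B F x₀ (nabla (σ f)) b X)
        (fun X Y f => map_add _ _ _) (fun c X f => map_smul _ _ _)
        (fun X f g => by
          rw [homRep_apply, hadd, _root_.add_apply, map_add]; rfl)
        (fun c X f => by
          rw [homRep_apply, hsmul, _root_.smul_apply, map_smul]; rfl)), fun b X f => rfl⟩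
  refine ⟨A, ?_, ?_⟩
  · have : ContDiffAt ℝ ∞ A (extChartAt 𝓘(ℝ, B) x₀ x₀) :=
      contDiffAt_of_apply fun X => contDiffAt_of_apply fun f => by
        simp only [hA]
        exact (hn f).clm_apply contDiffAt_const
    exact this.differentiableAt (by simp)
  · filter_upwards [eventually_eventually_nhds.2 hloc, localDomain_mem_nhds (B := B) (F := F) (E := E) x₀]
      with y hy hyd u hu X
    have hLs : ∀ (τ : ∀ y, E y), MDifferentiableAt 𝓘(ℝ, B) (𝓘(ℝ, B).prod 𝓘(ℝ, F))
        (fun x => TotalSpace.mk' F x (τ x)) y → MDifferentiableAt 𝓘(ℝ, B) 𝓘(ℝ, F)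
        (fun w => (trivializationAt F E x₀).continuousLinearMapAt ℝ w (τ w)) y := fun τ hτ => by
      refine (((trivializationAt F E x₀).mdifferentiableAt_section_iff _ _
        hyd.1).1 hτ).congr_of_eventuallyEq ?_
      filter_upwards [(trivializationAt F E x₀).open_baseSet.mem_nhds hyd.1] with w hw
      rw [Trivialization.continuousLinearMapAt_apply_of_mem (R := ℝ) _ hw]
    -- The difference of `∇` and the flat connection of the trivialization is tensorial. Its value
    -- on the section represented by `u` is therefore its value on the constant section through `u
    -- y`, where the flat part vanishes.
    have hT : TensorialAt 𝓘(ℝ, B) F (fun τ : ∀ x, E x =>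
        (trivializationAt F E x₀).continuousLinearMapAt ℝ y (nabla τ y X)
        - mvfderiv 𝓘(ℝ, B)
          (fun w => (trivializationAt F E x₀).continuousLinearMapAt ℝ w (τ w)) y X) y := by
      constructor
      · intro g τ hg hτ
        have e : mvfderiv 𝓘(ℝ, B) (fun w => (trivializationAt F E x₀).continuousLinearMapAt ℝ w
            ((g • τ) w)) y X = g y • mvfderiv 𝓘(ℝ, B)
            (fun w => (trivializationAt F E x₀).continuousLinearMapAt ℝ w (τ w)) y X
            + mvfderiv 𝓘(ℝ, B) g y X • (trivializationAt F E x₀).continuousLinearMapAt ℝ y (τ y) := by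
          refine Eq.trans ?_ (congrArg (fun S => S X) (mvfderiv_smul hg (hLs τ hτ)))
          congr 2
          ext w
          simp
        simp only [e, nabla.isCovariantDerivativeOnUniv.leibniz hτ hg]
        simp only [_root_.add_apply, _root_.smul_apply, ContinuousLinearMap.smulRight_apply,
          map_add, map_smul]
        module
      · intro τ τ' hτ hτ'
        have e : mvfderiv 𝓘(ℝ, B) (fun w => (trivializationAt F E x₀).continuousLinearMapAt ℝ w
            ((τ + τ') w)) y X = mvfderiv 𝓘(ℝ, B)
            (fun w => (trivializationAt F E x₀).continuousLinearMapAt ℝ w (τ w)) y X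
            + mvfderiv 𝓘(ℝ, B)
            (fun w => (trivializationAt F E x₀).continuousLinearMapAt ℝ w (τ' w)) y X := by
          refine Eq.trans ?_ (congrArg (fun S => S X) (mvfderiv_add (hLs τ hτ) (hLs τ' hτ')))
          congr 2
          ext w
          simp
        simp only [e, nabla.isCovariantDerivativeOnUniv.add hτ hτ']
        simp only [_root_.add_apply, map_add]
        module
    have hXd := mdifferentiableAt_extChartAt (I := 𝓘(ℝ, B)) hyd.2
    have h1 := hT.pointwise (mdifferentiableAt_localSection hyd hu)
      (hσ1 (u (extChartAt 𝓘(ℝ, B) x₀ y)) y) (by rw [hy.self_of_nhds]; rfl)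
    have hinv : ∀ᶠ w in nhds y, ∀ v : B → F,
        (trivializationAt F E x₀).continuousLinearMapAt ℝ w (localSection x₀ v w)
          = v (extChartAt 𝓘(ℝ, B) x₀ w) := by
      filter_upwards [(trivializationAt F E x₀).open_baseSet.mem_nhds hyd.1] with w hw v
      exact Trivialization.continuousLinearMapAt_symmL _ hw _
    have e1 : (fun w => (trivializationAt F E x₀).continuousLinearMapAt ℝ w (localSection x₀ u w))
        =ᶠ[nhds y] fun w => u (extChartAt 𝓘(ℝ, B) x₀ w) := hinv.mono fun w hw => hw u
    have e2 : (fun w => (trivializationAt F E x₀).continuousLinearMapAt ℝ w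
        (σ (u (extChartAt 𝓘(ℝ, B) x₀ y)) w))
        =ᶠ[nhds y] fun w => u (extChartAt 𝓘(ℝ, B) x₀ y) := by
      filter_upwards [hinv, hy] with w hw hw'
      rw [hw', hw]
    have e3 : A (extChartAt 𝓘(ℝ, B) x₀ y) (mvfderiv 𝓘(ℝ, B) (extChartAt 𝓘(ℝ, B) x₀) y X)
        (u (extChartAt 𝓘(ℝ, B) x₀ y)) = (trivializationAt F E x₀).continuousLinearMapAt ℝ y
          (nabla (σ (u (extChartAt 𝓘(ℝ, B) x₀ y))) y X) := by
      rw [hA, homRep_extChartAt hyd.2]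
      congr 2
      exact symmL_mvfderiv_extChartAt hyd.2 X
    simp only [mvfderiv_congr e1, mvfderiv_congr e2, mvfderiv_const, mvfderiv_comp' hu hXd,
      _root_.zero_apply, sub_zero] at h1
    rw [e3, ← h1]
    abel

end LocalRepresentatives
end FQuat
end

/-! ### The connection form on endomorphism fields, and smoothness of the projection on `T M`. -/

noncomputable section
namespace FQuat
section LocalIdentities

set_option linter.unusedSectionVars false

variable {B : Type*} [NormedAddCommGroup B] [NormedSpace ℝ B]
  {M : Type*} [TopologicalSpace M] [ChartedSpace B M] [IsManifold 𝓘(ℝ, B) ∞ M]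
  {F : Type*} [NormedAddCommGroup F] [NormedSpace ℝ F]
  {E : M → Type*} [TopologicalSpace (TotalSpace F E)]
  [∀ x, AddCommGroup (E x)] [∀ x, Module ℝ (E x)] [∀ x, TopologicalSpace (E x)]
  [∀ x, IsTopologicalAddGroup (E x)] [∀ x, ContinuousSMul ℝ (E x)]
  [FiberBundle F E] [VectorBundle ℝ F E]

/-- `A` is the connection form of `∇` in the chart and in the trivialization at `x₀`. -/
def IsConnForm (nabla : CovariantDerivative 𝓘(ℝ, B) F E) (x₀ : M)
    (A : B → B →L[ℝ] F →L[ℝ] F) : Prop :=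
  ∀ᶠ y in nhds x₀, ∀ u : B → F, DifferentiableAt ℝ u (extChartAt 𝓘(ℝ, B) x₀ y) →
    ∀ X : TangentSpace 𝓘(ℝ, B) y,
    (trivializationAt F E x₀).continuousLinearMapAt ℝ y (nabla (localSection x₀ u) y X)
      = fderiv ℝ u (extChartAt 𝓘(ℝ, B) x₀ y) (mvfderiv 𝓘(ℝ, B) (extChartAt 𝓘(ℝ, B) x₀) y X)
        + A (extChartAt 𝓘(ℝ, B) x₀ y) (mvfderiv 𝓘(ℝ, B) (extChartAt 𝓘(ℝ, B) x₀) y X)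
          (u (extChartAt 𝓘(ℝ, B) x₀ y))

theorem eventually_chart {x₀ : M} {Q : B → Prop}
    (h : ∀ᶠ y in nhds x₀, Q (extChartAt 𝓘(ℝ, B) x₀ y)) :
    ∀ᶠ b in nhds (extChartAt 𝓘(ℝ, B) x₀ x₀), Q b := by
  have h1 := (continuousAt_extChartAt_symm (I := 𝓘(ℝ, B)) x₀).eventually
    (by rw [extChartAt_to_inv]; exact h)
  filter_upwards [h1, extChartAt_target_mem_nhds (I := 𝓘(ℝ, B)) x₀] with b hb hbt
  rwa [(extChartAt 𝓘(ℝ, B) x₀).right_inv hbt] at hb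

theorem eventually_of_chart {x₀ : M} {Q : B → Prop}
    (h : ∀ᶠ b in nhds (extChartAt 𝓘(ℝ, B) x₀ x₀), Q b) :
    ∀ᶠ y in nhds x₀, Q (extChartAt 𝓘(ℝ, B) x₀ y) :=
  (continuousAt_extChartAt (I := 𝓘(ℝ, B)) x₀).eventually h

theorem localSection_const {x₀ y : M} (hy : y ∈ localDomain B F E x₀) (e : E y) :
    localSection (B := B) x₀
      (fun _ => (trivializationAt F E x₀).continuousLinearMapAt ℝ y e) y = e :=
  Trivialization.symmL_continuousLinearMapAt _ hy.1 e

variable {nabla : CovariantDerivative 𝓘(ℝ, B) F E} {x₀ : M} {A : B → B →L[ℝ] F →L[ℝ] F}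

/-- The covariant derivative of an endomorphism field, in the trivialization at `x₀`. -/
theorem IsConnForm.endDeriv [FiniteDimensional ℝ F] [ContMDiffVectorBundle ∞ F E 𝓘(ℝ, B)]
    (hA : IsConnForm nabla x₀ A) :
    ∀ᶠ y in nhds x₀, ∀ T : ∀ x, E x →L[ℝ] E x,
      MDifferentiableAt 𝓘(ℝ, B) (𝓘(ℝ, B).prod 𝓘(ℝ, F →L[ℝ] F))
        (fun x => TotalSpace.mk' (F →L[ℝ] F) (E := fun x => E x →L[ℝ] E x) x (T x)) y →
      DifferentiableAt ℝ (homRep F F x₀ T) (extChartAt 𝓘(ℝ, B) x₀ y) →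
      ∀ (X : TangentSpace 𝓘(ℝ, B) y) (e : E y),
      (trivializationAt F E x₀).continuousLinearMapAt ℝ y (FQuat.endDeriv nabla T y X e)
        = covEnd A (homRep F F x₀ T) (extChartAt 𝓘(ℝ, B) x₀ y)
          (mvfderiv 𝓘(ℝ, B) (extChartAt 𝓘(ℝ, B) x₀) y X)
          ((trivializationAt F E x₀).continuousLinearMapAt ℝ y e) := by
  have : IsManifold 𝓘(ℝ, B) 1 M := .of_le (n := ∞) (by simp)
  have : ContMDiffVectorBundle 1 F E 𝓘(ℝ, B) := .of_le (n := ∞) (by simp)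
  have hdom := localDomain_mem_nhds (B := B) (F := F) (E := E) x₀
  filter_upwards [hA, eventually_mem_nhds_iff.2 hdom] with y hAy hy T hT hT' X e
  have hy' := mem_of_mem_nhds hy
  have hσ := mdifferentiableAt_localSection hy' (differentiableAt_const (𝕜 := ℝ)
    ((trivializationAt F E x₀).continuousLinearMapAt ℝ y e))
  have h1 := endDeriv_apply nabla T y hT X _ hσ
  rw [localSection_const hy'] at h1
  have hT2 : DifferentiableAt ℝ (fun b => homRep F F x₀ T b
      ((trivializationAt F E x₀).continuousLinearMapAt ℝ y e)) (extChartAt 𝓘(ℝ, B) x₀ y) :=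
    hT'.clm_apply (differentiableAt_const _)
  rw [h1, nabla.isCovariantDerivativeOnUniv.congr_of_eventuallyEq
    (MDifferentiableAt.clm_bundle_apply hT hσ) (mdifferentiableAt_localSection hy' hT2)
    Filter.univ_mem (by filter_upwards [hy] with w hw; exact apply_localSection (B := B) hw T _), map_sub,
    hAy _ hT2]
  have h2 := hAy _ (differentiableAt_const (𝕜 := ℝ)
    ((trivializationAt F E x₀).continuousLinearMapAt ℝ y e)) X
  have h3 : (trivializationAt F E x₀).continuousLinearMapAt ℝ y (T y (nabla (localSection (B := B) x₀
      fun _ => (trivializationAt F E x₀).continuousLinearMapAt ℝ y e) y X))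
      = homRep F F x₀ T (extChartAt 𝓘(ℝ, B) x₀ y)
        ((trivializationAt F E x₀).continuousLinearMapAt ℝ y (nabla (localSection (B := B) x₀
      fun _ => (trivializationAt F E x₀).continuousLinearMapAt ℝ y e) y X)) := by
    rw [homRep_extChartAt hy'.2, Trivialization.symmL_continuousLinearMapAt _ hy'.1]
  rw [h3, h2, fderiv_const_apply, _root_.zero_apply, zero_add, covEnd]
  simp only [_root_.add_apply, _root_.sub_apply, mul_apply_eq_comp]
  rw [add_sub_assoc]
  congr 1
  exact fderiv_eval hT' _ _

namespace AlmostFQuaternionic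

variable (S : AlmostFQuaternionic (M := M) B F E)

theorem exists_decomp (x : M) (e : E x) : ∃ X, ∃ v ∈ S.V x, e = S.ι x X + v := by
  have h : e ∈ LinearMap.range (S.ι x).toLinearMap ⊔ S.V x := by
    rw [(S.isCompl x).sup_eq_top]; trivial
  obtain ⟨_, ⟨X, rfl⟩, v, hv, rfl⟩ := Submodule.mem_sup.1 h
  exact ⟨X, v, hv, rfl⟩

/-- A representative of the projection `ρ`. -/
structure IsProjRep (x₀ : M) (ρ : B → F →L[ℝ] B) : Prop where
  contDiffAt : ContDiffAt ℝ ∞ ρ (extChartAt 𝓘(ℝ, B) x₀ x₀)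
  apply_ι : ∀ᶠ y in nhds x₀, ∀ X : TangentSpace 𝓘(ℝ, B) y, ρ (extChartAt 𝓘(ℝ, B) x₀ y)
    ((trivializationAt F E x₀).continuousLinearMapAt ℝ y (S.ι y X))
      = mvfderiv 𝓘(ℝ, B) (extChartAt 𝓘(ℝ, B) x₀) y X
  apply_V : ∀ᶠ y in nhds x₀, ∀ v ∈ S.V y, ρ (extChartAt 𝓘(ℝ, B) x₀ y)
    ((trivializationAt F E x₀).continuousLinearMapAt ℝ y v) = 0

theorem contDiffAt_homRep_ι (x₀ : M) :
    ContDiffAt ℝ ∞ (homRep B F x₀ S.ι) (extChartAt 𝓘(ℝ, B) x₀ x₀) :=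
  contDiffAt_homRep (S.ι_smooth x₀)

theorem homRep_ι_apply {x₀ y : M} (hy : y ∈ (chartAt B x₀).source) (X : TangentSpace 𝓘(ℝ, B) y) :
    homRep B F x₀ S.ι (extChartAt 𝓘(ℝ, B) x₀ y) (mvfderiv 𝓘(ℝ, B) (extChartAt 𝓘(ℝ, B) x₀) y X)
      = (trivializationAt F E x₀).continuousLinearMapAt ℝ y (S.ι y X) := by
  have : IsManifold 𝓘(ℝ, B) 1 M := .of_le (n := ∞) (by simp)
  rw [homRep_extChartAt hy]
  congr 2
  exact symmL_mvfderiv_extChartAt hy X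

/-- `ρ` is defined fibrewise, so its smoothness has to be derived. A smooth frame `s` of `V` and `ι`
give the smooth family `Φ b : (X, c) ↦ ι X + ∑ c_j s_j`, bijective since `E = T M ⊕ V`. Inversion is
smooth at an invertible map, and `ρ` is the first component of the inverse. -/
theorem exists_isProjRep [FiniteDimensional ℝ B] [FiniteDimensional ℝ F]
    [ContMDiffVectorBundle ∞ F E 𝓘(ℝ, B)] (x₀ : M) : ∃ ρ, S.IsProjRep x₀ ρ := by
  have : IsManifold 𝓘(ℝ, B) 1 M := .of_le (n := ∞) (by simp)
  obtain ⟨U, hU, hxU, n, s, hs, hsV⟩ := S.V_smooth x₀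
  have hdom := localDomain_mem_nhds (B := B) (F := F) (E := E) x₀
  let t : Fin n → B → F := fun j b => (trivializationAt F E x₀).continuousLinearMapAt ℝ
    ((extChartAt 𝓘(ℝ, B) x₀).symm b) (s j ((extChartAt 𝓘(ℝ, B) x₀).symm b))
  have ht : ∀ j, ContDiffAt ℝ ∞ (t j) (extChartAt 𝓘(ℝ, B) x₀ x₀) := fun j => by
    have h := (hs j x₀ hxU).contMDiffAt (hU.mem_nhds hxU)
    rw [contMDiffAt_section] at h
    refine contDiffAt_chart (f := fun y => (trivializationAt F E x₀).continuousLinearMapAt ℝ y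
      (s j y)) (h.congr_of_eventuallyEq ?_)
    filter_upwards [hdom] with w hw
    rw [Trivialization.continuousLinearMapAt_apply_of_mem (R := ℝ) _ hw.1]
  let Φ : B → (B × (Fin n → ℝ)) →L[ℝ] F := fun b =>
    (homRep B F x₀ S.ι b).coprod (∑ j, (ContinuousLinearMap.proj j).smulRight (t j b))
  have hΦ : ContDiffAt ℝ ∞ Φ (extChartAt 𝓘(ℝ, B) x₀ x₀) := by
    refine contDiffAt_of_apply fun p => ?_
    have : ContDiffAt ℝ ∞ (fun b => homRep B F x₀ S.ι b p.1 + ∑ j, p.2 j • t j b)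
        (extChartAt 𝓘(ℝ, B) x₀ x₀) :=
      ((S.contDiffAt_homRep_ι x₀).clm_apply contDiffAt_const).add
        (ContDiffAt.sum fun j _ => (ht j).const_smul (p.2 j))
    refine this.congr_of_eventuallyEq (Filter.Eventually.of_forall fun b => ?_)
    simp [Φ]
  have hval : ∀ y ∈ localDomain B F E x₀, ∀ (X : TangentSpace 𝓘(ℝ, B) y) (c : Fin n → ℝ),
      Φ (extChartAt 𝓘(ℝ, B) x₀ y) (mvfderiv 𝓘(ℝ, B) (extChartAt 𝓘(ℝ, B) x₀) y X, c)
        = (trivializationAt F E x₀).continuousLinearMapAt ℝ y (S.ι y X + ∑ j, c j • s j y) := by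
    intro y hy X c
    have htj : ∀ j, t j (extChartAt 𝓘(ℝ, B) x₀ y)
        = (trivializationAt F E x₀).continuousLinearMapAt ℝ y (s j y) := fun j => by
      have : ∀ w, w = y → (trivializationAt F E x₀).continuousLinearMapAt ℝ w (s j w)
        = (trivializationAt F E x₀).continuousLinearMapAt ℝ y (s j y) := by rintro _ rfl; rfl
      exact this _ ((extChartAt 𝓘(ℝ, B) x₀).left_inv (by simpa using hy.2))
    rw [map_add, ← S.homRep_ι_apply hy.2, map_sum]
    simp only [Φ, ContinuousLinearMap.coprod_apply, _root_.sum_apply,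
      ContinuousLinearMap.smulRight_apply, ContinuousLinearMap.proj_apply, htj, map_smul]
  have hbij : ∀ y ∈ localDomain B F E x₀ ∩ U,
      Function.Bijective (Φ (extChartAt 𝓘(ℝ, B) x₀ y)) := by
    rintro y ⟨hy, hyU⟩
    constructor
    · refine (injective_iff_map_eq_zero _).2 ?_
      rintro ⟨X, c⟩ h
      rw [← mvfderiv_extChartAt_symmL hy.2 X, hval y hy] at h
      have h0 := congrArg ((trivializationAt F E x₀).symmL ℝ y) h
      rw [Trivialization.symmL_continuousLinearMapAt _ hy.1, map_zero] at h0
      have hv : ∑ j, c j • s j y ∈ S.V y := by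
        rw [← (hsV y hyU).2, Submodule.mem_span_range_iff_exists_fun]
        exact ⟨c, rfl⟩
      have h1 : ∑ j, c j • s j y = 0 := by
        refine Submodule.disjoint_def.1 (S.isCompl y).disjoint _ ?_ hv
        rw [eq_neg_of_add_eq_zero_right h0]
        exact neg_mem (LinearMap.mem_range_self (S.ι y).toLinearMap _)
      rw [h1, add_zero] at h0
      have h2 : (trivializationAt B (TangentSpace 𝓘(ℝ, B)) x₀).symmL ℝ y X = 0 :=
        S.ι_injective y (h0.trans (map_zero _).symm)
      have h3 : X = 0 := by
        rw [← mvfderiv_extChartAt_symmL hy.2 X, h2, map_zero]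
      exact Prod.ext h3 (funext (Fintype.linearIndependent_iff.1 (hsV y hyU).1 c h1))
    · intro f
      obtain ⟨X, v, hv, he⟩ := S.exists_decomp y ((trivializationAt F E x₀).symmL ℝ y f)
      rw [← (hsV y hyU).2, Submodule.mem_span_range_iff_exists_fun] at hv
      obtain ⟨c, rfl⟩ := hv
      refine ⟨(mvfderiv 𝓘(ℝ, B) (extChartAt 𝓘(ℝ, B) x₀) y X, c), ?_⟩
      rw [hval y hy, ← he, Trivialization.continuousLinearMapAt_symmL _ hy.1]
  have hinvert : ∀ y ∈ localDomain B F E x₀ ∩ U, (Φ (extChartAt 𝓘(ℝ, B) x₀ y)).IsInvertible :=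
    fun y hy => ⟨(LinearEquiv.ofBijective (Φ (extChartAt 𝓘(ℝ, B) x₀ y)).toLinearMap
      (hbij y hy)).toContinuousLinearEquiv, by ext <;> rfl⟩
  have hinv : ∀ y ∈ localDomain B F E x₀ ∩ U, ∀ (X : TangentSpace 𝓘(ℝ, B) y) (c : Fin n → ℝ),
      (ContinuousLinearMap.fst ℝ B (Fin n → ℝ) ∘L (Φ (extChartAt 𝓘(ℝ, B) x₀ y)).inverse)
        ((trivializationAt F E x₀).continuousLinearMapAt ℝ y (S.ι y X + ∑ j, c j • s j y))
        = mvfderiv 𝓘(ℝ, B) (extChartAt 𝓘(ℝ, B) x₀) y X := by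
    intro y hy X c
    rw [← hval y hy.1]
    exact congrArg Prod.fst ((hinvert y hy).inverse_apply_self _)
  refine ⟨fun b => ContinuousLinearMap.fst ℝ B (Fin n → ℝ) ∘L (Φ b).inverse, ?_, ?_, ?_⟩
  · obtain ⟨e, he⟩ := hinvert x₀ ⟨mem_of_mem_nhds hdom, hxU⟩
    have h1 := contDiffAt_map_inverse (𝕜 := ℝ) (n := ∞) e
    rw [he] at h1
    exact contDiffAt_const.clm_comp (h1.comp _ hΦ)
  · filter_upwards [hdom, hU.mem_nhds hxU] with y hy hyU X
    have := hinv y ⟨hy, hyU⟩ X 0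
    simpa using this
  · filter_upwards [hdom, hU.mem_nhds hxU] with y hy hyU v hv
    rw [← (hsV y hyU).2, Submodule.mem_span_range_iff_exists_fun] at hv
    obtain ⟨c, rfl⟩ := hv
    have := hinv y ⟨hy, hyU⟩ 0 c
    simpa using this

end AlmostFQuaternionic

end LocalIdentities
end FQuat
end

/-! ### Compatibility and torsion-freeness in the trivialization. -/

noncomputable section
namespace FQuat
namespace AlmostFQuaternionic

set_option linter.unusedSectionVars false

variable {B : Type*} [NormedAddCommGroup B] [NormedSpace ℝ B]
  {M : Type*} [TopologicalSpace M] [ChartedSpace B M] [IsManifold 𝓘(ℝ, B) ∞ M]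
  {F : Type*} [NormedAddCommGroup F] [NormedSpace ℝ F]
  {E : M → Type*} [TopologicalSpace (TotalSpace F E)]
  [∀ x, AddCommGroup (E x)] [∀ x, Module ℝ (E x)] [∀ x, TopologicalSpace (E x)]
  [∀ x, IsTopologicalAddGroup (E x)] [∀ x, ContinuousSMul ℝ (E x)]
  [FiberBundle F E] [VectorBundle ℝ F E]
  {S : AlmostFQuaternionic (M := M) B F E}
  {nabla : CovariantDerivative 𝓘(ℝ, B) F E} {x₀ : M} {A : B → B →L[ℝ] F →L[ℝ] F}
  {ρ : B → F →L[ℝ] B}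

variable (S) in
/-- The representative of the projection of `E` on `T M`. -/
def projRep (x₀ : M) (ρ : B → F →L[ℝ] B) (b : B) : F →L[ℝ] F :=
  homRep B F x₀ S.ι b ∘L ρ b

theorem IsProjRep.contDiffAt_projRep (hρ : S.IsProjRep x₀ ρ) :
    ContDiffAt ℝ ∞ (S.projRep x₀ ρ) (extChartAt 𝓘(ℝ, B) x₀ x₀) :=
  (S.contDiffAt_homRep_ι x₀).clm_comp hρ.contDiffAt

/-- The representatives of `ρ` and of `ι ∘ ρ`, applied to a vector `e = ι X + v`. -/
theorem IsProjRep.eventually_apply (hρ : S.IsProjRep x₀ ρ) :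
    ∀ᶠ y in nhds x₀, ∀ (X : TangentSpace 𝓘(ℝ, B) y), ∀ v ∈ S.V y,
      ρ (extChartAt 𝓘(ℝ, B) x₀ y)
        ((trivializationAt F E x₀).continuousLinearMapAt ℝ y (S.ι y X + v))
        = mvfderiv 𝓘(ℝ, B) (extChartAt 𝓘(ℝ, B) x₀) y X ∧
      S.projRep x₀ ρ (extChartAt 𝓘(ℝ, B) x₀ y)
        ((trivializationAt F E x₀).continuousLinearMapAt ℝ y (S.ι y X + v))
        = (trivializationAt F E x₀).continuousLinearMapAt ℝ y (S.ι y X) := by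
  filter_upwards [hρ.apply_ι, hρ.apply_V,
    localDomain_mem_nhds (B := B) (F := F) (E := E) x₀] with y h1 h2 hy X v hv
  have h3 : ρ (extChartAt 𝓘(ℝ, B) x₀ y)
      ((trivializationAt F E x₀).continuousLinearMapAt ℝ y (S.ι y X + v))
      = mvfderiv 𝓘(ℝ, B) (extChartAt 𝓘(ℝ, B) x₀) y X := by
    rw [map_add, map_add, h1, h2 v hv, add_zero]
  refine ⟨h3, ?_⟩
  rw [projRep, ContinuousLinearMap.comp_apply, h3, S.homRep_ι_apply hy.2]

theorem IsProjRep.ρ_comp_ι (hρ : S.IsProjRep x₀ ρ) :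
    ∀ᶠ y in nhds x₀, ∀ X : B, ρ (extChartAt 𝓘(ℝ, B) x₀ y)
      (homRep B F x₀ S.ι (extChartAt 𝓘(ℝ, B) x₀ y) X) = X := by
  have : IsManifold 𝓘(ℝ, B) 1 M := .of_le (n := ∞) (by simp)
  filter_upwards [hρ.apply_ι, localDomain_mem_nhds (B := B) (F := F) (E := E) x₀] with y h1 hy X
  rw [← mvfderiv_extChartAt_symmL hy.2 X, S.homRep_ι_apply hy.2, h1]

/-- A vector is in `V` when its image under the representative of `ρ` vanishes. -/
theorem IsProjRep.mem_V (hρ : S.IsProjRep x₀ ρ) :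
    ∀ᶠ y in nhds x₀, ∀ f : F, S.projRep x₀ ρ (extChartAt 𝓘(ℝ, B) x₀ y) f = 0 →
      (trivializationAt F E x₀).symmL ℝ y f ∈ S.V y := by
  filter_upwards [hρ.eventually_apply, localDomain_mem_nhds (B := B) (F := F) (E := E) x₀]
    with y h1 hy f hf
  obtain ⟨X, v, hv, he⟩ := S.exists_decomp y ((trivializationAt F E x₀).symmL ℝ y f)
  have h2 := (h1 X v hv).2
  rw [← he, Trivialization.continuousLinearMapAt_symmL _ hy.1, hf] at h2
  have h3 := congrArg ((trivializationAt F E x₀).symmL ℝ y) h2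
  rw [Trivialization.symmL_continuousLinearMapAt _ hy.1, map_zero] at h3
  rw [he, ← h3, zero_add]
  exact hv

variable [ContMDiffVectorBundle ∞ F E 𝓘(ℝ, B)]

/-- The projection on `T M` is parallel. -/
theorem IsProjRep.covEnd_eq_zero (hρ : S.IsProjRep x₀ ρ) (hA : IsConnForm nabla x₀ A)
    (hcomp : S.IsCompatible nabla) :
    ∀ᶠ b in nhds (extChartAt 𝓘(ℝ, B) x₀ x₀), ∀ X, covEnd A (S.projRep x₀ ρ) b X = 0 := by
  have : IsManifold 𝓘(ℝ, B) 1 M := .of_le (n := ∞) (by simp)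
  have : ContMDiffVectorBundle 1 F E 𝓘(ℝ, B) := .of_le (n := ∞) (by simp)
  have hdiff : ∀ᶠ b in nhds (extChartAt 𝓘(ℝ, B) x₀ x₀),
      DifferentiableAt ℝ (S.projRep x₀ ρ) b := by
    filter_upwards [(hρ.contDiffAt_projRep.of_le (m := 1) (by simp)).eventually (by simp)] with b hb
    exact hb.differentiableAt (by simp)
  refine eventually_chart ?_
  filter_upwards [hA, eventually_of_chart hdiff, hρ.eventually_apply.eventually_nhds,
    hρ.eventually_apply, eventually_mem_nhds_iff.2
    (localDomain_mem_nhds (B := B) (F := F) (E := E) x₀)] with y hAy hP hdec hdec' hyn X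
  have hy := mem_of_mem_nhds hyn
  rw [← mvfderiv_extChartAt_symmL hy.2 X]
  ext f
  obtain ⟨Y, hY⟩ : ∃ Y, Y = (trivializationAt B (TangentSpace 𝓘(ℝ, B)) x₀).symmL ℝ y X := ⟨_, rfl⟩
  rw [← hY]
  have hu : DifferentiableAt ℝ (fun b => S.projRep x₀ ρ b f) (extChartAt 𝓘(ℝ, B) x₀ y) :=
    hP.clm_apply (differentiableAt_const _)
  have hu' : DifferentiableAt ℝ (fun b => f - S.projRep x₀ ρ b f) (extChartAt 𝓘(ℝ, B) x₀ y) :=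
    (differentiableAt_const _).sub hu
  -- For constant `f`, the sections `P f` and `f - P f` lie in `T M` and in `V`, so their
  -- derivatives do too: `P ∇(P f) = ∇(P f)` and `P ∇(f - P f) = 0`. Together these give `P ∇f = ∇(P
  -- f)`.
  have hmem : ∀ᶠ w in nhds y,
      localSection x₀ (fun b => S.projRep x₀ ρ b f) w ∈ LinearMap.range (S.ι w).toLinearMap ∧
      localSection x₀ (fun b => f - S.projRep x₀ ρ b f) w ∈ S.V w := by
    filter_upwards [hdec, hyn] with w hw hwd
    obtain ⟨Z, v, hv, he⟩ := S.exists_decomp w ((trivializationAt F E x₀).symmL ℝ w f)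
    have h2 := (hw Z v hv).2
    rw [← he, Trivialization.continuousLinearMapAt_symmL _ hwd.1] at h2
    simp only [localSection, h2, map_sub, Trivialization.symmL_continuousLinearMapAt _ hwd.1]
    refine ⟨LinearMap.mem_range_self _ Z, ?_⟩
    rw [he]
    simpa using hv
  have m1 := hcomp.preserves_T _ y (mdifferentiableAt_localSection hy hu)
    (hmem.mono fun w h => h.1) Y
  have m2 := hcomp.preserves_V _ y (mdifferentiableAt_localSection hy hu')
    (hmem.mono fun w h => h.2) Y
  have e1 := hAy _ hu Y
  have e2 := hAy _ hu' Y
  obtain ⟨Z, hZ⟩ := m1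
  have p1 := (hdec' Z 0 (zero_mem _)).2
  have p2 := (hdec' 0 _ m2).2
  rw [add_zero, show S.ι y Z = _ from hZ] at p1
  rw [map_zero, zero_add, map_zero] at p2
  rw [e1] at p1
  rw [e2] at p2
  have hfd : fderiv ℝ (fun b => f - S.projRep x₀ ρ b f) (extChartAt 𝓘(ℝ, B) x₀ y)
      = -fderiv ℝ (fun b => S.projRep x₀ ρ b f) (extChartAt 𝓘(ℝ, B) x₀ y) := by
    rw [fderiv_const_sub]
  have hfe : fderiv ℝ (fun b => S.projRep x₀ ρ b f) (extChartAt 𝓘(ℝ, B) x₀ y)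
      (mvfderiv 𝓘(ℝ, B) (extChartAt 𝓘(ℝ, B) x₀) y Y) = fderiv ℝ (S.projRep x₀ ρ)
      (extChartAt 𝓘(ℝ, B) x₀ y) (mvfderiv 𝓘(ℝ, B) (extChartAt 𝓘(ℝ, B) x₀) y Y) f :=
    fderiv_eval hP _ _
  rw [hfe] at p1
  rw [hfd, _root_.neg_apply, hfe] at p2
  simp only [map_add, map_sub, map_neg] at p1 p2
  simp only [covEnd, _root_.add_apply, _root_.sub_apply, mul_apply_eq_comp, _root_.zero_apply]
  linear_combination (norm := module) -p1 - p2

variable [FiniteDimensional ℝ F]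

/-- The connection preserves the span of an admissible frame. -/
theorem covEnd_homRep_mem_span (hA : IsConnForm nabla x₀ A) (hcomp : S.IsCompatible nabla)
    {U : Set M} {𝕀 : Fin 3 → ∀ x, E x →L[ℝ] E x} (h𝕀 : IsAdmissibleFrame B F S.Z U 𝕀)
    (hx : x₀ ∈ U) :
    ∀ᶠ b in nhds (extChartAt 𝓘(ℝ, B) x₀ x₀), ∀ X l, ∃ a : Fin 3 → ℝ,
      covEnd A (homRep F F x₀ (𝕀 l)) b X = ∑ m, a m • homRep F F x₀ (𝕀 m) b := by
  have : IsManifold 𝓘(ℝ, B) 1 M := .of_le (n := ∞) (by simp)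
  have hsm : ∀ l, ∀ y ∈ U, ContMDiffAt 𝓘(ℝ, B) (𝓘(ℝ, B).prod 𝓘(ℝ, F →L[ℝ] F)) ∞
      (fun x => TotalSpace.mk' (F →L[ℝ] F) (E := fun x => E x →L[ℝ] E x) x (𝕀 l x)) y :=
    fun l y hy => (h𝕀.smooth l).contMDiffAt (h𝕀.isOpen.mem_nhds hy)
  have hdiff : ∀ᶠ b in nhds (extChartAt 𝓘(ℝ, B) x₀ x₀), ∀ l,
      DifferentiableAt ℝ (homRep F F x₀ (𝕀 l)) b := by
    refine Filter.eventually_all.2 fun l => ?_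
    filter_upwards [((contDiffAt_homRep (hsm l x₀ hx)).of_le (m := 1) (by simp)).eventually
      (by simp)] with b hb
    exact hb.differentiableAt (by simp)
  refine eventually_chart ?_
  filter_upwards [hA.endDeriv, eventually_of_chart hdiff, h𝕀.isOpen.mem_nhds hx,
    localDomain_mem_nhds (B := B) (F := F) (E := E) x₀] with y hAy hd hyU hy X l
  rw [← mvfderiv_extChartAt_symmL hy.2 X]
  obtain ⟨Y, hY⟩ : ∃ Y, Y = (trivializationAt B (TangentSpace 𝓘(ℝ, B)) x₀).symmL ℝ y X := ⟨_, rfl⟩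
  rw [← hY]
  obtain ⟨c, hc⟩ := hcomp.quaternionic U 𝕀 h𝕀 y hyU Y l
  refine ⟨c, ?_⟩
  ext f
  have h1 := hAy (𝕀 l) ((hsm l y hyU).mdifferentiableAt (by simp)) (hd l) Y
    ((trivializationAt F E x₀).symmL ℝ y f)
  rw [Trivialization.continuousLinearMapAt_symmL _ hy.1, hc] at h1
  rw [← h1, map_sum, _root_.sum_apply]
  simp only [map_smul, _root_.smul_apply, homRep_extChartAt hy.2]

/-- The torsion-freeness of the connection induced on `T M`. -/
theorem torsion_symm [FiniteDimensional ℝ B] (hA : IsConnForm nabla x₀ A)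
    {D : CovariantDerivative 𝓘(ℝ, B) B (TangentSpace 𝓘(ℝ, B) : M → Type _)}
    (hD : ∀ x, D.torsion x = 0) (hind : S.IsInducedBy nabla D) :
    ∀ᶠ b in nhds (extChartAt 𝓘(ℝ, B) x₀ x₀), ∀ X Y,
      fderiv ℝ (homRep B F x₀ S.ι) b X Y + A b X (homRep B F x₀ S.ι b Y)
        = fderiv ℝ (homRep B F x₀ S.ι) b Y X + A b Y (homRep B F x₀ S.ι b X) := by
  have : IsManifold 𝓘(ℝ, B) 1 M := .of_le (n := ∞) (by simp)
  have : IsManifold 𝓘(ℝ, B) 2 M := inferInstance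
  have : ContMDiffVectorBundle 1 F E 𝓘(ℝ, B) := .of_le (n := ∞) (by simp)
  have : CompleteSpace B := FiniteDimensional.complete ℝ B
  have hdiff : ∀ᶠ b in nhds (extChartAt 𝓘(ℝ, B) x₀ x₀),
      DifferentiableAt ℝ (homRep B F x₀ S.ι) b := by
    filter_upwards [((S.contDiffAt_homRep_ι x₀).of_le (m := 1) (by simp)).eventually
      (by simp)] with b hb
    exact hb.differentiableAt (by simp)
  refine eventually_chart ?_
  filter_upwards [hA, eventually_of_chart hdiff, eventually_mem_nhds_iff.2
    (localDomain_mem_nhds (B := B) (F := F) (E := E) x₀)] with y hAy hd hyn X Y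
  have hy := mem_of_mem_nhds hyn
  have hyt : y ∈ localDomain B B (TangentSpace 𝓘(ℝ, B) : M → Type _) x₀ := ⟨hy.2, hy.2⟩
  let c : B → ∀ w : M, TangentSpace 𝓘(ℝ, B) w := fun X =>
    localSection (B := B) (F := B) x₀ fun _ => X
  have hc : ∀ X, ContMDiffAt 𝓘(ℝ, B) 𝓘(ℝ, B).tangent ∞
      (fun w => (⟨w, c X w⟩ : TangentBundle 𝓘(ℝ, B) M)) y := fun X =>
    contMDiffAt_localSection hyt X
  have hcd : ∀ X, MDifferentiableAt 𝓘(ℝ, B) 𝓘(ℝ, B).tangent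
      (fun w => (⟨w, c X w⟩ : TangentBundle 𝓘(ℝ, B) M)) y := fun X =>
    (hc X).mdifferentiableAt (by simp)
  have hval : ∀ X, ∀ᶠ w in nhds y, mvfderiv 𝓘(ℝ, B) (extChartAt 𝓘(ℝ, B) x₀) w (c X w) = X :=
    fun X => by
      filter_upwards [hyn] with w hw
      exact mvfderiv_extChartAt_symmL hw.2 X
  -- Coordinate fields commute, since the derivatives of the coordinates along them are constant.
  -- Thus zero torsion means `D_{c X} (c Y) = D_{c Y} (c X)`, and `ι` transports this to `E`.
  have hbr : VectorField.mlieBracket 𝓘(ℝ, B) (c X) (c Y) y = 0 := by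
    have h1 := mvfderiv_mlieBracket (f := extChartAt 𝓘(ℝ, B) x₀)
      (contMDiffAt_extChartAt' hy.2) ((hc X).of_le (by simp))
      ((hc Y).of_le (by simp))
    rw [mvfderiv_congr (hval X), mvfderiv_congr (hval Y), mvfderiv_const,
      mvfderiv_const] at h1
    have h2 := symmL_mvfderiv_extChartAt hy.2 (VectorField.mlieBracket 𝓘(ℝ, B) (c X) (c Y) y)
    rw [h1] at h2
    rw [← h2]
    simp
  have htor := D.torsion_apply (hcd X) (hcd Y)
  rw [hD, hbr] at htor
  have key : ∀ X Y, (trivializationAt F E x₀).continuousLinearMapAt ℝ y (S.ι y (D (c Y) y (c X y)))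
      = fderiv ℝ (homRep B F x₀ S.ι) (extChartAt 𝓘(ℝ, B) x₀ y) X Y
        + A (extChartAt 𝓘(ℝ, B) x₀ y) X (homRep B F x₀ S.ι (extChartAt 𝓘(ℝ, B) x₀ y) Y) := by
    intro X Y
    have hu : DifferentiableAt ℝ (fun b => homRep B F x₀ S.ι b Y) (extChartAt 𝓘(ℝ, B) x₀ y) :=
      hd.clm_apply (differentiableAt_const _)
    have hloc := mdifferentiableAt_localSection hy hu
    have hev : ∀ᶠ w in nhds y, S.ι w (c Y w)
        = localSection (B := B) (E := E) x₀ (fun b => homRep B F x₀ S.ι b Y) w := by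
      filter_upwards [hyn] with w hw
      exact apply_localSection (B := B) hw S.ι _
    have h1 := hAy _ hu (c X y)
    rw [(hval X).self_of_nhds] at h1
    rw [← hind.restrict (c Y) y (hcd Y) (c X y),
      nabla.isCovariantDerivativeOnUniv.congr_of_eventuallyEq
      (hloc.congr_of_eventuallyEq (hev.mono fun w hw => congrArg (TotalSpace.mk' F w) hw)) hloc Filter.univ_mem hev, h1]
    congr 1
    exact fderiv_eval hd _ _
  rw [← key, ← key]
  congr 2
  rw [sub_zero] at htor
  exact sub_eq_zero.1 htor.symm

end AlmostFQuaternionic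
end FQuat
end

/-! ### The curvature of the compatible connection satisfies the algebraic hypotheses. -/

noncomputable section
namespace FQuat
section CurvatureForm

variable {B : Type*} [NormedAddCommGroup B] [NormedSpace ℝ B]
  {F : Type*} [NormedAddCommGroup F] [NormedSpace ℝ F]
  {A : B → B →L[ℝ] F →L[ℝ] F} {b : B}

theorem curvA_swap (X Y : B) : curvA A b X Y = -curvA A b Y X := by
  simp only [curvA]
  abel

set_option synthInstance.maxHeartbeats 200000 in
theorem curvA_add_left (X X' Y : B) : curvA A b (X + X') Y = curvA A b X Y + curvA A b X' Y := by
  simp only [curvA, map_add, _root_.add_apply, add_mul, mul_add]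
  abel

set_option synthInstance.maxHeartbeats 200000 in
theorem curvA_smul_left (c : ℝ) (X Y : B) : curvA A b (c • X) Y = c • curvA A b X Y := by
  simp only [curvA, map_smul, _root_.smul_apply, smul_mul_assoc, mul_smul_comm]
  module

theorem curvA_add_right (X Y Y' : B) : curvA A b X (Y + Y') = curvA A b X Y + curvA A b X Y' := by
  rw [curvA_swap, curvA_add_left, neg_add, ← curvA_swap X Y, ← curvA_swap X Y']

theorem curvA_smul_right (c : ℝ) (X Y : B) : curvA A b X (c • Y) = c • curvA A b X Y := by
  rw [curvA_swap, curvA_smul_left, ← smul_neg, ← curvA_swap X Y]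

end CurvatureForm

namespace AlmostFQuaternionic

set_option linter.unusedSectionVars false

variable {B : Type*} [NormedAddCommGroup B] [NormedSpace ℝ B]
  {M : Type*} [TopologicalSpace M] [ChartedSpace B M] [IsManifold 𝓘(ℝ, B) ∞ M]
  {F : Type*} [NormedAddCommGroup F] [NormedSpace ℝ F]
  {E : M → Type*} [TopologicalSpace (TotalSpace F E)]
  [∀ x, AddCommGroup (E x)] [∀ x, Module ℝ (E x)] [∀ x, TopologicalSpace (E x)]
  [∀ x, IsTopologicalAddGroup (E x)] [∀ x, ContinuousSMul ℝ (E x)]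
  [FiberBundle F E] [VectorBundle ℝ F E]
  {S : AlmostFQuaternionic (M := M) B F E}
  {nabla : CovariantDerivative 𝓘(ℝ, B) F E} {x₀ : M} {A : B → B →L[ℝ] F →L[ℝ] F}
  {ρ : B → F →L[ℝ] B} {U : Set M} {𝕀 : Fin 3 → ∀ x, E x →L[ℝ] E x}

theorem _root_.FQuat.IsAdmissibleFrame.isQuatFrame_homRep {Z : ∀ x, Set (E x →L[ℝ] E x)}
    (h𝕀 : IsAdmissibleFrame B F Z U 𝕀) {y : M} (hyU : y ∈ U) (hy : y ∈ localDomain B F E x₀) :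
    IsQuatFrame (homRep F F x₀ (𝕀 0) (extChartAt 𝓘(ℝ, B) x₀ y) : F →ₗ[ℝ] F)
      (homRep F F x₀ (𝕀 1) (extChartAt 𝓘(ℝ, B) x₀ y))
      (homRep F F x₀ (𝕀 2) (extChartAt 𝓘(ℝ, B) x₀ y)) := by
  have h : ∀ l f, homRep F F x₀ (𝕀 l) (extChartAt 𝓘(ℝ, B) x₀ y) f
      = (trivializationAt F E x₀).continuousLinearMapAt ℝ y
        (𝕀 l y ((trivializationAt F E x₀).symmL ℝ y f)) := fun l f => homRep_extChartAt hy.2 _ _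
  constructor <;> intro f <;>
    simp only [ContinuousLinearMap.coe_coe, h, Trivialization.symmL_continuousLinearMapAt _ hy.1,
      h𝕀.sq y hyU, h𝕀.mul₀₁ y hyU, h𝕀.mul₁₀ y hyU, map_neg,
      Trivialization.continuousLinearMapAt_symmL _ hy.1]

theorem _root_.FQuat.IsAdmissibleFrame.mem {Z : ∀ x, Set (E x →L[ℝ] E x)}
    (h𝕀 : IsAdmissibleFrame B F Z U 𝕀) {y : M} (hyU : y ∈ U) (l : Fin 3) : 𝕀 l y ∈ Z y := by
  rw [h𝕀.admissible y hyU]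
  refine ⟨⟨EuclideanSpace.single l 1, by simp⟩, ?_⟩
  rw [Finset.sum_eq_single l] <;> simp +contextual

/-- `J V ⊆ T M` for the representatives of the admissible complex structures. -/
theorem IsProjRep.apply_homRep_of_ker (hρ : S.IsProjRep x₀ ρ)
    (h𝕀 : IsAdmissibleFrame B F S.Z U 𝕀) (hx : x₀ ∈ U) :
    ∀ᶠ y in nhds x₀, ∀ l f, S.projRep x₀ ρ (extChartAt 𝓘(ℝ, B) x₀ y) f = 0 →
      S.projRep x₀ ρ (extChartAt 𝓘(ℝ, B) x₀ y)
        (homRep F F x₀ (𝕀 l) (extChartAt 𝓘(ℝ, B) x₀ y) f)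
        = homRep F F x₀ (𝕀 l) (extChartAt 𝓘(ℝ, B) x₀ y) f := by
  filter_upwards [hρ.mem_V, hρ.eventually_apply, h𝕀.isOpen.mem_nhds hx,
    localDomain_mem_nhds (B := B) (F := F) (E := E) x₀] with y hV hP hyU hy l f hf
  obtain ⟨X, hX⟩ := S.J_mem y _ (h𝕀.mem hyU l) _ (hV f hf)
  rw [homRep_extChartAt hy.2, ← hX]
  simpa using (hP X 0 (zero_mem _)).2

/-- The trivialization at `x₀` maps `V` at `x₀` isomorphically onto this kernel. -/
theorem IsProjRep.finrank_ker (hρ : S.IsProjRep x₀ ρ) :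
    finrank ℝ (LinearMap.ker (S.projRep x₀ ρ (extChartAt 𝓘(ℝ, B) x₀ x₀) : F →ₗ[ℝ] F))
      = finrank ℝ (S.V x₀) := by
  have hx := mem_of_mem_nhds (localDomain_mem_nhds (B := B) (F := F) (E := E) x₀)
  let e := ((trivializationAt F E x₀).continuousLinearEquivAt ℝ x₀ hx.1).toLinearEquiv
  have he : ∀ v, e v = (trivializationAt F E x₀).continuousLinearMapAt ℝ x₀ v := fun v =>
    congrFun (Trivialization.coe_continuousLinearEquivAt_eq _ hx.1) v
  have h : LinearMap.ker (S.projRep x₀ ρ (extChartAt 𝓘(ℝ, B) x₀ x₀) : F →ₗ[ℝ] F)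
      = (S.V x₀).map e.toLinearMap := by
    ext f
    constructor
    · intro hf
      refine ⟨(trivializationAt F E x₀).symmL ℝ x₀ f, hρ.mem_V.self_of_nhds f hf, ?_⟩
      exact (he _).trans (Trivialization.continuousLinearMapAt_symmL (R := ℝ) _ hx.1 f)
    · rintro ⟨v, hv, rfl⟩
      have := (hρ.eventually_apply.self_of_nhds 0 v hv).2
      rw [map_zero, zero_add, map_zero] at this
      refine LinearMap.mem_ker.2 (Eq.trans ?_ this)
      exact congrArg _ (he v)
  rw [h]
  exact e.finrank_map_eq _

variable [ContMDiffVectorBundle ∞ F E 𝓘(ℝ, B)] [FiniteDimensional ℝ F] [FiniteDimensional ℝ B]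

/-- The curvature of a torsion-free compatible connection. -/
theorem IsProjRep.curvA_zeroOne (hρ : S.IsProjRep x₀ ρ) (hA : IsConnForm nabla x₀ A)
    (hAd : DifferentiableAt ℝ A (extChartAt 𝓘(ℝ, B) x₀ x₀))
    {D : CovariantDerivative 𝓘(ℝ, B) B (TangentSpace 𝓘(ℝ, B) : M → Type _)}
    (hD : ∀ x, D.torsion x = 0) (hind : S.IsInducedBy nabla D)
    {r : ℕ} (hr : finrank ℝ (S.V x₀) = r)
    (hrank : (4 * r < finrank ℝ F ∧ 8 ≤ 4 * r) ∨ (finrank ℝ F = 4 * r ∧ 12 ≤ 4 * r))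
    (h𝕀 : IsAdmissibleFrame B F S.Z U 𝕀) (hx : x₀ ∈ U)
    (a : Fin 3 → ℝ) (ha : a 0 ^ 2 + a 1 ^ 2 + a 2 ^ 2 = 1) {J : F →L[ℝ] F}
    (hJ : J = ∑ j, a j • homRep F F x₀ (𝕀 j) (extChartAt 𝓘(ℝ, B) x₀ x₀)) (x y : F)
    {R₀ R₁ : F →L[ℝ] F}
    (h₀ : R₀ = curvA A (extChartAt 𝓘(ℝ, B) x₀ x₀) (ρ (extChartAt 𝓘(ℝ, B) x₀ x₀) x)
        (ρ (extChartAt 𝓘(ℝ, B) x₀ x₀) y) - curvA A (extChartAt 𝓘(ℝ, B) x₀ x₀)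
        (ρ (extChartAt 𝓘(ℝ, B) x₀ x₀) (J x)) (ρ (extChartAt 𝓘(ℝ, B) x₀ x₀) (J y)))
    (h₁ : R₁ = curvA A (extChartAt 𝓘(ℝ, B) x₀ x₀) (ρ (extChartAt 𝓘(ℝ, B) x₀ x₀) x)
        (ρ (extChartAt 𝓘(ℝ, B) x₀ x₀) (J y)) + curvA A (extChartAt 𝓘(ℝ, B) x₀ x₀)
        (ρ (extChartAt 𝓘(ℝ, B) x₀ x₀) (J x)) (ρ (extChartAt 𝓘(ℝ, B) x₀ x₀) y)) :
    J * (R₀ * J - J * R₀) = R₁ * J - J * R₁ := by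
  have hxd := mem_of_mem_nhds (localDomain_mem_nhds (B := B) (F := F) (E := E) x₀)
  obtain ⟨b, hb⟩ : ∃ b, b = extChartAt 𝓘(ℝ, B) x₀ x₀ := ⟨_, rfl⟩
  have hnt : Nontrivial F := Module.nontrivial_of_finrank_pos (R := ℝ) (by omega)
  have hρι := hρ.ρ_comp_ι.self_of_nhds
  have hP2 : ContDiffAt ℝ 2 (S.projRep x₀ ρ) (extChartAt 𝓘(ℝ, B) x₀ x₀) :=
    hρ.contDiffAt_projRep.of_le ENat.LEInfty.out
  have hI2 : ∀ l, ContDiffAt ℝ 2 (homRep F F x₀ (𝕀 l)) (extChartAt 𝓘(ℝ, B) x₀ x₀) := fun l =>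
    (contDiffAt_homRep ((h𝕀.smooth l).contMDiffAt (h𝕀.isOpen.mem_nhds hx))).of_le
      ENat.LEInfty.out
  have hι2 : ContDiffAt ℝ 2 (homRep B F x₀ S.ι) (extChartAt 𝓘(ℝ, B) x₀ x₀) :=
    (S.contDiffAt_homRep_ι x₀).of_le ENat.LEInfty.out
  have hcomm := curvA_commutator_of_parallel hAd hP2 (hρ.covEnd_eq_zero hA hind.compatible)
  have hbian := curvA_bianchi hAd hι2 (torsion_symm hA hD hind)
  have hq : ∀ᶠ c in nhds (extChartAt 𝓘(ℝ, B) x₀ x₀),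
      IsQuatFrame (homRep F F x₀ (𝕀 0) c : F →ₗ[ℝ] F) (homRep F F x₀ (𝕀 1) c)
        (homRep F F x₀ (𝕀 2) c) := by
    refine eventually_chart ?_
    filter_upwards [h𝕀.isOpen.mem_nhds hx, localDomain_mem_nhds (B := B) (F := F) (E := E) x₀]
      with y hyU hy
    exact h𝕀.isQuatFrame_homRep hyU hy
  have hspan := curvA_commutator_mem_span hAd hI2 hq
    (covEnd_homRep_mem_span hA hind.compatible h𝕀 hx)
  have hker := (hρ.apply_homRep_of_ker h𝕀 hx).self_of_nhds
  have hrk := hρ.finrank_ker.trans hr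
  have hq0 := hq.self_of_nhds
  have hPe : ∀ f, S.projRep x₀ ρ (extChartAt 𝓘(ℝ, B) x₀ x₀) f
      = homRep B F x₀ S.ι (extChartAt 𝓘(ℝ, B) x₀ x₀) (ρ (extChartAt 𝓘(ℝ, B) x₀ x₀) f) :=
    fun f => rfl
  rw [← hb] at h₀ h₁ hJ hρι hcomm hbian hspan hker hrk hq0 hPe
  have hρP : ∀ f, ρ b (S.projRep x₀ ρ b f) = ρ b f := fun f => by rw [hPe, hρι]
  -- The curvature is pulled back to `F` by `ρ`: its arguments become vectors of `E`, on which the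
  -- complex structures act, and it vanishes when one of them is in `V`.
  let R : F →ₗ[ℝ] F →ₗ[ℝ] End ℝ F := LinearMap.mk₂ ℝ
    (fun x y => (curvA A b (ρ b x) (ρ b y) : F →ₗ[ℝ] F))
    (fun x x' y => by rw [map_add, curvA_add_left]; rfl)
    (fun c x y => by rw [map_smul, curvA_smul_left]; rfl)
    (fun x y y' => by rw [map_add, curvA_add_right]; rfl)
    (fun c x y => by rw [map_smul, curvA_smul_right]; rfl)
  have hR : ∀ x y f, R x y f = curvA A b (ρ b x) (ρ b y) f := fun x y f => rfl
  have key := curvature_zeroOne (I := fun l => (homRep F F x₀ (𝕀 l) b : F →ₗ[ℝ] F)) hq0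
    (P := (S.projRep x₀ ρ b : F →ₗ[ℝ] F)) (fun x => by simp [hPe, hρι])
    (fun l v hv => hker l v hv) (R := R)
    (fun x y => by
      ext f
      rw [LinearMap.neg_apply, hR, hR, curvA_swap]
      rfl)
    (fun x y => by ext f; simp only [hR, ContinuousLinearMap.coe_coe, hρP])
    (fun x y f => by
      simp only [hR, ContinuousLinearMap.coe_coe]
      exact congrArg (fun T : F →L[ℝ] F => T f) (hcomm (ρ b x) (ρ b y)))
    (fun x y f => by
      simp only [hR, ContinuousLinearMap.coe_coe, hPe]
      exact hbian _ _ _)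
    (fun x y l => by
      obtain ⟨c, hc⟩ := hspan (ρ b x) (ρ b y) l
      refine ⟨c, fun f => ?_⟩
      simpa [hR] using congrArg (fun T : F →L[ℝ] F => T f) hc)
    hrk hrank a ha x y
  have hJc : ∀ f, combo (fun l => (homRep F F x₀ (𝕀 l) b : F →ₗ[ℝ] F)) a f = J f := fun f => by
    rw [combo_apply, hJ, Fin.sum_univ_three]; rfl
  ext f
  have := key f
  simp only [hJc, LinearMap.sub_apply, LinearMap.add_apply, hR] at this
  rw [h₀, h₁]
  exact this

end AlmostFQuaternionic
end FQuat
end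

/-! ### The tautological section of the twistor space and its covariant derivative. -/

noncomputable section
namespace FQuat
section TwistorSpace

set_option linter.unusedSectionVars false

variable {B : Type*} [NormedAddCommGroup B] [NormedSpace ℝ B]
  {M : Type*} [TopologicalSpace M] [ChartedSpace B M] [IsManifold 𝓘(ℝ, B) ∞ M]
  {F : Type*} [NormedAddCommGroup F] [NormedSpace ℝ F]
  {E : M → Type*} [TopologicalSpace (TotalSpace F E)]
  [∀ x, AddCommGroup (E x)] [∀ x, Module ℝ (E x)] [∀ x, TopologicalSpace (E x)]
  [∀ x, IsTopologicalAddGroup (E x)] [∀ x, ContinuousSMul ℝ (E x)]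
  [FiberBundle F E] [VectorBundle ℝ F E]
  {nabla : CovariantDerivative 𝓘(ℝ, B) F E} {x₀ : M} {A : B → B →L[ℝ] F →L[ℝ] F}
  {U : Set M} {𝕀 : Fin 3 → ∀ x, E x →L[ℝ] E x} {Z : ∀ x, Set (E x →L[ℝ] E x)}

variable (B) in
/-- The coordinates of the projection of a point of `M × S²` in the chart at `x₀`. -/
def baseChart (x₀ : M) (w : M × S2) : B := extChartAt 𝓘(ℝ, B) x₀ w.1

theorem contMDiffAt_baseChart {w : M × S2} (hw : w.1 ∈ (chartAt B x₀).source) :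
    ContMDiffAt (𝓘(ℝ, B).prod (𝓡 2)) 𝓘(ℝ, B) ∞ (baseChart B x₀) w :=
  (contMDiffAt_extChartAt' hw).comp w contMDiffAt_fst

theorem mvfderiv_baseChart {w : M × S2} (hw : w.1 ∈ (chartAt B x₀).source) (ξ : TZ (B := B) w) :
    mvfderiv (𝓘(ℝ, B).prod (𝓡 2)) (baseChart B x₀) w ξ
      = mvfderiv 𝓘(ℝ, B) (extChartAt 𝓘(ℝ, B) x₀) w.1 (baseComp w ξ) := by
  have : IsManifold 𝓘(ℝ, B) 1 M := .of_le (n := ∞) (by simp)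
  have h := mfderiv_comp (I := 𝓘(ℝ, B).prod (𝓡 2)) (I' := 𝓘(ℝ, B)) w
    (mdifferentiableAt_extChartAt (I := 𝓘(ℝ, B)) hw) mdifferentiableAt_fst
  exact congrArg (fun L => L ξ) h

theorem contMDiff_sphere_coe :
    ContMDiff (𝓘(ℝ, B).prod (𝓡 2)) 𝓘(ℝ, EuclideanSpace ℝ (Fin 3)) ∞
      (fun w : M × S2 => (w.2 : EuclideanSpace ℝ (Fin 3))) := by
  have : Fact (finrank ℝ (EuclideanSpace ℝ (Fin 3)) = 2 + 1) := ⟨finrank_euclideanSpace_fin⟩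
  exact (contMDiff_coe_sphere (E := EuclideanSpace ℝ (Fin 3)) (n := 2) (m := ∞)).comp contMDiff_snd

variable (F) in
/-- The representative of `a ↦ ∑ j, a j • 𝕀 j` in the chart and in the trivialization at `x₀`. -/
def frameRep (x₀ : M) (𝕀 : Fin 3 → ∀ x, E x →L[ℝ] E x) (b : B) :
    EuclideanSpace ℝ (Fin 3) →L[ℝ] F →L[ℝ] F :=
  ∑ j, (EuclideanSpace.proj j).smulRight (homRep F F x₀ (𝕀 j) b)

theorem frameRep_apply (x₀ : M) (𝕀 : Fin 3 → ∀ x, E x →L[ℝ] E x) (b : B)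
    (a : EuclideanSpace ℝ (Fin 3)) :
    frameRep F x₀ 𝕀 b a = ∑ j, a j • homRep F F x₀ (𝕀 j) b := by
  simp [frameRep]

theorem homRep_structureAt (x₀ : M) (𝕀 : Fin 3 → ∀ x, E x →L[ℝ] E x) (a : S2) (b : B) :
    homRep F F x₀ (structureAt 𝕀 a) b = frameRep F x₀ 𝕀 b a.1 := by
  ext f
  rw [frameRep_apply, homRep_apply, structureAt]
  simp only [_root_.sum_apply, _root_.smul_apply, map_sum, map_smul]
  rfl

theorem frameRep_apply_apply {x₀ y : M} (hy : y ∈ localDomain B F E x₀)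
    (𝕀 : Fin 3 → ∀ x, E x →L[ℝ] E x) (a : EuclideanSpace ℝ (Fin 3)) (e : E y) :
    frameRep F x₀ 𝕀 (extChartAt 𝓘(ℝ, B) x₀ y) a
      ((trivializationAt F E x₀).continuousLinearMapAt ℝ y e)
      = (trivializationAt F E x₀).continuousLinearMapAt ℝ y (∑ j, a j • 𝕀 j y e) := by
  rw [frameRep_apply]
  simp only [_root_.sum_apply, _root_.smul_apply, map_sum, map_smul, homRep_extChartAt hy.2,
    Trivialization.symmL_continuousLinearMapAt _ hy.1]

variable (F) in
/-- The representative of the tautological section, in the trivialization at `x₀`, of the pull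
back of `End E` to `M × S²`. -/
def twistorRep (x₀ : M) (𝕀 : Fin 3 → ∀ x, E x →L[ℝ] E x) (w : M × S2) : F →L[ℝ] F :=
  frameRep F x₀ 𝕀 (baseChart B x₀ w) w.2.1

theorem twistorRep_apply {w : M × S2} (hw : w.1 ∈ localDomain B F E x₀) (e : E w.1) :
    twistorRep (B := B) F x₀ 𝕀 w ((trivializationAt F E x₀).continuousLinearMapAt ℝ w.1 e)
      = (trivializationAt F E x₀).continuousLinearMapAt ℝ w.1 (structureAt 𝕀 w.2 w.1 e) := by
  rw [twistorRep, baseChart, frameRep_apply_apply hw, structureAt]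
  simp

theorem IsAdmissibleFrame.contMDiffAt (h𝕀 : IsAdmissibleFrame B F Z U 𝕀) {y : M} (hy : y ∈ U)
    (j : Fin 3) : ContMDiffAt 𝓘(ℝ, B) (𝓘(ℝ, B).prod 𝓘(ℝ, F →L[ℝ] F)) ∞
      (fun x => TotalSpace.mk' (F →L[ℝ] F) (E := fun x => E x →L[ℝ] E x) x (𝕀 j x)) y :=
  (h𝕀.smooth j).contMDiffAt (h𝕀.isOpen.mem_nhds hy)

theorem IsAdmissibleFrame.contDiffAt_frameRep (h𝕀 : IsAdmissibleFrame B F Z U 𝕀) (hx : x₀ ∈ U) :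
    ContDiffAt ℝ ∞ (frameRep F x₀ 𝕀) (extChartAt 𝓘(ℝ, B) x₀ x₀) := by
  refine contDiffAt_of_apply fun a => ?_
  simp only [frameRep_apply]
  exact ContDiffAt.sum fun j _ => (contDiffAt_homRep (h𝕀.contMDiffAt hx j)).const_smul (a j)

theorem IsAdmissibleFrame.contMDiffAt_twistorRep (h𝕀 : IsAdmissibleFrame B F Z U 𝕀)
    {z : M × S2} (hz : z.1 ∈ U) :
    ContMDiffAt (𝓘(ℝ, B).prod (𝓡 2)) 𝓘(ℝ, F →L[ℝ] F) ∞ (twistorRep (B := B) F z.1 𝕀) z := by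
  have h1 := (h𝕀.contDiffAt_frameRep hz).contMDiffAt
  have h2 : ContMDiffAt (𝓘(ℝ, B).prod (𝓡 2)) 𝓘(ℝ, B) ∞ (baseChart B z.1) z :=
    contMDiffAt_baseChart (mem_chart_source B z.1)
  have h3 := ContMDiffAt.comp (I' := 𝓘(ℝ, B)) z h1 h2
  exact h3.clm_apply contMDiff_sphere_coe.contMDiffAt

theorem IsAdmissibleFrame.structureAt_structureAt (h𝕀 : IsAdmissibleFrame B F Z U 𝕀)
    {y : M} (hy : y ∈ U) (a : S2) (e : E y) :
    structureAt 𝕀 a y (structureAt 𝕀 a y e) = -e := by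
  have ha : a.1 0 ^ 2 + a.1 1 ^ 2 + a.1 2 ^ 2 = 1 := by
    have := EuclideanSpace.norm_eq a.1
    rw [mem_sphere_zero_iff_norm.1 a.2, Fin.sum_univ_three] at this
    simpa using this.symm
  have hq : IsQuatFrame (𝕀 0 y : E y →ₗ[ℝ] E y) (𝕀 1 y) (𝕀 2 y) :=
    ⟨h𝕀.sq y hy 0, h𝕀.sq y hy 1, h𝕀.mul₀₁ y hy, h𝕀.mul₁₀ y hy⟩
  have h := combo_combo (I := fun l => (𝕀 l y : E y →ₗ[ℝ] E y)) hq a.1 a.1 e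
  have hc : ∀ e, combo (fun l => (𝕀 l y : E y →ₗ[ℝ] E y)) a.1 e = structureAt 𝕀 a y e :=
    fun e => by rw [combo_apply, structureAt, Fin.sum_univ_three]; rfl
  rw [hc, hc, combo_apply] at h
  rw [h]
  simp only [Matrix.cons_val]
  linear_combination (norm := module) -ha • e

theorem IsAdmissibleFrame.memKerAddI (h𝕀 : IsAdmissibleFrame B F Z U 𝕀)
    {y : M} (hy : y ∈ U) {a : S2} {u v : E y} (h : structureAt 𝕀 a y u = v) :
    MemKerAddI (structureAt 𝕀 a y) u v :=
  ⟨h, by rw [← h, h𝕀.structureAt_structureAt hy]⟩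

set_option synthInstance.maxHeartbeats 200000 in
/-- The vertical part of a tangent vector of the twistor space, in the trivialization at `x₀`. -/
theorem IsConnForm.verticalPart [FiniteDimensional ℝ F] [ContMDiffVectorBundle ∞ F E 𝓘(ℝ, B)]
    {z : M × S2} (hA : IsConnForm nabla z.1 A) (h𝕀 : IsAdmissibleFrame B F Z U 𝕀) (hz : z.1 ∈ U) :
    ∀ᶠ w in nhds z, ∀ (ξ : TZ (B := B) w) (e : E w.1),
      (trivializationAt F E z.1).continuousLinearMapAt ℝ w.1 (FQuat.verticalPart nabla 𝕀 w ξ e)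
        = covHom (𝓘(ℝ, B).prod (𝓡 2)) A (baseChart B z.1) (twistorRep (B := B) F z.1 𝕀) w ξ
          ((trivializationAt F E z.1).continuousLinearMapAt ℝ w.1 e) := by
  have hdiff : ∀ᶠ b in nhds (extChartAt 𝓘(ℝ, B) z.1 z.1),
      DifferentiableAt ℝ (frameRep F z.1 𝕀) b := by
    filter_upwards [((h𝕀.contDiffAt_frameRep hz).of_le (m := 1) (by simp)).eventually
      (by simp)] with b hb
    exact hb.differentiableAt (by simp)
  have hev : ∀ {Q : M → Prop}, (∀ᶠ y in nhds z.1, Q y) → ∀ᶠ w in nhds z, Q w.1 := fun h =>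
    (continuous_fst.tendsto z).eventually h
  filter_upwards [hev hA.endDeriv, hev (eventually_of_chart hdiff),
    hev (h𝕀.isOpen.mem_nhds hz), hev (localDomain_mem_nhds (B := B) (F := F) (E := E) z.1)]
    with w hAw hd hwU hw ξ e
  have hT : MDifferentiableAt 𝓘(ℝ, B) (𝓘(ℝ, B).prod 𝓘(ℝ, F →L[ℝ] F))
      (fun x => TotalSpace.mk' (F →L[ℝ] F) (E := fun x => E x →L[ℝ] E x) x
        (structureAt 𝕀 w.2 x)) w.1 := by
    have h : ContMDiffAt 𝓘(ℝ, B) (𝓘(ℝ, B).prod 𝓘(ℝ, F →L[ℝ] F)) ∞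
        (fun x => TotalSpace.mk' (F →L[ℝ] F) (E := fun x => E x →L[ℝ] E x) x
          (∑ j, w.2.1 j • 𝕀 j x)) w.1 :=
      .sum_section fun j _ => (h𝕀.contMDiffAt hwU j).const_smul_section
    exact h.mdifferentiableAt (by simp)
  have hrep : homRep F F z.1 (structureAt 𝕀 w.2) = fun b : B => frameRep F z.1 𝕀 b w.2.1 :=
    funext fun b => homRep_structureAt z.1 𝕀 w.2 b
  have h1 := hAw (structureAt 𝕀 w.2) hT
    (by rw [hrep]; exact hd.clm_apply (differentiableAt_const _)) (baseComp w ξ) e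
  have hx := (contMDiffAt_baseChart (x₀ := z.1) hw.2).mdifferentiableAt (by simp)
  have hs := (contMDiff_sphere_coe (B := B) (M := M) w).mdifferentiableAt (by simp)
  have hd' : DifferentiableAt ℝ (frameRep F z.1 𝕀) (baseChart B z.1 w) := hd
  have hJ : mvfderiv (𝓘(ℝ, B).prod (𝓡 2)) (twistorRep (B := B) F z.1 𝕀) w ξ
      = fderiv ℝ (frameRep F z.1 𝕀) (baseChart B z.1 w)
          (mvfderiv (𝓘(ℝ, B).prod (𝓡 2)) (baseChart B z.1) w ξ) w.2.1
        + frameRep F z.1 𝕀 (baseChart B z.1 w) (sphereComp w ξ) := by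
    have h2 := mvfderiv_clm_apply (mdifferentiableAt_comp' hd' hx) hs ξ
    rw [mvfderiv_comp' hd' hx] at h2
    exact h2
  -- The tautological section is the frame at the base point applied to the point of the sphere. Its
  -- derivative splits into the covariant derivative with the coefficients frozen and the term of
  -- the sphere component, which are the two summands of the vertical part.
  have h3 : covHom (𝓘(ℝ, B).prod (𝓡 2)) A (baseChart B z.1) (twistorRep (B := B) F z.1 𝕀) w ξ
      = covEnd A (homRep F F z.1 (structureAt 𝕀 w.2)) (extChartAt 𝓘(ℝ, B) z.1 w.1)
        (mvfderiv 𝓘(ℝ, B) (extChartAt 𝓘(ℝ, B) z.1) w.1 (baseComp w ξ))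
        + frameRep F z.1 𝕀 (baseChart B z.1 w) (sphereComp w ξ) := by
    have h4 := fderiv_eval hd (mvfderiv 𝓘(ℝ, B) (extChartAt 𝓘(ℝ, B) z.1) w.1 (baseComp w ξ)) w.2.1
    rw [covHom, hJ, covEnd, hrep, h4, mvfderiv_baseChart hw.2]
    simp only [baseChart, twistorRep]
    abel
  rw [h3, _root_.add_apply, ← h1, baseChart, frameRep_apply_apply hw, ← map_add,
    FQuat.verticalPart, add_comm]

end TwistorSpace
end FQuat
end

/-! ### Liftable fields and integrability of the two distributions. -/

noncomputable section
namespace FQuat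
section Integrability

set_option linter.unusedSectionVars false

variable {B : Type*} [NormedAddCommGroup B] [NormedSpace ℝ B] [FiniteDimensional ℝ B]
  {M : Type*} [TopologicalSpace M] [ChartedSpace B M] [IsManifold 𝓘(ℝ, B) ∞ M]
  {F : Type*} [NormedAddCommGroup F] [NormedSpace ℝ F] [FiniteDimensional ℝ F]
  {E : M → Type*} [TopologicalSpace (TotalSpace F E)]
  [∀ x, AddCommGroup (E x)] [∀ x, Module ℝ (E x)] [∀ x, TopologicalSpace (E x)]
  [∀ x, IsTopologicalAddGroup (E x)] [∀ x, ContinuousSMul ℝ (E x)]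
  [FiberBundle F E] [VectorBundle ℝ F E] [ContMDiffVectorBundle ∞ F E 𝓘(ℝ, B)]
  {nabla : CovariantDerivative 𝓘(ℝ, B) F E} {A : B → B →L[ℝ] F →L[ℝ] F} {z : M × S2}
  {U : Set M} {𝕀 : Fin 3 → ∀ x, E x →L[ℝ] E x}

theorem eventually_fst {Q : M → Prop} (h : ∀ᶠ y in nhds z.1, Q y) : ∀ᶠ w in nhds z, Q w.1 :=
  (continuous_fst.tendsto z).eventually h

theorem IsAdmissibleFrame.twistorRep_mul_self {Z : ∀ x, Set (E x →L[ℝ] E x)}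
    (h𝕀 : IsAdmissibleFrame B F Z U 𝕀) (hz : z.1 ∈ U) :
    ∀ᶠ w in nhds z, twistorRep (B := B) F z.1 𝕀 w * twistorRep (B := B) F z.1 𝕀 w = -1 := by
  filter_upwards [eventually_fst (h𝕀.isOpen.mem_nhds hz),
    eventually_fst (localDomain_mem_nhds (B := B) (F := F) (E := E) z.1)] with w hwU hw
  ext f
  rw [← Trivialization.continuousLinearMapAt_symmL (R := ℝ) (trivializationAt F E z.1) hw.1 f,
    mul_apply_eq_comp, twistorRep_apply hw, twistorRep_apply hw,
    h𝕀.structureAt_structureAt hwU, map_neg]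
  rfl

theorem continuousLinearMapAt_injective {x₀ y : M} (hy : y ∈ localDomain B F E x₀) :
    Function.Injective ((trivializationAt F E x₀).continuousLinearMapAt ℝ y) := fun u v h => by
  have := congrArg ((trivializationAt F E x₀).symmL ℝ y) h
  rwa [Trivialization.symmL_continuousLinearMapAt _ hy.1,
    Trivialization.symmL_continuousLinearMapAt _ hy.1] at this

/-- In the trivialization the vertical part is the covariant derivative of the tautological section.
Of the two equations of `MemKerAddI`, the second follows from the first as `J² = -1`. -/
theorem IsConnForm.verticalPartZeroOne_iff {Z : ∀ x, Set (E x →L[ℝ] E x)}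
    (hA : IsConnForm nabla z.1 A) (h𝕀 : IsAdmissibleFrame B F Z U 𝕀) (hz : z.1 ∈ U) :
    ∀ᶠ w in nhds z, ∀ ξ₁ ξ₂ : TZ (B := B) w, VerticalPartZeroOne nabla 𝕀 w ξ₁ ξ₂ ↔
      twistorRep (B := B) F z.1 𝕀 w * covHom (𝓘(ℝ, B).prod (𝓡 2)) A (baseChart B z.1)
        (twistorRep (B := B) F z.1 𝕀) w ξ₁
      = covHom (𝓘(ℝ, B).prod (𝓡 2)) A (baseChart B z.1) (twistorRep (B := B) F z.1 𝕀) w ξ₂ := by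
  filter_upwards [hA.verticalPart h𝕀 hz, eventually_fst (h𝕀.isOpen.mem_nhds hz),
    eventually_fst (localDomain_mem_nhds (B := B) (F := F) (E := E) z.1)] with w hV hwU hw ξ₁ ξ₂
  constructor
  · intro h
    ext f
    rw [← Trivialization.continuousLinearMapAt_symmL (R := ℝ) (trivializationAt F E z.1) hw.1 f,
      mul_apply_eq_comp, ← hV, ← hV, twistorRep_apply hw, (h _).1]
  · intro h e
    refine h𝕀.memKerAddI hwU (continuousLinearMapAt_injective (B := B) hw ?_)
    rw [← twistorRep_apply hw, hV, hV, ← h, mul_apply_eq_comp]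

theorem SmoothFieldOn.contMDiffAt {ζ : ∀ w : M × S2, TZ (B := B) w} {Ω : Set (M × S2)}
    [IsManifold 𝓘(ℝ, B) 1 M]
    (h : SmoothFieldOn ζ Ω) (hΩ : IsOpen Ω) (hz : z ∈ Ω) :
    ContMDiffAt (𝓘(ℝ, B).prod (𝓡 2)) (𝓘(ℝ, B).prod (𝓡 2)).tangent 1
      (fun w => (⟨w, ζ w⟩ : TangentBundle (𝓘(ℝ, B).prod (𝓡 2)) (M × S2))) z :=
  (ContMDiffOn.contMDiffAt h (hΩ.mem_nhds hz)).of_le (by simp)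

namespace AlmostFQuaternionic

variable {S : AlmostFQuaternionic (M := M) B F E} {ρ : B → F →L[ℝ] B}

/-- In local coordinates around `z`, the complex vector field `ξ 0 + i ξ 1` on the twistor space
admits, up to the endomorphism field `P` of `E`, a differentiable lift to `ker (J + i)`, and its
vertical part is of type `(0,1)`. -/
structure IsLiftable (S : AlmostFQuaternionic (M := M) B F E)
    (nabla : CovariantDerivative 𝓘(ℝ, B) F E) (𝕀 : Fin 3 → ∀ x, E x →L[ℝ] E x)
    (P : B → F →L[ℝ] F) (z : M × S2) (ξ : Fin 2 → ∀ w : M × S2, TZ (B := B) w) : Prop where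
  exists_lift : ∃ e : Fin 2 → M × S2 → F,
    (∀ i, MDifferentiableAt (𝓘(ℝ, B).prod (𝓡 2)) 𝓘(ℝ, F) (e i) z) ∧
    (∀ i, ∀ᶠ w in nhds z, P (baseChart B z.1 w) (e i w)
      = homRep B F z.1 S.ι (baseChart B z.1 w)
        (mvfderiv (𝓘(ℝ, B).prod (𝓡 2)) (baseChart B z.1) w (ξ i w))) ∧
    ∀ᶠ w in nhds z, twistorRep (B := B) F z.1 𝕀 w (e 0 w) = e 1 w
  vertical : ∀ᶠ w in nhds z, VerticalPartZeroOne nabla 𝕀 w (ξ 0 w) (ξ 1 w)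

/-- The common core of both integrability statements, with `P` the identity or the projection on `T
M`. The assumption `hPρ` recovers the base component of a field as `ρ` of its lift, which is what
the curvature condition requires. -/
theorem IsLiftable.bracket {P : B → F →L[ℝ] F} {ξ η : Fin 2 → ∀ w : M × S2, TZ (B := B) w}
    (hξ : S.IsLiftable nabla 𝕀 P z ξ) (hη : S.IsLiftable nabla 𝕀 P z η)
    [IsManifold 𝓘(ℝ, B) 1 M]
    (hξs : ∀ i, ContMDiffAt (𝓘(ℝ, B).prod (𝓡 2)) (𝓘(ℝ, B).prod (𝓡 2)).tangent 1
      (fun w => (⟨w, ξ i w⟩ : TangentBundle (𝓘(ℝ, B).prod (𝓡 2)) (M × S2))) z)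
    (hηs : ∀ i, ContMDiffAt (𝓘(ℝ, B).prod (𝓡 2)) (𝓘(ℝ, B).prod (𝓡 2)).tangent 1
      (fun w => (⟨w, η i w⟩ : TangentBundle (𝓘(ℝ, B).prod (𝓡 2)) (M × S2))) z)
    (h𝕀 : IsAdmissibleFrame B F S.Z U 𝕀) (hz : z.1 ∈ U)
    (hA : IsConnForm nabla z.1 A) (hAd : DifferentiableAt ℝ A (extChartAt 𝓘(ℝ, B) z.1 z.1))
    {D : CovariantDerivative 𝓘(ℝ, B) B (TangentSpace 𝓘(ℝ, B) : M → Type _)}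
    (hD : ∀ x, D.torsion x = 0) (hind : S.IsInducedBy nabla D)
    {r : ℕ} (hr : finrank ℝ (S.V z.1) = r)
    (hrank : (4 * r < finrank ℝ F ∧ 8 ≤ 4 * r) ∨ (finrank ℝ F = 4 * r ∧ 12 ≤ 4 * r))
    (hρ : S.IsProjRep z.1 ρ)
    (hP : DifferentiableAt ℝ P (extChartAt 𝓘(ℝ, B) z.1 z.1))
    (hpar : ∀ X, covEnd A P (extChartAt 𝓘(ℝ, B) z.1 z.1) X = 0)
    (hPρ : ∀ e X, P (extChartAt 𝓘(ℝ, B) z.1 z.1) e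
      = homRep B F z.1 S.ι (extChartAt 𝓘(ℝ, B) z.1 z.1) X →
        ρ (extChartAt 𝓘(ℝ, B) z.1 z.1) e = X)
    {ζ : Fin 2 → TZ (B := B) z}
    (hζ₀ : ζ 0 = VectorField.mlieBracket (𝓘(ℝ, B).prod (𝓡 2)) (ξ 0) (η 0) z
      - VectorField.mlieBracket (𝓘(ℝ, B).prod (𝓡 2)) (ξ 1) (η 1) z)
    (hζ₁ : ζ 1 = VectorField.mlieBracket (𝓘(ℝ, B).prod (𝓡 2)) (ξ 0) (η 1) z
      + VectorField.mlieBracket (𝓘(ℝ, B).prod (𝓡 2)) (ξ 1) (η 0) z) :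
    (∃ d : Fin 2 → F, twistorRep (B := B) F z.1 𝕀 z (d 0) = d 1 ∧
      ∀ i, homRep B F z.1 S.ι (extChartAt 𝓘(ℝ, B) z.1 z.1)
        (mvfderiv 𝓘(ℝ, B) (extChartAt 𝓘(ℝ, B) z.1) z.1 (baseComp z (ζ i)))
        = P (extChartAt 𝓘(ℝ, B) z.1 z.1) (d i)) ∧
      VerticalPartZeroOne nabla 𝕀 z (ζ 0) (ζ 1) := by
  have : CompleteSpace B := FiniteDimensional.complete ℝ B
  have : IsManifold 𝓘(ℝ, B) 2 M := inferInstance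
  have : IsManifold (𝓡 2) 2 S2 := inferInstance
  have : IsManifold (𝓘(ℝ, B).prod (𝓡 2)) 2 (M × S2) := inferInstance
  have hsrc : z.1 ∈ (chartAt B z.1).source := mem_chart_source B z.1
  have hx : ContMDiffAt (𝓘(ℝ, B).prod (𝓡 2)) 𝓘(ℝ, B) 2 (baseChart B z.1) z :=
    (contMDiffAt_baseChart hsrc).of_le ENat.LEInfty.out
  have hJ := (h𝕀.contMDiffAt_twistorRep hz).of_le (m := 2) ENat.LEInfty.out
  have hι := ((S.contDiffAt_homRep_ι z.1).of_le (m := 1) (by simp)).differentiableAt (by simp)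
  have hV := hA.verticalPartZeroOne_iff h𝕀 hz
  have htors := (torsion_symm hA hD hind).self_of_nhds
  have hsq := h𝕀.twistorRep_mul_self hz
  have hvert : ∀ {ξ : Fin 2 → ∀ w : M × S2, TZ (B := B) w}, S.IsLiftable nabla 𝕀 P z ξ →
      ∀ᶠ w in nhds z, twistorRep (B := B) F z.1 𝕀 w * covHom (𝓘(ℝ, B).prod (𝓡 2)) A
        (baseChart B z.1) (twistorRep (B := B) F z.1 𝕀) w (ξ 0 w)
      = covHom (𝓘(ℝ, B).prod (𝓡 2)) A (baseChart B z.1) (twistorRep (B := B) F z.1 𝕀) w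
        (ξ 1 w) := fun h => by
    filter_upwards [hV, h.vertical] with w hw h
    exact (hw _ _).1 h
  obtain ⟨e, he, heξ, hJe⟩ := hξ.exists_lift
  obtain ⟨f, hf, hfη, hJf⟩ := hη.exists_lift
  have ha : z.2.1 0 ^ 2 + z.2.1 1 ^ 2 + z.2.1 2 ^ 2 = 1 := by
    have := EuclideanSpace.norm_eq z.2.1
    rw [mem_sphere_zero_iff_norm.1 z.2.2, Fin.sum_univ_three] at this
    simpa using this.symm
  have key := twistor_bracket hx hJ hAd hP hι hpar htors hsq hξs hηs he hf heξ hfη hJe hJf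
    (hvert hξ) (hvert hη) ?_ hζ₀ hζ₁
  · obtain ⟨⟨d, hd, hdζ⟩, hver⟩ := key
    refine ⟨⟨d, hd, fun i => ?_⟩, (hV.self_of_nhds _ _).2 hver⟩
    rw [← mvfderiv_baseChart hsrc]
    exact hdζ i
  -- The base components are `ρ e₀`, `ρ (J e₀)` and `ρ f₀`, `ρ (J f₀)`, so the algebraic curvature
  -- condition applies to the real parts `e₀`, `f₀` of the lifts.
  · intro R₀ R₁ h₀ h₁
    refine hρ.curvA_zeroOne hA hAd hD hind hr hrank h𝕀 hz z.2.1 ha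
      (frameRep_apply z.1 𝕀 _ z.2.1) (e 0 z) (f 0 z) ?_ ?_
    all_goals
      have q0 := hPρ _ _ (heξ 0).self_of_nhds
      have q1 := hPρ _ _ (heξ 1).self_of_nhds
      have q2 := hPρ _ _ (hfη 0).self_of_nhds
      have q3 := hPρ _ _ (hfη 1).self_of_nhds
      rw [← hJe.self_of_nhds] at q1
      rw [← hJf.self_of_nhds] at q3
    · rw [h₀, ← q0, ← q1, ← q2, ← q3]
      rfl
    · rw [h₁, ← q0, ← q1, ← q2, ← q3]
      rfl

theorem mdifferentiableAt_ι_baseComp {ξ : ∀ w : M × S2, TZ (B := B) w} [IsManifold 𝓘(ℝ, B) 1 M]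
    (hξ : ContMDiffAt (𝓘(ℝ, B).prod (𝓡 2)) (𝓘(ℝ, B).prod (𝓡 2)).tangent 1
      (fun w => (⟨w, ξ w⟩ : TangentBundle (𝓘(ℝ, B).prod (𝓡 2)) (M × S2))) z) :
    MDifferentiableAt (𝓘(ℝ, B).prod (𝓡 2)) 𝓘(ℝ, F) (fun w => homRep B F z.1 S.ι
      (baseChart B z.1 w) (mvfderiv (𝓘(ℝ, B).prod (𝓡 2)) (baseChart B z.1) w (ξ w))) z := by
  have : CompleteSpace B := FiniteDimensional.complete ℝ B
  have : IsManifold 𝓘(ℝ, B) 2 M := inferInstance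
  have : IsManifold (𝓡 2) 2 S2 := inferInstance
  have : IsManifold (𝓘(ℝ, B).prod (𝓡 2)) 2 (M × S2) := inferInstance
  have hx : ContMDiffAt (𝓘(ℝ, B).prod (𝓡 2)) 𝓘(ℝ, B) 2 (baseChart B z.1) z :=
    (contMDiffAt_baseChart (mem_chart_source B z.1)).of_le ENat.LEInfty.out
  have hι := ((S.contDiffAt_homRep_ι z.1).of_le (m := 1) (by simp)).differentiableAt (by simp)
  exact mdifferentiableAt_clm_apply
    (mdifferentiableAt_comp' (u := baseChart B z.1) hι (hx.mdifferentiableAt (by simp)))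
    (mdifferentiableAt_mvfderiv_field hx hξ)

theorem homRep_ι_baseChart {w : M × S2} (hw : w.1 ∈ localDomain B F E z.1) (ξ : TZ (B := B) w) :
    homRep B F z.1 S.ι (baseChart B z.1 w)
        (mvfderiv (𝓘(ℝ, B).prod (𝓡 2)) (baseChart B z.1) w ξ)
      = (trivializationAt F E z.1).continuousLinearMapAt ℝ w.1 (S.ι w.1 (baseComp w ξ)) := by
  rw [mvfderiv_baseChart hw.2]
  exact S.homRep_ι_apply hw.2 _

/-- The lift is the image under `ι` of the base component of the field itself, already in `ker (J +
√-1)` and differentiable. -/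
theorem isLiftable_of_CRDistribution {ξ : Fin 2 → ∀ w : M × S2, TZ (B := B) w}
    [IsManifold 𝓘(ℝ, B) 1 M]
    (hξs : ∀ i, ContMDiffAt (𝓘(ℝ, B).prod (𝓡 2)) (𝓘(ℝ, B).prod (𝓡 2)).tangent 1
      (fun w => (⟨w, ξ i w⟩ : TangentBundle (𝓘(ℝ, B).prod (𝓡 2)) (M × S2))) z)
    (hξ : ∀ᶠ w in nhds z, CRDistribution nabla S.ι 𝕀 w (ξ 0 w) (ξ 1 w)) :
    S.IsLiftable nabla 𝕀 (fun _ => 1) z ξ := by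
  refine ⟨⟨fun i w => homRep B F z.1 S.ι (baseChart B z.1 w)
    (mvfderiv (𝓘(ℝ, B).prod (𝓡 2)) (baseChart B z.1) w (ξ i w)),
    fun i => mdifferentiableAt_ι_baseComp (hξs i), fun i => .of_forall fun w => rfl, ?_⟩,
    hξ.mono fun w h => h.2⟩
  filter_upwards [hξ, eventually_fst (localDomain_mem_nhds (B := B) (F := F) (E := E) z.1)]
    with w h hw
  rw [homRep_ι_baseChart hw, homRep_ι_baseChart hw, twistorRep_apply hw, h.1.1]

theorem structureAt_mem_range (h𝕀 : IsAdmissibleFrame B F S.Z U 𝕀) {y : M} (hy : y ∈ U) (a : S2)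
    {v : E y} (hv : v ∈ S.V y) : ∃ X, S.ι y X = structureAt 𝕀 a y v :=
  S.J_mem y (structureAt 𝕀 a y) (by rw [h𝕀.admissible y hy]; exact ⟨a, rfl⟩) v hv

/-- Taking the `V`-components of the two equations, where `J u` and `J v` disappear because they are
tangent, expresses `v` through `J X` and `u` through `J Y`. -/
theorem eq_sub_and_eq_add_of_proj {P J : F →L[ℝ] F} {X Y u v : F} (hX : P X = X) (hY : P Y = Y)
    (hu : P u = 0) (hv : P v = 0) (hJu : P (J u) = J u) (hJv : P (J v) = J v)
    (h : J (X + u) = Y + v) (h' : J (Y + v) = -(X + u)) :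
    X + u = X - (J Y - P (J Y)) ∧ Y + v = Y + (J X - P (J X)) := by
  have e := congrArg P h
  have e' := congrArg P h'
  simp only [map_add, map_neg, hX, hY, hu, hv, hJu, hJv] at e e' h h'
  constructor
  · linear_combination (norm := module) h' - e'
  · linear_combination (norm := module) e - h

/-- The vectors of `ker (J + √-1)` given at each point need not vary differentiably a priori. By
`eq_sub_and_eq_add_of_proj` they coincide with an expression in `J`, the projection and the base
components, all of them differentiable. -/
theorem isLiftable_of_coCRDistribution {ξ : Fin 2 → ∀ w : M × S2, TZ (B := B) w}
    [IsManifold 𝓘(ℝ, B) 1 M]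
    (hξs : ∀ i, ContMDiffAt (𝓘(ℝ, B).prod (𝓡 2)) (𝓘(ℝ, B).prod (𝓡 2)).tangent 1
      (fun w => (⟨w, ξ i w⟩ : TangentBundle (𝓘(ℝ, B).prod (𝓡 2)) (M × S2))) z)
    (h𝕀 : IsAdmissibleFrame B F S.Z U 𝕀) (hz : z.1 ∈ U) (hρ : S.IsProjRep z.1 ρ)
    (hξ : ∀ᶠ w in nhds z, CoCRDistribution nabla S.ρ 𝕀 w (ξ 0 w) (ξ 1 w)) :
    S.IsLiftable nabla 𝕀 (S.projRep z.1 ρ) z ξ := by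
  obtain ⟨X, hX⟩ : ∃ X : Fin 2 → M × S2 → F, ∀ i w, X i w = homRep B F z.1 S.ι (baseChart B z.1 w)
    (mvfderiv (𝓘(ℝ, B).prod (𝓡 2)) (baseChart B z.1) w (ξ i w)) := ⟨_, fun _ _ => rfl⟩
  have hXd : ∀ i, MDifferentiableAt (𝓘(ℝ, B).prod (𝓡 2)) 𝓘(ℝ, F) (X i) z := fun i => by
    rw [show X i = _ from funext (hX i)]
    exact mdifferentiableAt_ι_baseComp (hξs i)
  have hx : MDifferentiableAt (𝓘(ℝ, B).prod (𝓡 2)) 𝓘(ℝ, B) (baseChart B z.1) z :=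
    (contMDiffAt_baseChart (mem_chart_source B z.1)).mdifferentiableAt (by simp)
  have hP := mdifferentiableAt_comp' (u := baseChart B z.1)
    ((hρ.contDiffAt_projRep.of_le (m := 1) (by simp)).differentiableAt (by simp)) hx
  have hJX : ∀ i, MDifferentiableAt (𝓘(ℝ, B).prod (𝓡 2)) 𝓘(ℝ, F)
      (fun w => twistorRep (B := B) F z.1 𝕀 w (X i w)) z := fun i =>
    mdifferentiableAt_clm_apply ((h𝕀.contMDiffAt_twistorRep hz).mdifferentiableAt (by simp))
      (hXd i)
  -- `X 0`, `X 1` are the tangent parts of the lift; the differences are the `V`-parts forced by `J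
  -- e₀ = e₁`.
  let e : Fin 2 → M × S2 → F := ![
    fun w => X 0 w - (twistorRep (B := B) F z.1 𝕀 w (X 1 w)
      - S.projRep z.1 ρ (baseChart B z.1 w) (twistorRep (B := B) F z.1 𝕀 w (X 1 w))),
    fun w => X 1 w + (twistorRep (B := B) F z.1 𝕀 w (X 0 w)
      - S.projRep z.1 ρ (baseChart B z.1 w) (twistorRep (B := B) F z.1 𝕀 w (X 0 w)))]
  have hex : ∀ᶠ w in nhds z, ∃ u : Fin 2 → E w.1, structureAt 𝕀 w.2 w.1 (u 0) = u 1 ∧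
      (∀ i, e i w = (trivializationAt F E z.1).continuousLinearMapAt ℝ w.1 (u i)) ∧
      ∀ i, S.projRep z.1 ρ (baseChart B z.1 w) (e i w) = X i w := by
    filter_upwards [hξ, eventually_fst (localDomain_mem_nhds (B := B) (F := F) (E := E) z.1),
      eventually_fst hρ.eventually_apply, eventually_fst (h𝕀.isOpen.mem_nhds hz)]
      with w h hw hdec hwU
    obtain ⟨⟨u₀, u₁, ⟨hu, hu'⟩, h0, h1⟩, -⟩ := h
    obtain ⟨X₀, v₀, hv₀, rfl⟩ := S.exists_decomp w.1 u₀
    obtain ⟨X₁, v₁, hv₁, rfl⟩ := S.exists_decomp w.1 u₁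
    rw [map_add, S.ρ_ι, S.ρ_V _ _ hv₀, add_zero] at h0
    rw [map_add, S.ρ_ι, S.ρ_V _ _ hv₁, add_zero] at h1
    have g0 : X 0 w = (trivializationAt F E z.1).continuousLinearMapAt ℝ w.1 (S.ι w.1 X₀) := by
      rw [hX, homRep_ι_baseChart hw, h0]
    have g1 : X 1 w = (trivializationAt F E z.1).continuousLinearMapAt ℝ w.1 (S.ι w.1 X₁) := by
      rw [hX, homRep_ι_baseChart hw, h1]
    have hPι : ∀ Y, S.projRep z.1 ρ (baseChart B z.1 w)
        ((trivializationAt F E z.1).continuousLinearMapAt ℝ w.1 (S.ι w.1 Y))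
        = (trivializationAt F E z.1).continuousLinearMapAt ℝ w.1 (S.ι w.1 Y) := fun Y => by
      have := (hdec Y 0 (zero_mem _)).2
      rwa [add_zero] at this
    have hPV : ∀ v ∈ S.V w.1, S.projRep z.1 ρ (baseChart B z.1 w)
        ((trivializationAt F E z.1).continuousLinearMapAt ℝ w.1 v) = 0 := fun v hv => by
      have := (hdec 0 v hv).2
      rwa [map_zero, zero_add, map_zero] at this
    have hPJ : ∀ v ∈ S.V w.1, S.projRep z.1 ρ (baseChart B z.1 w)
        (twistorRep (B := B) F z.1 𝕀 w
          ((trivializationAt F E z.1).continuousLinearMapAt ℝ w.1 v))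
        = twistorRep (B := B) F z.1 𝕀 w
          ((trivializationAt F E z.1).continuousLinearMapAt ℝ w.1 v) := fun v hv => by
      obtain ⟨Y, hY⟩ := structureAt_mem_range h𝕀 hwU w.2 hv
      rw [twistorRep_apply hw, ← hY, hPι]
    obtain ⟨r0, r1⟩ := eq_sub_and_eq_add_of_proj (hPι X₀) (hPι X₁) (hPV v₀ hv₀) (hPV v₁ hv₁)
      (hPJ v₀ hv₀) (hPJ v₁ hv₁)
      (by rw [← map_add, ← map_add, twistorRep_apply hw, hu])
      (by rw [← map_add, ← map_add, twistorRep_apply hw, hu', map_neg])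
    rw [← g0, ← g1] at r0 r1
    have k : ∀ i, e i w = (trivializationAt F E z.1).continuousLinearMapAt ℝ w.1
        (![S.ι w.1 X₀ + v₀, S.ι w.1 X₁ + v₁] i) := by
      refine Fin.forall_fin_two.2 ⟨?_, ?_⟩
      · refine r0.symm.trans ?_
        rw [g0, ← map_add]; rfl
      · refine r1.symm.trans ?_
        rw [g1, ← map_add]; rfl
    refine ⟨![S.ι w.1 X₀ + v₀, S.ι w.1 X₁ + v₁], hu, k, ?_⟩
    refine Fin.forall_fin_two.2 ⟨?_, ?_⟩
    · rw [k, g0]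
      exact (hdec X₀ v₀ hv₀).2
    · rw [k, g1]
      exact (hdec X₁ v₁ hv₁).2
  refine ⟨⟨e, ?_, fun i => ?_, ?_⟩, hξ.mono fun w h => h.2⟩
  · refine Fin.forall_fin_two.2 ⟨?_, ?_⟩
    · exact (hXd 0).sub ((hJX 1).sub (mdifferentiableAt_clm_apply hP (hJX 1)))
    · exact (hXd 1).add ((hJX 0).sub (mdifferentiableAt_clm_apply hP (hJX 0)))
  · filter_upwards [hex] with w ⟨u, _, _, h⟩
    rw [h, hX]
  · filter_upwards [hex, eventually_fst (localDomain_mem_nhds (B := B) (F := F) (E := E) z.1)]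
      with w ⟨u, h, h', _⟩ hw
    rw [h', h', twistorRep_apply hw, h]

variable [T2Space M]

/-- The case `P = 1`: the identity commutes with `A`, hence is parallel, and the lift of the bracket
is its base component. -/
theorem cRIntegrable (hsmooth : CovariantDerivative.ContMDiffCovariantDerivative nabla ∞)
    {D : CovariantDerivative 𝓘(ℝ, B) B (TangentSpace 𝓘(ℝ, B) : M → Type _)}
    (hD : ∀ x, D.torsion x = 0) (hind : S.IsInducedBy nabla D)
    {r : ℕ} (hr : ∀ x, finrank ℝ (S.V x) = r)
    (hrank : (4 * r < finrank ℝ F ∧ 8 ≤ 4 * r) ∨ (finrank ℝ F = 4 * r ∧ 12 ≤ 4 * r)) :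
    CRIntegrable S.toQuaternionicStructure S.ι nabla := by
  intro U 𝕀 h𝕀 Ω hΩ hΩU ξ₁ ξ₂ η₁ η₂ hξ₁ hξ₂ hη₁ hη₂ hξ hη z hz
  have : IsManifold 𝓘(ℝ, B) 1 M := .of_le (n := ∞) (by simp)
  obtain ⟨A, hAd, hA⟩ := exists_connForm hsmooth z.1
  obtain ⟨ρ, hρ⟩ := S.exists_isProjRep z.1
  have hξs : ∀ i, ContMDiffAt (𝓘(ℝ, B).prod (𝓡 2)) (𝓘(ℝ, B).prod (𝓡 2)).tangent 1
      (fun w => (⟨w, ![ξ₁, ξ₂] i w⟩ : TangentBundle (𝓘(ℝ, B).prod (𝓡 2)) (M × S2))) z :=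
    Fin.forall_fin_two.2 ⟨hξ₁.contMDiffAt hΩ hz, hξ₂.contMDiffAt hΩ hz⟩
  have hηs : ∀ i, ContMDiffAt (𝓘(ℝ, B).prod (𝓡 2)) (𝓘(ℝ, B).prod (𝓡 2)).tangent 1
      (fun w => (⟨w, ![η₁, η₂] i w⟩ : TangentBundle (𝓘(ℝ, B).prod (𝓡 2)) (M × S2))) z :=
    Fin.forall_fin_two.2 ⟨hη₁.contMDiffAt hΩ hz, hη₂.contMDiffAt hΩ hz⟩
  have hdom := mem_of_mem_nhds (localDomain_mem_nhds (B := B) (F := F) (E := E) z.1)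
  obtain ⟨⟨d, hd, hdζ⟩, hver⟩ := IsLiftable.bracket
    (isLiftable_of_CRDistribution hξs (Filter.mem_of_superset (hΩ.mem_nhds hz) hξ))
    (isLiftable_of_CRDistribution hηs (Filter.mem_of_superset (hΩ.mem_nhds hz) hη)) hξs hηs h𝕀 (hΩU z hz) hA hAd
    hD hind (hr z.1) hrank hρ (differentiableAt_const _)
    (fun X => by
      rw [covEnd, fderiv_const_apply]
      simp)
    (fun e X h => by
      rw [show e = _ from h]
      exact hρ.ρ_comp_ι.self_of_nhds X)
    (ζ := ![_, _]) rfl rfl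
  refine ⟨h𝕀.memKerAddI (hΩU z hz) (continuousLinearMapAt_injective (B := B) hdom ?_), hver⟩
  rw [← twistorRep_apply hdom, ← S.homRep_ι_apply hdom.2, ← S.homRep_ι_apply hdom.2]
  exact (congrArg _ (hdζ 0)).trans (hd.trans (hdζ 1).symm)

/-- The case in which `P` is the projection on `T M`, parallel by compatibility of the connection
with both `V` and `T M`. -/
theorem coCRIntegrable (hsmooth : CovariantDerivative.ContMDiffCovariantDerivative nabla ∞)
    {D : CovariantDerivative 𝓘(ℝ, B) B (TangentSpace 𝓘(ℝ, B) : M → Type _)}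
    (hD : ∀ x, D.torsion x = 0) (hind : S.IsInducedBy nabla D)
    {r : ℕ} (hr : ∀ x, finrank ℝ (S.V x) = r)
    (hrank : (4 * r < finrank ℝ F ∧ 8 ≤ 4 * r) ∨ (finrank ℝ F = 4 * r ∧ 12 ≤ 4 * r)) :
    CoCRIntegrable S.toQuaternionicStructure S.ρ nabla := by
  intro U 𝕀 h𝕀 Ω hΩ hΩU ξ₁ ξ₂ η₁ η₂ hξ₁ hξ₂ hη₁ hη₂ hξ hη z hz
  have : IsManifold 𝓘(ℝ, B) 1 M := .of_le (n := ∞) (by simp)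
  obtain ⟨A, hAd, hA⟩ := exists_connForm hsmooth z.1
  obtain ⟨ρ, hρ⟩ := S.exists_isProjRep z.1
  have hξs : ∀ i, ContMDiffAt (𝓘(ℝ, B).prod (𝓡 2)) (𝓘(ℝ, B).prod (𝓡 2)).tangent 1
      (fun w => (⟨w, ![ξ₁, ξ₂] i w⟩ : TangentBundle (𝓘(ℝ, B).prod (𝓡 2)) (M × S2))) z :=
    Fin.forall_fin_two.2 ⟨hξ₁.contMDiffAt hΩ hz, hξ₂.contMDiffAt hΩ hz⟩
  have hηs : ∀ i, ContMDiffAt (𝓘(ℝ, B).prod (𝓡 2)) (𝓘(ℝ, B).prod (𝓡 2)).tangent 1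
      (fun w => (⟨w, ![η₁, η₂] i w⟩ : TangentBundle (𝓘(ℝ, B).prod (𝓡 2)) (M × S2))) z :=
    Fin.forall_fin_two.2 ⟨hη₁.contMDiffAt hΩ hz, hη₂.contMDiffAt hΩ hz⟩
  have hdom := mem_of_mem_nhds (localDomain_mem_nhds (B := B) (F := F) (E := E) z.1)
  have hρι := hρ.ρ_comp_ι.self_of_nhds
  obtain ⟨⟨d, hd, hdζ⟩, hver⟩ := IsLiftable.bracket
    (isLiftable_of_coCRDistribution hξs h𝕀 (hΩU z hz) hρ (Filter.mem_of_superset (hΩ.mem_nhds hz) hξ))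
    (isLiftable_of_coCRDistribution hηs h𝕀 (hΩU z hz) hρ (Filter.mem_of_superset (hΩ.mem_nhds hz) hη))
    hξs hηs h𝕀 (hΩU z hz) hA hAd hD hind (hr z.1) hrank hρ
    ((hρ.contDiffAt_projRep.of_le (m := 1) (by simp)).differentiableAt (by simp))
    (hρ.covEnd_eq_zero hA hind.compatible).self_of_nhds
    (fun e X h => by
      have := congrArg (ρ (extChartAt 𝓘(ℝ, B) z.1 z.1)) h
      rwa [projRep, ContinuousLinearMap.comp_apply, hρι, hρι] at this)
    (ζ := ![_, _]) rfl rfl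
  have hL := fun f : F =>
    Trivialization.continuousLinearMapAt_symmL (R := ℝ) (trivializationAt F E z.1) hdom.1 f
  -- The equality in the trivialization is turned back into `X = ρ e` in the fibre of `E`, as `ι`
  -- and the trivialization are injective.
  have hbase : ∀ (X : TangentSpace 𝓘(ℝ, B) z.1) (f : F),
      homRep B F z.1 S.ι (extChartAt 𝓘(ℝ, B) z.1 z.1)
        (mvfderiv 𝓘(ℝ, B) (extChartAt 𝓘(ℝ, B) z.1) z.1 X)
        = S.projRep z.1 ρ (extChartAt 𝓘(ℝ, B) z.1 z.1) f →
      X = S.ρ z.1 ((trivializationAt F E z.1).symmL ℝ z.1 f) := fun X f h => by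
    obtain ⟨Y, v, hv, he⟩ := S.exists_decomp z.1 ((trivializationAt F E z.1).symmL ℝ z.1 f)
    have h2 := (hρ.eventually_apply.self_of_nhds Y v hv).2
    rw [← he, hL, ← h, S.homRep_ι_apply hdom.2] at h2
    rw [he, map_add, S.ρ_ι, S.ρ_V _ _ hv, add_zero]
    exact S.ι_injective _ (continuousLinearMapAt_injective (B := B) hdom h2)
  refine ⟨⟨(trivializationAt F E z.1).symmL ℝ z.1 (d 0),
    (trivializationAt F E z.1).symmL ℝ z.1 (d 1),
    h𝕀.memKerAddI (hΩU z hz) (continuousLinearMapAt_injective (B := B) hdom ?_),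
    hbase _ _ (hdζ 0), hbase _ _ (hdζ 1)⟩, hver⟩
  rw [← twistorRep_apply hdom, hL, hL, hd]

end AlmostFQuaternionic
end Integrability
end FQuat
end

theorem corollary3p4
    {B : Type*} [NormedAddCommGroup B] [NormedSpace ℝ B] [FiniteDimensional ℝ B]
    {M : Type*} [TopologicalSpace M] [ChartedSpace B M] [IsManifold 𝓘(ℝ, B) ∞ M] [T2Space M]
    {F : Type*} [NormedAddCommGroup F] [NormedSpace ℝ F] [FiniteDimensional ℝ F]
    {E : M → Type*} [TopologicalSpace (TotalSpace F E)]
    [∀ x, AddCommGroup (E x)] [∀ x, Module ℝ (E x)] [∀ x, TopologicalSpace (E x)]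
    [∀ x, IsTopologicalAddGroup (E x)] [∀ x, ContinuousSMul ℝ (E x)]
    [FiberBundle F E] [VectorBundle ℝ F E] [ContMDiffVectorBundle ∞ F E 𝓘(ℝ, B)]
    (S : FQuat.AlmostFQuaternionic (M := M) B F E)
    (D : CovariantDerivative 𝓘(ℝ, B) B (TangentSpace 𝓘(ℝ, B) : M → Type _))
    (nabla : CovariantDerivative 𝓘(ℝ, B) F E)
    (hsmooth : CovariantDerivative.ContMDiffCovariantDerivative nabla ∞)
    (hD : ∀ x, D.torsion x = 0)
    (hind : S.IsInducedBy nabla D)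
    (r : ℕ) (hr : ∀ x, Module.finrank ℝ (S.V x) = r)
    (hrank : (4 * r < Module.finrank ℝ F ∧ 8 ≤ 4 * r) ∨
      (Module.finrank ℝ F = 4 * r ∧ 12 ≤ 4 * r)) :
    S.IsIntegrable nabla :=
  ⟨FQuat.AlmostFQuaternionic.coCRIntegrable hsmooth hD hind hr hrank,
    FQuat.AlmostFQuaternionic.cRIntegrable hsmooth hD hind hr hrank⟩
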